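/- **Setting.** Let $\theta\in\mathbb R$ and put $\beta_1=\frac{\cos\theta}{\sqrt2}-\frac{\sin\theta}{\sqrt6}$, $\beta_2=-\frac{\cos\theta}{\sqrt2}-\frac{\sin\theta}{\sqrt6}$, $\beta_3=\frac{2\sin\theta}{\sqrt6}$, $\gamma_1=-\frac{\cos\theta}{\sqrt6}-\frac{\sin\theta}{\sqrt2}$, $\gamma_2=-\frac{\cos\theta}{\sqrt6}+\frac{\sin\theta}{\sqrt2}$, $\gamma_3=\frac{2\cos\theta}{\sqrt6}$, $a=\frac16$, $b=-\frac12\beta_1\beta_2\beta_3$, $c=-\frac12\gamma_1\gamma_2\gamma_3$. Let $y_j,z_j:\mathbb R\to\mathbb C$ $(j=1,2,3)$ and $v,w:\mathbb R\to\mathbb R$ satisfy, for all $s,t\in\mathbb R$ and with indices taken cyclically, $$\frac{dy_j}{ds}=\beta_j\overline{y_{j+1}y_{j+2}},\quad \frac{dz_j}{dt}=\gamma_j\overline{z_{j+1}z_{j+2}},\quad |y_j|^2=\beta_jv+1,\quad |z_j|^2=\gamma_jw+1 .$$ Let $B=\operatorname{Im}(y_1y_2y_3)(0)$ and $C=\operatorname{Im}(z_1z_2z_3)(0)$.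 With $z=s+it$ as complex coordinate on $\mathbb R^2$, define vectors in $\mathbb C^3$, for $j=1,2,3$, $$X^0_j=y_jz_j,\qquad X^{\pm}_j=\beta_j\overline{y_{j+1}y_{j+2}}\,z_j\mp i\gamma_jy_j\overline{z_{j+1}z_{j+2}},$$ and $\phi_0=\frac1{\sqrt3}X^0$, $\phi_1=\frac1{2\sqrt3}X^+$, $\phi_{-1}=-\frac{1}{2\sqrt3\,(a+bv+cw)}X^-$, where $\phi_{-1}$ is considered where $a+bv+cw\ne0$. Then $X^0$ has no zeros; let $\psi=[X^0]:\mathbb R^2\to\mathbb{CP}^2$. **Definitions.** A smooth map $\mathbb R^2\to\mathbb{CP}^{m-1}$ (Fubini–Study metric) is *harmonic* if it is a critical point of the energy under all smooth compactly supported variations. The *harmonic sequence* of a harmonic map $\psi$ consists of harmonic maps $\psi_k:\mathbb R^2\to\mathbb{CP}^{m-1}$, for $k$ in an interval $I\ni0$ of $\mathbb Z$, with $\psi_0=\psi$, for which there are a closed discrete set $D\subset\mathbb R^2$ and maps $\phi_k$ to $\mathbb C^m$ such that $\phi_0$ is smooth and nowhere zero on $\mathbb R^2$ with $[\phi_0]=\psi_0$,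 and such that off $D$, for all $k\in I$, $\phi_k$ is smooth and nonzero, $[\phi_k]=\psi_k$, and $$\langle\phi_k,\phi_{k+1}\rangle=0,\quad \frac{\partial\phi_k}{\partial z}=\phi_{k+1}+\frac{\partial}{\partial z}\bigl(\log|\phi_k|^2\bigr)\phi_k,\quad \frac{\partial\phi_k}{\partial\bar z}=-\frac{|\phi_k|^2}{|\phi_{k-1}|^2}\phi_{k-1}.$$ Here $\phi_k=0$ for $k\notin I$, and the right side of the last equation is read as $0$ if $k-1\notin I$. A harmonic map $\psi$ is *non-isotropic* if it has a harmonic sequence with $I=\mathbb Z$, and *isotropic* otherwise; it is *superconformal* if it is non-isotropic and any $m$ consecutive terms of its harmonic sequence are mutually orthogonal at every point. **Proposition.** $\operatorname{Im}(y_1y_2y_3)\equiv B$ and $\operatorname{Im}(z_1z_2z_3)\equiv C$. (i) Suppose $bB$ and $cC$ are not both zero. Then $\psi$ is superconformal. Its harmonic sequence is defined for all $k\in\mathbb Z$, is $3$-periodic, and is given on all of $\mathbb R^2$ (where $X^-,X^0,X^+$ have no zeros) by $$\psi_{3k-1}=[X^-],\qquad \psi_{3k}=[X^0],\qquad \psi_{3k+1}=[X^+]\qquad(k\in\mathbb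 Z).$$ It is realized, with $D=\emptyset$, by a sequence $(\phi_k)_{k\in\mathbb Z}$ extending the above $\phi_{-1},\phi_0,\phi_1$, with $\phi_2=\xi\phi_{-1}$ and $\phi_{k+3}=\xi\phi_k$ for all $k$, where $\xi=cC-ibB$. (ii) Suppose $bB=cC=0$. Then $\psi$ is isotropic. If moreover $\psi$ is not constant, its harmonic sequence is exactly $\psi_{-1},\psi_0,\psi_1$, where $\psi_0=[X^0]$ and, off the closed discrete set $D=\{a+bv+cw=0\}$, $X^\pm$ have no zeros and $\psi_{-1}=[X^-]$, $\psi_1=[X^+]$; the maps $\psi_{\pm1}$ are smooth and harmonic on all of $\mathbb R^2$. It is realized by the above $\phi_{-1},\phi_0,\phi_1$. -/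

import Mathlib

open scoped ContDiff LinearAlgebra.Projectivization

noncomputable section

/-! ### Harmonic maps from the plane to complex projective space

The plane is `ℂ` with coordinate `x + i y`, and complex projective space of dimension `m - 1` is
the space of lines in the Hermitian space `ℂ^m`. -/

/-- Complex projective space: the space of complex lines in `ℂ^m`. -/
abbrev CProj (m : ℕ) : Type := ℙ ℂ (EuclideanSpace ℂ (Fin m))

/-- The orthogonal projection onto a line.  This is the standard smooth embedding of projective
space as a submanifold of the real vector space of Hermitian endomorphisms of `ℂ^m`. -/
def lineProj {m : ℕ} (x : CProj m) : EuclideanSpace ℂ (Fin m) →L[ℂ] EuclideanSpace ℂ (Fin m) :=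
  x.submodule.starProjection

/-- Smooth maps from the plane to projective space. -/
def IsSmoothMap {m : ℕ} (f : ℂ → CProj m) : Prop :=
  ContDiff ℝ ∞ fun p => lineProj (f p)

/-- The squared Hilbert-Schmidt norm of an endomorphism of `ℂ^m`. -/
def hsNormSq {m : ℕ} (A : EuclideanSpace ℂ (Fin m) →L[ℂ] EuclideanSpace ℂ (Fin m)) : ℝ :=
  ∑ i, ‖A (EuclideanSpace.single i 1)‖ ^ 2

/-- The squared length `|df|²` of the differential of a map from the Euclidean plane to projective
space with its Fubini-Study metric.  The latter is induced, under the embedding `lineProj`, by half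
of the Hilbert-Schmidt inner product (the factor gives holomorphic sectional curvature `4`). -/
def energyDensity {m : ℕ} (f : ℂ → CProj m) (p : ℂ) : ℝ :=
  (hsNormSq (fderiv ℝ (fun q => lineProj (f q)) p 1) +
    hsNormSq (fderiv ℝ (fun q => lineProj (f q)) p Complex.I)) / 2

/-- A smooth variation of `f` that is supported in the set `K`. -/
structure IsVariation {m : ℕ} (f : ℂ → CProj m) (K : Set ℂ) (F : ℝ → ℂ → CProj m) : Prop where
  smooth : ContDiff ℝ ∞ fun q : ℝ × ℂ => lineProj (F q.1 q.2)
  zero : F 0 = f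
  fixed : ∀ ε, ∀ p ∉ K, F ε p = f p

/-- Harmonic maps: the smooth critical points of the energy with respect to all smooth compactly
supported variations. -/
def IsHarmonicMap {m : ℕ} (f : ℂ → CProj m) : Prop :=
  IsSmoothMap f ∧ ∀ (K : Set ℂ) (F : ℝ → ℂ → CProj m), IsCompact K → IsVariation f K F →
    HasDerivAt (fun ε => ∫ p in K, energyDensity (F ε) p) 0 0

/-! ### The harmonic sequence -/

/-- The operator `∂/∂z = (∂/∂x - i ∂/∂y) / 2` on functions with values in a complex space. -/
def dZ {V : Type*} [NormedAddCommGroup V] [NormedSpace ℂ V] (f : ℂ → V) (p : ℂ) : V :=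
  (2⁻¹ : ℂ) • (fderiv ℝ f p 1 - Complex.I • fderiv ℝ f p Complex.I)

/-- The operator `∂/∂z̄ = (∂/∂x + i ∂/∂y) / 2` on functions with values in a complex space. -/
def dZbar {V : Type*} [NormedAddCommGroup V] [NormedSpace ℂ V] (f : ℂ → V) (p : ℂ) : V :=
  (2⁻¹ : ℂ) • (fderiv ℝ f p 1 + Complex.I • fderiv ℝ f p Complex.I)

/-- `φ k`, for `k` in the set of indices `I`, are the distinguished sections of the line bundles
`L_k` given by the maps `Ψ k`, with exceptional set `D`.

The section `φ 0` of `L_0` is smooth and nowhere zero.  The other sections are only required to be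
smooth and nonzero off the closed discrete set `D`, where they may have zeros or poles.
Off `D` the equations of the harmonic sequence hold for all `k` in `I`.  These include
`⟪φ k, ∂φ k/∂z̄⟫ = 0`, which says that `φ k` is a holomorphic section of `L_k`.

Outside `I` we put `φ k = 0`, and so at the top index `k` of `I`, if there is one, the second
equation says `∂φ k/∂z = (∂/∂z log ‖φ k‖²) φ k`, and at the bottom index the third equation says
`∂φ k/∂z̄ = 0`: the sequence terminates at these places. -/
structure IsHarmonicLift {m : ℕ} (I : Set ℤ) (D : Set ℂ) (Ψ : ℤ → ℂ → CProj m)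
    (φ : ℤ → ℂ → EuclideanSpace ℂ (Fin m)) : Prop where
  discrete : ∀ p, ∀ᶠ q in nhdsWithin p {p}ᶜ, q ∉ D
  closed : IsClosed D
  smooth_zero : ContDiff ℝ ∞ (φ 0)
  lift_zero : ∀ p, ∃ h : φ 0 p ≠ 0, Ψ 0 p = Projectivization.mk ℂ (φ 0 p) h
  smooth : ∀ k ∈ I, ContDiffOn ℝ ∞ (φ k) Dᶜ
  lift : ∀ k ∈ I, ∀ p ∉ D, ∃ h : φ k p ≠ 0, Ψ k p = Projectivization.mk ℂ (φ k p) h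
  outside : ∀ k ∉ I, ∀ p, φ k p = 0
  orthogonal : ∀ k ∈ I, ∀ p ∉ D, inner ℂ (φ k p) (φ (k + 1) p) = 0
  dZ_eq : ∀ k ∈ I, ∀ p ∉ D, dZ (φ k) p =
    φ (k + 1) p + dZ (fun q => ((Real.log (‖φ k q‖ ^ 2) : ℝ) : ℂ)) p • φ k p
  dZbar_eq : ∀ k ∈ I, ∀ p ∉ D, dZbar (φ k) p =
    -(((‖φ k p‖ ^ 2 / ‖φ (k - 1) p‖ ^ 2 : ℝ) : ℂ) • φ (k - 1) p)

/-- `Ψ k`, for `k` in the interval of integers `I`, is the harmonic sequence of the map `ψ`, with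
distinguished sections `φ k` and exceptional set `D`.  The maps `Ψ k` with `k` in `I` are harmonic
on the whole plane, also at the points of `D`. -/
structure IsHarmonicSequenceWith {m : ℕ} (ψ : ℂ → CProj m) (I : Set ℤ) (D : Set ℂ)
    (Ψ : ℤ → ℂ → CProj m) (φ : ℤ → ℂ → EuclideanSpace ℂ (Fin m)) : Prop where
  interval : I.OrdConnected
  zero_mem : (0 : ℤ) ∈ I
  zero : Ψ 0 = ψ
  harmonic : ∀ k ∈ I, IsHarmonicMap (Ψ k)
  isLift : IsHarmonicLift I D Ψ φ

/-- `Ψ k`, for `k` in the interval of integers `I`, is the harmonic sequence of `ψ`. -/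
def IsHarmonicSequence {m : ℕ} (ψ : ℂ → CProj m) (I : Set ℤ) (Ψ : ℤ → ℂ → CProj m) : Prop :=
  ∃ (D : Set ℂ) (φ : ℤ → ℂ → EuclideanSpace ℂ (Fin m)), IsHarmonicSequenceWith ψ I D Ψ φ

/-- A harmonic map is non-isotropic if all the terms of its harmonic sequence exist. -/
def IsNonisotropic {m : ℕ} (ψ : ℂ → CProj m) : Prop :=
  IsHarmonicMap ψ ∧ ∃ Ψ, IsHarmonicSequence ψ Set.univ Ψ

/-- A harmonic map is isotropic if not all the terms of its harmonic sequence exist. -/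
def IsIsotropic {m : ℕ} (ψ : ℂ → CProj m) : Prop :=
  IsHarmonicMap ψ ∧ ¬ IsNonisotropic ψ

/-- Two maps to projective space are orthogonal if they give orthogonal lines at all points. -/
def OrthogonalMaps {m : ℕ} (f g : ℂ → CProj m) : Prop :=
  ∀ p, (f p).submodule ⟂ (g p).submodule

/-- A harmonic map `ψ` to projective space of dimension `m - 1` is superconformal if it is
non-isotropic and every `m` consecutive terms of its harmonic sequence are mutually orthogonal. -/
def IsSuperconformal {m : ℕ} (ψ : ℂ → CProj m) : Prop :=
  IsNonisotropic ψ ∧ ∃ Ψ, IsHarmonicSequence ψ Set.univ Ψ ∧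
    ∀ j k : ℤ, j < k → k < j + m → OrthogonalMaps (Ψ j) (Ψ k)

/-! ### The family of maps

The indices `1, 2, 3` are `0, 1, 2` in `Fin 3`, where addition is cyclic. -/

namespace SLCone

/-- The constants `β_j`. -/
def β (θ : ℝ) : Fin 3 → ℝ :=
  ![Real.cos θ / √2 - Real.sin θ / √6, -(Real.cos θ / √2) - Real.sin θ / √6, 2 * Real.sin θ / √6]

/-- The constants `γ_j`. -/
def γ (θ : ℝ) : Fin 3 → ℝ :=
  ![-(Real.cos θ / √6) - Real.sin θ / √2, -(Real.cos θ / √6) + Real.sin θ / √2, 2 * Real.cos θ / √6]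

def a : ℝ := 1 / 6

def b (θ : ℝ) : ℝ := -(1 / 2) * (β θ 0 * β θ 1 * β θ 2)

def c (θ : ℝ) : ℝ := -(1 / 2) * (γ θ 0 * γ θ 1 * γ θ 2)

/-- The functions `y_j, z_j, v, w` that define a map of the family: `dy_1/ds` is `β_1` times the
complex conjugate of `y_2 y_3`, and cyclically, `|y_j|² = β_j v + 1`, and likewise for `z_j`. -/
structure IsData (θ : ℝ) (y z : Fin 3 → ℝ → ℂ) (v w : ℝ → ℝ) : Prop where
  y_deriv : ∀ j s, HasDerivAt (y j) ((β θ j : ℂ) * star (y (j + 1) s * y (j + 2) s)) s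
  z_deriv : ∀ j t, HasDerivAt (z j) ((γ θ j : ℂ) * star (z (j + 1) t * z (j + 2) t)) t
  y_norm : ∀ j s, ‖y j s‖ ^ 2 = β θ j * v s + 1
  z_norm : ∀ j t, ‖z j t‖ ^ 2 = γ θ j * w t + 1

/-- The vector with components `y_1 z_1, y_2 z_2, y_3 z_3` at the point `s + i t`. -/
def vec₀ (y z : Fin 3 → ℝ → ℂ) (p : ℂ) : EuclideanSpace ℂ (Fin 3) :=
  WithLp.toLp 2 fun j => y j p.re * z j p.im

/-- The vector whose first component is `β_1` times the conjugate of `y_2 y_3` times `z_1`, plus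
`i γ_1 y_1` times the conjugate of `z_2 z_3`, and cyclically. -/
def vecNeg (θ : ℝ) (y z : Fin 3 → ℝ → ℂ) (p : ℂ) : EuclideanSpace ℂ (Fin 3) :=
  WithLp.toLp 2 fun j =>
    (β θ j : ℂ) * star (y (j + 1) p.re * y (j + 2) p.re) * z j p.im +
      Complex.I * (γ θ j : ℂ) * y j p.re * star (z (j + 1) p.im * z (j + 2) p.im)

/-- The vector whose first component is `β_1` times the conjugate of `y_2 y_3` times `z_1`, minus
`i γ_1 y_1` times the conjugate of `z_2 z_3`, and cyclically. -/
def vecPos (θ : ℝ) (y z : Fin 3 → ℝ → ℂ) (p : ℂ) : EuclideanSpace ℂ (Fin 3) :=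
  WithLp.toLp 2 fun j =>
    (β θ j : ℂ) * star (y (j + 1) p.re * y (j + 2) p.re) * z j p.im -
      Complex.I * (γ θ j : ℂ) * y j p.re * star (z (j + 1) p.im * z (j + 2) p.im)

/-- The function `a + b v(s) + c w(t)` at the point `s + i t`. -/
def weight (θ : ℝ) (v w : ℝ → ℝ) (p : ℂ) : ℝ := a + b θ * v p.re + c θ * w p.im

/-- The map `φ = φ_0` to the unit sphere. -/
def phi₀ (y z : Fin 3 → ℝ → ℂ) (p : ℂ) : EuclideanSpace ℂ (Fin 3) :=
  ((1 / √3 : ℝ) : ℂ) • vec₀ y z p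

/-- The section `φ_{-1}`. -/
def phiNeg (θ : ℝ) (y z : Fin 3 → ℝ → ℂ) (v w : ℝ → ℝ) (p : ℂ) : EuclideanSpace ℂ (Fin 3) :=
  ((-(1 / (2 * √3 * weight θ v w p)) : ℝ) : ℂ) • vecNeg θ y z p

/-- The section `φ_1`. -/
def phiPos (θ : ℝ) (y z : Fin 3 → ℝ → ℂ) (p : ℂ) : EuclideanSpace ℂ (Fin 3) :=
  ((1 / (2 * √3) : ℝ) : ℂ) • vecPos θ y z p

theorem vec₀_ne_zero {θ : ℝ} {y z : Fin 3 → ℝ → ℂ} {v w : ℝ → ℝ} (h : IsData θ y z v w) (p : ℂ) :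
    vec₀ y z p ≠ 0 := by
  intro h0
  have hj : ∀ j, (β θ j * v p.re + 1) * (γ θ j * w p.im + 1) = 0 := by
    intro j
    have h1 : y j p.re * z j p.im = 0 := by
      have := congrArg (fun x : EuclideanSpace ℂ (Fin 3) => x j) h0
      simpa [vec₀] using this
    rw [← h.y_norm, ← h.z_norm, ← mul_pow, ← norm_mul, h1]
    simp
  have e0 := hj 0
  have e1 := hj 1
  have e2 := hj 2
  have s2 : (√2)⁻¹ ^ 2 = (1 / 2 : ℝ) := by rw [inv_pow, Real.sq_sqrt (by norm_num)]; norm_num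
  have s6 : (√6)⁻¹ ^ 2 = (1 / 6 : ℝ) := by rw [inv_pow, Real.sq_sqrt (by norm_num)]; norm_num
  have hsum : β θ 0 * γ θ 0 + β θ 1 * γ θ 1 + β θ 2 * γ θ 2 = 0 := by
    simp [β, γ, div_eq_mul_inv]
    linear_combination (-2 * Real.cos θ * Real.sin θ) * s2 + (6 * Real.cos θ * Real.sin θ) * s6
  have hb : β θ 0 + β θ 1 + β θ 2 = 0 := by simp [β, div_eq_mul_inv]; ring
  have hc : γ θ 0 + γ θ 1 + γ θ 2 = 0 := by simp [γ, div_eq_mul_inv]; ring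
  have : (3 : ℝ) = 0 := by
    linear_combination e0 + e1 + e2 - v p.re * w p.im * hsum - v p.re * hb - w p.im * hc
  norm_num at this

/-- The map `ψ` to the complex projective plane, `s + i t ↦ [y_1 z_1, y_2 z_2, y_3 z_3]`. -/
def psi {θ : ℝ} {y z : Fin 3 → ℝ → ℂ} {v w : ℝ → ℝ} (h : IsData θ y z v w) (p : ℂ) : CProj 3 :=
  Projectivization.mk ℂ (vec₀ y z p) (vec₀_ne_zero h p)

end SLCone

end

/-! Write `W = a + b v + c w`. Everything follows from the structure equations of the frame `X⁻, X⁰,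
X⁺`. The three vectors are mutually orthogonal, with `|X⁰|² = 3` and `|X^±|² = 12 W`
(`inner_mixVec_mixVec`). The derivatives are `∂X⁰/∂z = X⁺/2`, `∂X⁰/∂z̄ = X⁻/2`, `∂X⁺/∂z̄ = ∂X⁻/∂z =
-2 W X⁰`. Where `W ≠ 0` also `∂X⁺/∂z = (W_z X⁺ - ξ X⁻) / W` and `∂X⁻/∂z̄ = (W_z̄ X⁻ + ξ̄ X⁺) / W`.
They rest on trigonometric identities among the constants. The number `ξ` is constant because `y_1
y_2 y_3` and `z_1 z_2 z_3` have real derivatives. After the rescaling to `φ_{-1}, φ_0, φ_1` these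
are the equations of a harmonic sequence with `φ_2 = ξ φ_{-1}`.

Harmonicity is tested on the projection `P` onto the line. The first variation of the energy is `-∫
⟨ΔP, Q⟩` for a field `Q = QP + PQ`, which is off-diagonal with respect to `P`; so it suffices that
`ΔP` commutes with `P` (`isHarmonicMap_of_commute`). By the structure equations `ΔP` is diagonal in
the frame for each of the three lines, where `W ≠ 0` in the case of `X^±`.

If `ξ ≠ 0`, then `W` has no zeros: at a zero both `X^±` would vanish, which together with `bB ≠ 0`
or `cC ≠ 0` would give `X⁰ = 0`. The sections then repeat with factor `ξ`.

If `ξ = 0`, any harmonic sequence of `ψ` has `φ_0 = g X⁰` and `φ_1 = (g/2) X⁺`, and `φ_2` is both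
parallel and orthogonal to `X⁺`, hence zero. So `ψ` is isotropic. For nonconstant `ψ` the zeros of
`W` are isolated. They cannot occur if `b = 0` or `c = 0`, by a Gronwall argument. Otherwise `B = C
= 0`, and the zeros lie at nondegenerate critical points of `v` and `w`. In this last case `ψ` is
real up to constant phases, a map to a sphere, and `X^±` are the eigenvectors of the cross product
with `X⁰`. Hence the projections onto their lines are `(1 - P₀ ± T) / 2` with `T` smooth everywhere,
and the lines extend over the zeros of `W` (`crossMap_eq`, `exists_harmonic_extension`). -/

/-! ### The Hilbert-Schmidt inner product and tangent vectors at a projection -/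

/-- The real inner product on endomorphisms of `ℂ^m` whose square norm is `hsNormSq`. -/
noncomputable def hsInner (m : ℕ) :
    (EuclideanSpace ℂ (Fin m) →L[ℂ] EuclideanSpace ℂ (Fin m)) →L[ℝ]
      (EuclideanSpace ℂ (Fin m) →L[ℂ] EuclideanSpace ℂ (Fin m)) →L[ℝ] ℝ :=
  LinearMap.mkContinuous₂
    (LinearMap.mk₂ ℝ (fun A C => ∑ i, (inner ℂ (A (EuclideanSpace.single i 1))
        (C (EuclideanSpace.single i 1))).re)
      (fun A A' C => by simp [Finset.sum_add_distrib])
      (fun r A C => by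
        simp only [smul_apply, Finset.smul_sum]
        refine Finset.sum_congr rfl fun i _ => ?_
        rw [← Complex.coe_smul r, inner_smul_left]; simp)
      (fun A C C' => by simp [Finset.sum_add_distrib])
      (fun r A C => by
        simp only [smul_apply, Finset.smul_sum]
        refine Finset.sum_congr rfl fun i _ => ?_
        rw [← Complex.coe_smul r, inner_smul_right]; simp))
    m (fun A C => by
      simp only [LinearMap.mk₂_apply]
      calc ‖∑ i : Fin m, (inner ℂ (A (EuclideanSpace.single i 1))
              (C (EuclideanSpace.single i 1))).re‖
          ≤ ∑ _i : Fin m, ‖A‖ * ‖C‖ := by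
            refine norm_sum_le_of_le _ fun i _ => ?_
            refine (Complex.abs_re_le_norm _).trans ((norm_inner_le_norm _ _).trans ?_)
            have hA := A.le_opNorm (EuclideanSpace.single i 1)
            have hC := C.le_opNorm (EuclideanSpace.single i 1)
            simp only [PiLp.norm_single, norm_one, mul_one] at hA hC
            gcongr
        _ = m * ‖A‖ * ‖C‖ := by simp [mul_assoc])

section hs
variable {m : ℕ}

theorem hsInner_apply (A C : EuclideanSpace ℂ (Fin m) →L[ℂ] EuclideanSpace ℂ (Fin m)) :
    hsInner m A C = ∑ i, (inner ℂ (A (EuclideanSpace.single i 1))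
        (C (EuclideanSpace.single i 1))).re := rfl

theorem hsInner_comm (A C : EuclideanSpace ℂ (Fin m) →L[ℂ] EuclideanSpace ℂ (Fin m)) :
    hsInner m A C = hsInner m C A := by
  simp only [hsInner_apply]
  exact Finset.sum_congr rfl fun i _ => by
    rw [← inner_conj_symm, Complex.conj_re]

theorem hsInner_self (A : EuclideanSpace ℂ (Fin m) →L[ℂ] EuclideanSpace ℂ (Fin m)) :
    hsInner m A A = hsNormSq A := by
  simp only [hsInner_apply, hsNormSq]
  exact Finset.sum_congr rfl fun i _ => inner_self_eq_norm_sq (𝕜 := ℂ) _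

theorem hsInner_eq_trace (A C : EuclideanSpace ℂ (Fin m) →L[ℂ] EuclideanSpace ℂ (Fin m)) :
    hsInner m A C = (LinearMap.trace ℂ _ (star A * C).toLinearMap).re := by
  rw [LinearMap.trace_eq_sum_inner _ (EuclideanSpace.basisFun (Fin m) ℂ), Complex.re_sum,
    hsInner_apply]
  refine Finset.sum_congr rfl fun i _ => ?_
  simp [ContinuousLinearMap.star_eq_adjoint, ContinuousLinearMap.adjoint_inner_right]

theorem hsInner_mul_left (A B C : EuclideanSpace ℂ (Fin m) →L[ℂ] EuclideanSpace ℂ (Fin m)) :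
    hsInner m A (B * C) = hsInner m (star B * A) C := by
  simp [hsInner_eq_trace, mul_assoc]

theorem hsInner_mul_right (A B C : EuclideanSpace ℂ (Fin m) →L[ℂ] EuclideanSpace ℂ (Fin m)) :
    hsInner m A (B * C) = hsInner m (A * star C) B := by
  simp only [hsInner_eq_trace, star_mul, star_star]
  rw [← mul_assoc, ContinuousLinearMap.toLinearMap_mul, LinearMap.trace_mul_comm,
    ← ContinuousLinearMap.toLinearMap_mul, mul_assoc]

/-- A tangent vector to the Grassmannian at a projection is orthogonal to everything that commutes
with the projection. -/
theorem hsInner_eq_zero_of_commute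
    {P L Q : EuclideanSpace ℂ (Fin m) →L[ℂ] EuclideanSpace ℂ (Fin m)}
    (hP : P * P = P) (hs : star P = P) (hQ : Q = Q * P + P * Q) (hL : Commute P L) :
    hsInner m L Q = 0 := by
  -- Sandwiching `Q = QP + PQ` between two factors `P` doubles `PQP`, so this diagonal block
  -- vanishes.
  have h0 : P * Q * P = 0 := by
    have h1 : P * Q * P = P * (Q * P + P * Q) * P := by rw [← hQ]
    have h2 : P * (Q * P + P * Q) * P = P * Q * P + P * Q * P := by
      rw [mul_add, add_mul, ← mul_assoc P P Q, hP, mul_assoc P (Q * P) P, mul_assoc Q P P, hP,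
        mul_assoc P Q P]
    rw [h2] at h1
    exact left_eq_add.mp h1
  -- As `L` commutes with `P`, moving factors `P` around the trace replaces `PQ` by `PQP`.
  have h3 : hsInner m L (P * Q) = 0 := by
    have e : hsInner m L (P * Q) = hsInner m L (P * Q * P) := by
      rw [hsInner_mul_left, hs, mul_assoc P Q P, hsInner_mul_left, hs, hsInner_mul_right, hs,
        mul_assoc, ← hL.eq, ← mul_assoc, hP]
    rw [e, h0, map_zero]
  have h4 : hsInner m L (Q * P) = 0 := by
    rw [hsInner_mul_right, hs, ← hL.eq, ← h3, hsInner_mul_left, hs]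
  rw [hQ, map_add, h3, h4, add_zero]

theorem lineProj_mul_self (x : CProj m) : lineProj x * lineProj x = lineProj x :=
  Submodule.isIdempotentElem_starProjection _

theorem star_lineProj (x : CProj m) : star (lineProj x) = lineProj x :=
  (isSelfAdjoint_starProjection _).star_eq

end hs

/-! ### First variation of the energy -/

/-- The derivative is continuous, hence bounded on the compact set `[ε₀ - 1, ε₀ + 1] × K`; a
constant dominates on a set of finite measure. -/
theorem hasDerivAt_setIntegral_of_contDiff {g : ℝ × ℂ → ℝ} (hg : ContDiff ℝ 1 g) {K : Set ℂ}
    (hK : IsCompact K) (ε₀ : ℝ) :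
    HasDerivAt (fun ε => ∫ p in K, g (ε, p)) (∫ p in K, fderiv ℝ g (ε₀, p) (1, 0)) ε₀ := by
  have hc : Continuous fun q : ℝ × ℂ => fderiv ℝ g q (1, 0) :=
    (hg.continuous_fderiv (by simp)).clm_apply continuous_const
  obtain ⟨M, hM⟩ := ((isCompact_Icc (a := ε₀ - 1) (b := ε₀ + 1)).prod hK).exists_bound_of_continuousOn
    hc.continuousOn
  have hfin : MeasureTheory.volume K < ⊤ := hK.measure_lt_top
  have : MeasureTheory.IsFiniteMeasure (MeasureTheory.volume.restrict K) :=
    ⟨by simpa using hfin⟩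
  refine (hasDerivAt_integral_of_dominated_loc_of_deriv_le (s := Set.Icc (ε₀ - 1) (ε₀ + 1))
    (bound := fun _ => M) (F' := fun ε p => fderiv ℝ g (ε, p) (1, 0))
    (Icc_mem_nhds (by linarith) (by linarith)) ?_ ?_ ?_ ?_ ?_ ?_).2
  · exact Filter.Eventually.of_forall fun ε =>
      (hg.continuous.comp (by fun_prop)).aestronglyMeasurable
  · exact (hg.continuous.comp (by fun_prop)).continuousOn.integrableOn_compact hK
  · exact (hc.comp (by fun_prop : Continuous fun p : ℂ => (ε₀, p))).aestronglyMeasurable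
  · refine (MeasureTheory.ae_restrict_mem hK.measurableSet).mono fun p hp ε hε => ?_
    exact hM (ε, p) ⟨hε, hp⟩
  · exact MeasureTheory.integrable_const _
  · refine Filter.Eventually.of_forall fun p ε _ => ?_
    have h1 := (hg.differentiable (by simp) (ε, p)).hasFDerivAt
    exact h1.comp_hasDerivAt ε ((hasDerivAt_id ε).prodMk (hasDerivAt_const ε p))

/-- The Laplacian of a function on the plane. -/
noncomputable def planeLaplacian {V : Type*} [NormedAddCommGroup V] [NormedSpace ℝ V] (f : ℂ → V)
    (p : ℂ) : V :=
  fderiv ℝ (fun q => fderiv ℝ f q 1) p 1 + fderiv ℝ (fun q => fderiv ℝ f q Complex.I) p Complex.I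

theorem fderiv_curry_right {V : Type*} [NormedAddCommGroup V] [NormedSpace ℝ V] {g : ℝ × ℂ → V}
    (hg : ContDiff ℝ ∞ g) (ε : ℝ) (p e : ℂ) :
    fderiv ℝ (fun q => g (ε, q)) p e = fderiv ℝ g (ε, p) (0, e) := by
  have h1 := (hg.differentiable (by simp) (ε, p)).hasFDerivAt
  have h2 : HasFDerivAt (fun q : ℂ => (ε, q)) (ContinuousLinearMap.inr ℝ ℝ ℂ) p :=
    hasFDerivAt_prodMk_right ε p
  have h3 : HasFDerivAt (fun q => g (ε, q)) ((fderiv ℝ g (ε, p)).comp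
    (ContinuousLinearMap.inr ℝ ℝ ℂ)) p := h1.comp p h2
  rw [h3.fderiv]
  simp

theorem contDiff_fderiv_apply {V W : Type*} [NormedAddCommGroup V] [NormedSpace ℝ V]
    [NormedAddCommGroup W] [NormedSpace ℝ W] {g : W → V}
    (hg : ContDiff ℝ ∞ g) (e : W) : ContDiff ℝ ∞ fun q => fderiv ℝ g q e :=
  (hg.fderiv_right (m := ∞) (by simp)).clm_apply contDiff_const

theorem fderiv_fderiv_comm {V W : Type*} [NormedAddCommGroup V] [NormedSpace ℝ V]
    [NormedAddCommGroup W] [NormedSpace ℝ W] {g : W → V}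
    (hg : ContDiff ℝ ∞ g) (q e e' : W) :
    fderiv ℝ (fun q => fderiv ℝ g q e) q e' = fderiv ℝ (fun q => fderiv ℝ g q e') q e := by
  have hd : DifferentiableAt ℝ (fderiv ℝ g) q :=
    (hg.fderiv_right (m := ∞) (by simp)).differentiable (by simp) q
  rw [fderiv_clm_apply hd (differentiableAt_const _), fderiv_clm_apply hd (differentiableAt_const _)]
  have := (hg.contDiffAt (x := q)).isSymmSndFDerivAt (by simpa using WithTop.coe_le_coe.2 (le_top (a := (2 : ℕ∞))))
  simpa using this e' e

/-- Integration by parts has no boundary term since `Q` has compact support. The integrability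
claims serve to split the integral of a sum over the two directions. -/
theorem integral_hsInner_fderiv {m : ℕ}
    {A Q : ℂ → EuclideanSpace ℂ (Fin m) →L[ℂ] EuclideanSpace ℂ (Fin m)}
    (hA : ContDiff ℝ ∞ A) (hQ : ContDiff ℝ ∞ Q) (hs : HasCompactSupport Q) (e : ℂ) :
    MeasureTheory.Integrable (fun p => hsInner m (A p) (fderiv ℝ Q p e)) ∧
    MeasureTheory.Integrable (fun p => hsInner m (fderiv ℝ A p e) (Q p)) ∧
    ∫ p, hsInner m (A p) (fderiv ℝ Q p e) = - ∫ p, hsInner m (fderiv ℝ A p e) (Q p) := by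
  have hA' := contDiff_fderiv_apply hA e
  have hQ' := contDiff_fderiv_apply hQ e
  have hs' : HasCompactSupport fun p => fderiv ℝ Q p e := hs.fderiv_apply ℝ e
  have key : ∀ A Q : ℂ → EuclideanSpace ℂ (Fin m) →L[ℂ] EuclideanSpace ℂ (Fin m),
      ContDiff ℝ ∞ A → ContDiff ℝ ∞ Q → HasCompactSupport Q →
      MeasureTheory.Integrable (fun p => hsInner m (A p) (Q p)) := by
    intro A Q hA hQ hs
    refine Continuous.integrable_of_hasCompactSupport
      (((hsInner m).continuous.comp hA.continuous).clm_apply hQ.continuous) ?_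
    exact hs.mono fun p hp hq => hp (by simp only [hq, map_zero])
  refine ⟨key _ _ hA hQ' hs', key _ _ hA' hQ hs, ?_⟩
  exact integral_bilinear_fderiv_right_eq_neg_left_of_integrable (key _ _ hA' hQ hs)
    (key _ _ hA hQ' hs') (key _ _ hA hQ hs) (fun p _ => hA.differentiable (by simp) p)
    (fun p _ => hQ.differentiable (by simp) p)

/-- A smooth map to projective space is harmonic if the projection onto the line commutes with its
Laplacian at all points. -/
theorem isHarmonicMap_of_commute {m : ℕ} {f : ℂ → CProj m} (hf : IsSmoothMap f)
    (hL : ∀ p, Commute (lineProj (f p)) (planeLaplacian (fun q => lineProj (f q)) p)) :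
    IsHarmonicMap f := by
  refine ⟨hf, fun K F hK hF => ?_⟩
  set G : ℝ × ℂ → EuclideanSpace ℂ (Fin m) →L[ℂ] EuclideanSpace ℂ (Fin m) :=
    fun q => lineProj (F q.1 q.2) with hG
  have hGs : ContDiff ℝ ∞ G := hF.smooth
  set Q : ℂ → EuclideanSpace ℂ (Fin m) →L[ℂ] EuclideanSpace ℂ (Fin m) :=
    fun p => fderiv ℝ G (0, p) (1, 0) with hQ
  set P : ℂ → EuclideanSpace ℂ (Fin m) →L[ℂ] EuclideanSpace ℂ (Fin m) :=
    fun p => lineProj (f p) with hP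
  have hPs : ContDiff ℝ ∞ P := hf
  have hGP : ∀ p, G (0, p) = P p := fun p => by simp [hG, hP, hF.zero]
  have hQs : ContDiff ℝ ∞ Q := (contDiff_fderiv_apply hGs (1, 0)).comp (by fun_prop)
  have hcurve : ∀ p, HasDerivAt (fun ε : ℝ => G (ε, p)) (Q p) 0 := fun p => by
    have h1 := (hGs.differentiable (by simp) (0, p)).hasFDerivAt
    exact h1.comp_hasDerivAt (0 : ℝ)
      ((hasDerivAt_id (0 : ℝ)).prodMk (hasDerivAt_const (0 : ℝ) p))
  have hQ0 : ∀ p ∉ K, Q p = 0 := by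
    intro p hp
    refine (hcurve p).unique ?_
    have : (fun ε : ℝ => G (ε, p)) = fun _ => P p := by
      funext ε; simp [hG, hP, hF.fixed ε p hp]
    rw [this]; exact hasDerivAt_const _ _
  -- Differentiate the idempotent law along the variation: the variation field is tangent to the
  -- space of projections.
  have hQeq : ∀ p, Q p = Q p * P p + P p * Q p := by
    intro p
    refine (hcurve p).unique ?_
    have h1 := (hcurve p).mul (hcurve p)
    rw [hGP] at h1
    refine h1.congr_of_eventuallyEq (Filter.Eventually.of_forall fun ε => ?_)
    exact (lineProj_mul_self _).symm
  have hsupp : HasCompactSupport Q := HasCompactSupport.intro hK hQ0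
  have hder0 : ∀ p ∉ K, ∀ e, fderiv ℝ Q p e = 0 := by
    intro p hp e
    have : Q =ᶠ[nhds p] fun _ => 0 :=
      Filter.eventually_of_mem (hK.isClosed.isOpen_compl.mem_nhds hp) fun q hq => hQ0 q hq
    rw [this.fderiv_eq]; simp
  -- Symmetry of mixed partial derivatives: the variation of `∂P/∂e` is `∂Q/∂e`.
  have hpart : ∀ e : ℂ, ∀ p, fderiv ℝ (fun q => fderiv ℝ G q (0, e)) (0, p) (1, 0) =
      fderiv ℝ Q p e := by
    intro e p
    rw [fderiv_fderiv_comm hGs, hQ, fderiv_curry_right (contDiff_fderiv_apply hGs (1, 0))]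
  have hGe : ∀ e : ℂ, ∀ p, fderiv ℝ G (0, p) (0, e) = fderiv ℝ P p e := by
    intro e p
    rw [← fderiv_curry_right hGs]
    simp only [hGP]
  have hcd : ∀ e : ℂ, ContDiff ℝ ∞ fun q =>
      hsInner m (fderiv ℝ G q (0, e)) (fderiv ℝ G q (0, e)) := fun e => by
    have h1 : ContDiff ℝ ∞ fun q => hsInner m (fderiv ℝ G q (0, e)) :=
      contDiff_const.clm_apply (contDiff_fderiv_apply hGs (0, e))
    exact h1.clm_apply (contDiff_fderiv_apply hGs (0, e))
  have hcdd : ∀ e : ℂ, ∀ p, fderiv ℝ (fun q =>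
      hsInner m (fderiv ℝ G q (0, e)) (fderiv ℝ G q (0, e))) (0, p) (1, 0) =
      2 * hsInner m (fderiv ℝ P p e) (fderiv ℝ Q p e) := by
    intro e p
    have hd := ((contDiff_fderiv_apply hGs (0, e)).differentiable (by simp) (0, p)).hasFDerivAt
    rw [((hsInner m).hasFDerivAt_of_bilinear hd hd).fderiv]
    simp [hpart, hGe, two_mul]
    rw [hsInner_comm]
  have hE : ∀ ε p, energyDensity (F ε) p =
      (hsInner m (fderiv ℝ G (ε, p) (0, 1)) (fderiv ℝ G (ε, p) (0, 1)) +
        hsInner m (fderiv ℝ G (ε, p) (0, Complex.I)) (fderiv ℝ G (ε, p) (0, Complex.I))) / 2 := by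
    intro ε p
    rw [energyDensity, hsInner_self, hsInner_self, ← fderiv_curry_right hGs,
      ← fderiv_curry_right hGs]
  have hmain := hasDerivAt_setIntegral_of_contDiff
    ((((hcd 1).add (hcd Complex.I)).div_const 2).of_le (by simp)) hK 0
  simp only [hE]
  convert hmain using 1
  have hval : ∀ p, fderiv ℝ (fun q => (hsInner m (fderiv ℝ G q (0, 1)) (fderiv ℝ G q (0, 1)) +
        hsInner m (fderiv ℝ G q (0, Complex.I)) (fderiv ℝ G q (0, Complex.I))) / 2) (0, p) (1, 0) =
      hsInner m (fderiv ℝ P p 1) (fderiv ℝ Q p 1) +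
        hsInner m (fderiv ℝ P p Complex.I) (fderiv ℝ Q p Complex.I) := by
    intro p
    have d1 := ((hcd 1).differentiable (by simp) (0, p)).hasFDerivAt
    have d2 := ((hcd Complex.I).differentiable (by simp) (0, p)).hasFDerivAt
    have d3 := (d1.add d2).mul_const (2⁻¹ : ℝ)
    simp only [div_eq_mul_inv]
    erw [d3.fderiv]
    simp only [smul_apply, add_apply, hcdd, smul_eq_mul]
    ring
  obtain ⟨i1, j1, e1⟩ := integral_hsInner_fderiv (contDiff_fderiv_apply hPs 1) hQs hsupp 1
  obtain ⟨i2, j2, e2⟩ := integral_hsInner_fderiv (contDiff_fderiv_apply hPs Complex.I) hQs hsupp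
    Complex.I
  -- The first variation formula read backwards, from `⟨ΔP, Q⟩ = 0` through integration by parts
  -- over the plane to the integral over `K`, outside which `Q` and its derivatives vanish.
  calc (0 : ℝ) = - ∫ p, hsInner m (planeLaplacian P p) (Q p) := by
        have : ∀ p, hsInner m (planeLaplacian P p) (Q p) = 0 := fun p =>
          hsInner_eq_zero_of_commute (lineProj_mul_self _) (star_lineProj _) (hQeq p) (hL p)
        simp [this]
    _ = ∫ p, (hsInner m (fderiv ℝ P p 1) (fderiv ℝ Q p 1) +
        hsInner m (fderiv ℝ P p Complex.I) (fderiv ℝ Q p Complex.I)) := by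
      rw [MeasureTheory.integral_add i1 i2, e1, e2, ← neg_add, ← MeasureTheory.integral_add j1 j2]
      simp [planeLaplacian]
    _ = ∫ p in K, (hsInner m (fderiv ℝ P p 1) (fderiv ℝ Q p 1) +
        hsInner m (fderiv ℝ P p Complex.I) (fderiv ℝ Q p Complex.I)) := by
      symm
      refine MeasureTheory.setIntegral_eq_integral_of_forall_compl_eq_zero fun p hp => ?_
      simp [hder0 p hp]
    _ = _ := by simp only [hval]

/-! ### Wirtinger calculus -/

section Wirtinger
variable {V W : Type*} [NormedAddCommGroup V] [NormedSpace ℂ V]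
  [NormedAddCommGroup W] [NormedSpace ℂ W]

/-- The real linear map `h ↦ h u + h̄ w`. -/
noncomputable def wirtingerMap (u w : V) : ℂ →L[ℝ] V :=
  (ContinuousLinearMap.id ℝ ℂ).smulRight u + (Complex.conjCLE : ℂ →L[ℝ] ℂ).smulRight w

@[simp] theorem wirtingerMap_apply (u w : V) (h : ℂ) :
    wirtingerMap u w h = h • u + (starRingEnd ℂ h) • w := by
  simp [wirtingerMap]

/-- The function `g` is real differentiable at `p`, with `∂g/∂z = u` and `∂g/∂z̄ = w`. -/
def HasWirtinger (g : ℂ → V) (u w : V) (p : ℂ) : Prop :=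
  HasFDerivAt g (wirtingerMap u w) p

namespace HasWirtinger
variable {g g' : ℂ → V} {u w u' w' : V} {p : ℂ}

theorem dZ_eq (h : HasWirtinger g u w p) : dZ g p = u := by
  have e : Complex.I • Complex.I • (u - w) = -(u - w) := by
    rw [smul_smul, Complex.I_mul_I, neg_one_smul]
  have h2 : u + w + (u - w) = (2 : ℂ) • u := by rw [two_smul]; abel
  rw [dZ, HasFDerivAt.fderiv h]
  simp only [wirtingerMap_apply, map_one, one_smul, Complex.conj_I, neg_smul, ← sub_eq_add_neg,
    ← smul_sub]
  rw [e, sub_neg_eq_add, h2, smul_smul]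
  norm_num

theorem dZbar_eq (h : HasWirtinger g u w p) : dZbar g p = w := by
  have e : Complex.I • Complex.I • (u - w) = -(u - w) := by
    rw [smul_smul, Complex.I_mul_I, neg_one_smul]
  have h2 : u + w + -(u - w) = (2 : ℂ) • w := by rw [two_smul]; abel
  rw [dZbar, HasFDerivAt.fderiv h]
  simp only [wirtingerMap_apply, map_one, one_smul, Complex.conj_I, neg_smul, ← sub_eq_add_neg,
    ← smul_sub]
  rw [e, h2, smul_smul]
  norm_num

theorem congr_deriv (h : HasWirtinger g u w p) (hu : u = u') (hw : w = w') :
    HasWirtinger g u' w' p := hu ▸ hw ▸ h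

theorem congr_of_eventuallyEq (h : HasWirtinger g u w p) (he : g' =ᶠ[nhds p] g) :
    HasWirtinger g' u w p := HasFDerivAt.congr_of_eventuallyEq h he

theorem add (h : HasWirtinger g u w p) (h' : HasWirtinger g' u' w' p) :
    HasWirtinger (fun q => g q + g' q) (u + u') (w + w') p := by
  refine (HasFDerivAt.add h h').congr_fderiv ?_
  ext x; simp; abel

theorem const (v : V) (p : ℂ) : HasWirtinger (fun _ => v) 0 0 p := by
  refine (hasFDerivAt_const v p).congr_fderiv ?_
  ext x; simp

theorem linear (T : V →L[ℂ] W) (h : HasWirtinger g u w p) :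
    HasWirtinger (fun q => T (g q)) (T u) (T w) p := by
  refine ((T.restrictScalars ℝ).hasFDerivAt.comp p h).congr_fderiv ?_
  ext x; simp

theorem const_smul (a : ℂ) (h : HasWirtinger g u w p) :
    HasWirtinger (fun q => a • g q) (a • u) (a • w) p :=
  linear (a • ContinuousLinearMap.id ℂ V) h

theorem neg (h : HasWirtinger g u w p) : HasWirtinger (fun q => -g q) (-u) (-w) p :=
  linear (-ContinuousLinearMap.id ℂ V) h

theorem sub (h : HasWirtinger g u w p) (h' : HasWirtinger g' u' w' p) :
    HasWirtinger (fun q => g q - g' q) (u - u') (w - w') p := by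
  simpa only [sub_eq_add_neg] using h.add h'.neg

theorem smul {f : ℂ → ℂ} {a b : ℂ} (hf : HasWirtinger f a b p) (h : HasWirtinger g u w p) :
    HasWirtinger (fun q => f q • g q) (a • g p + f p • u) (b • g p + f p • w) p := by
  refine (HasFDerivAt.smul hf h).congr_fderiv ?_
  ext x
  simp only [add_apply, smul_apply, wirtingerMap_apply, ContinuousLinearMap.smulRight_apply,
    smul_add, add_smul, smul_smul, smul_eq_mul, mul_comm]
  abel

theorem mul {f f' : ℂ → ℂ} {a b a' b' : ℂ} (hf : HasWirtinger f a b p)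
    (h : HasWirtinger f' a' b' p) :
    HasWirtinger (fun q => f q * f' q) (a * f' p + f p * a') (b * f' p + f p * b') p :=
  hf.smul h

theorem inv {f : ℂ → ℂ} {a b : ℂ} (hf : HasWirtinger f a b p) (h0 : f p ≠ 0) :
    HasWirtinger (fun q => (f q)⁻¹) (-a / f p ^ 2) (-b / f p ^ 2) p := by
  refine (((hasDerivAt_inv h0).complexToReal_fderiv).comp p hf).congr_fderiv ?_
  ext x
  simp
  ring

theorem ofReal_log {f : ℂ → ℝ} {a b : ℂ} (hf : HasWirtinger (fun q => (f q : ℂ)) a b p)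
    (h0 : f p ≠ 0) :
    HasWirtinger (fun q => ((Real.log (f q) : ℝ) : ℂ)) (a / f p) (b / f p) p := by
  have h1 : HasFDerivAt f (Complex.reCLM.comp (wirtingerMap a b)) p :=
    (Complex.reCLM.hasFDerivAt.comp p hf).congr_of_eventuallyEq
      (Filter.Eventually.of_forall fun q => by simp)
  -- The derivative of a real function takes real values, so passing to the real part loses nothing.
  have h2 : ∀ x, ((wirtingerMap a b x).re : ℂ) = wirtingerMap a b x := by
    intro x
    have h3 : HasFDerivAt (fun q => (f q : ℂ))
        (Complex.ofRealCLM.comp (Complex.reCLM.comp (wirtingerMap a b))) p :=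
      Complex.ofRealCLM.hasFDerivAt.comp p h1
    have := congrArg (fun T : ℂ →L[ℝ] ℂ => T x) (h3.unique hf)
    simpa using this
  refine (Complex.ofRealCLM.hasFDerivAt.comp p (h1.log h0)).congr_fderiv ?_
  ext x
  have := h2 x
  simp only [ContinuousLinearMap.comp_apply, smul_apply, Complex.reCLM_apply,
    Complex.ofRealCLM_apply, smul_eq_mul, Complex.ofReal_mul, this]
  simp
  ring

theorem toLp {n : ℕ} {f : Fin n → ℂ → ℂ} {a b : Fin n → ℂ}
    (h : ∀ j, HasWirtinger (f j) (a j) (b j) p) :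
    HasWirtinger (fun q => (WithLp.toLp 2 fun j => f j q : EuclideanSpace ℂ (Fin n)))
      (WithLp.toLp 2 a) (WithLp.toLp 2 b) p := by
  have h1 : HasWirtinger (fun q j => f j q) a b p := by
    refine hasFDerivAt_pi'' fun j => (h j).congr_fderiv ?_
    ext x; simp
  exact h1.linear (PiLp.continuousLinearEquiv 2 ℂ fun _ : Fin n => ℂ).symm.toContinuousLinearMap

theorem comp_re {f : ℝ → ℂ} {f' : ℂ} (h : HasDerivAt f f' p.re) :
    HasWirtinger (fun q => f q.re) (2⁻¹ * f') (2⁻¹ * f') p := by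
  refine (h.hasFDerivAt.comp p Complex.reCLM.hasFDerivAt).congr_fderiv ?_
  ext x
  simp only [ContinuousLinearMap.comp_apply, Complex.reCLM_apply, wirtingerMap_apply,
    smul_eq_mul]
  have : (x.re : ℂ) = (x + starRingEnd ℂ x) / 2 := by rw [Complex.add_conj]; simp
  simp
  rw [this]; ring

theorem comp_im {f : ℝ → ℂ} {f' : ℂ} (h : HasDerivAt f f' p.im) :
    HasWirtinger (fun q => f q.im) (-(Complex.I / 2 * f')) (Complex.I / 2 * f') p := by
  refine (h.hasFDerivAt.comp p Complex.imCLM.hasFDerivAt).congr_fderiv ?_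
  ext x
  simp only [ContinuousLinearMap.comp_apply, Complex.imCLM_apply, wirtingerMap_apply,
    smul_eq_mul]
  have : (x.im : ℂ) = -(Complex.I * (x - starRingEnd ℂ x) / 2) := by
    rw [Complex.sub_conj]
    push_cast
    linear_combination (x.im : ℂ) * Complex.I_sq
  simp
  rw [this]; ring

/-- The operator depends conjugate linearly on its second vector, so there `∂/∂z` and `∂/∂z̄` are
exchanged. -/
theorem rankOne {m : ℕ} {g g' : ℂ → EuclideanSpace ℂ (Fin m)} {u w u' w' : EuclideanSpace ℂ (Fin m)}
    (h : HasWirtinger g u w p) (h' : HasWirtinger g' u' w' p) :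
    HasWirtinger (fun q => InnerProductSpace.rankOne ℂ (g q) (g' q))
      (InnerProductSpace.rankOne ℂ u (g' p) + InnerProductSpace.rankOne ℂ (g p) w')
      (InnerProductSpace.rankOne ℂ w (g' p) + InnerProductSpace.rankOne ℂ (g p) u') p := by
  have hb : IsBoundedBilinearMap ℝ fun x : EuclideanSpace ℂ (Fin m) × EuclideanSpace ℂ (Fin m) =>
      InnerProductSpace.rankOne ℂ x.1 x.2 :=
    { add_left := by simp
      smul_left := fun c x y => by
        ext1 z; simp [smul_comm c]
      add_right := by simp
      smul_right := fun c x y => by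
        rw [← Complex.coe_smul c y, map_smulₛₗ]; simp
      bound := ⟨1, one_pos, fun x y => by simp⟩ }
  refine ((hb.hasFDerivAt (g p, g' p)).comp p (HasFDerivAt.prodMk h h')).congr_fderiv ?_
  ext1 x
  simp [hb.deriv_apply]
  abel

theorem star {m : ℕ} {g : ℂ → EuclideanSpace ℂ (Fin m) →L[ℂ] EuclideanSpace ℂ (Fin m)}
    {u w : EuclideanSpace ℂ (Fin m) →L[ℂ] EuclideanSpace ℂ (Fin m)} (h : HasWirtinger g u w p) :
    HasWirtinger (fun q => Star.star (g q)) (Star.star w) (Star.star u) p := by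
  refine ((starL' ℝ : _ ≃L[ℝ] _).toContinuousLinearMap.hasFDerivAt.comp p h).congr_fderiv ?_
  ext1 x
  simp [add_comm]

end HasWirtinger

/-- The Laplacian is `4 ∂²/∂z∂z̄`, split evenly between the two orders of differentiation: `w` is
`∂/∂z̄` of `∂P/∂z` and `u'` is `∂/∂z` of `∂P/∂z̄`. -/
theorem planeLaplacian_eq {V : Type*} [NormedAddCommGroup V] [NormedSpace ℂ V]
    {P A A' : ℂ → V} {u w u' w' : V} {p : ℂ}
    (hP : ∀ᶠ q in nhds p, HasWirtinger P (A q) (A' q) q)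
    (hA : HasWirtinger A u w p) (hA' : HasWirtinger A' u' w' p) :
    planeLaplacian P p = (2 : ℂ) • (w + u') := by
  have h1 : (fun q => fderiv ℝ P q 1) =ᶠ[nhds p] fun q => A q + A' q :=
    hP.mono fun q hq => by simp [HasFDerivAt.fderiv hq]
  have h2 : (fun q => fderiv ℝ P q Complex.I) =ᶠ[nhds p] fun q => Complex.I • (A q - A' q) :=
    hP.mono fun q hq => by simp [HasFDerivAt.fderiv hq, sub_eq_add_neg]
  rw [planeLaplacian, h1.fderiv_eq, h2.fderiv_eq, HasFDerivAt.fderiv (hA.add hA'),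
    HasFDerivAt.fderiv ((hA.sub hA').const_smul Complex.I)]
  simp only [wirtingerMap_apply, map_one, one_smul, Complex.conj_I, neg_smul, smul_smul,
    Complex.I_mul_I]
  match_scalars <;> first | ring1 | linear_combination Complex.I_sq | linear_combination -Complex.I_sq

/-- If `P` is the projection onto the values of a map to projective space, `∂P/∂z = A` and
`∂A/∂z̄` commutes with `P`, then so does the Laplacian of `P`. -/
theorem commute_planeLaplacian {m : ℕ}
    {P A : ℂ → EuclideanSpace ℂ (Fin m) →L[ℂ] EuclideanSpace ℂ (Fin m)}
    {u M : EuclideanSpace ℂ (Fin m) →L[ℂ] EuclideanSpace ℂ (Fin m)} {p : ℂ}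
    (hs : star (P p) = P p)
    (hP : ∀ᶠ q in nhds p, HasWirtinger P (A q) (star (A q)) q)
    (hA : HasWirtinger A u M p) (hM : Commute (P p) M) :
    Commute (P p) (planeLaplacian P p) := by
  rw [planeLaplacian_eq hP hA hA.star]
  refine Commute.smul_right (hM.add_right ?_) _
  rw [Commute, SemiconjBy]
  have := congrArg star hM.eq
  simp only [star_mul, hs] at this
  exact this.symm

end Wirtinger

/-! ### Trigonometric identities among the constants -/

namespace SLCone
section constants
variable (θ : ℝ)

/-- With `r = 1/√6` and `t = √3` all constants are polynomials in `r, t, cos θ, sin θ`, and the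
identities below become consequences of three polynomial relations. Geometrically, the points `(β_j,
γ_j)` are `2r (sin α_j, cos α_j)` for angles `α_j` that differ by `2π/3`, while `b = r³ sin 3θ` and
`c = -r³ cos 3θ`. -/
theorem exists_trig_constants : ∃ r t C S : ℝ, 6 * r ^ 2 = 1 ∧ t ^ 2 = 3 ∧ C ^ 2 + S ^ 2 = 1 ∧
    t = √3 ∧
    β θ 0 = r * (t * C - S) ∧ β θ 1 = r * (-(t * C) - S) ∧ β θ 2 = r * (2 * S) ∧
    γ θ 0 = r * (-C - t * S) ∧ γ θ 1 = r * (-C + t * S) ∧ γ θ 2 = r * (2 * C) ∧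
    b θ = -(1 / 2) * (r * (t * C - S) * (r * (-(t * C) - S)) * (r * (2 * S))) ∧
    c θ = -(1 / 2) * (r * (-C - t * S) * (r * (-C + t * S)) * (r * (2 * C))) := by
  have h6 : √6 = √2 * √3 := by rw [← Real.sqrt_mul (by norm_num)]; norm_num
  have h2 : √2 ^ 2 = 2 := Real.sq_sqrt (by norm_num)
  have h3 : √3 ^ 2 = 3 := Real.sq_sqrt (by norm_num)
  have p2 : √2 ≠ 0 := by positivity
  have p3 : √3 ≠ 0 := by positivity
  have hr : (√2)⁻¹ = (√6)⁻¹ * √3 := by rw [h6]; field_simp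
  have e0 : β θ 0 = (√6)⁻¹ * (√3 * Real.cos θ - Real.sin θ) := by
    simp [β, div_eq_mul_inv, hr]; ring
  have e1 : β θ 1 = (√6)⁻¹ * (-(√3 * Real.cos θ) - Real.sin θ) := by
    simp [β, div_eq_mul_inv, hr]; ring
  have e2 : β θ 2 = (√6)⁻¹ * (2 * Real.sin θ) := by
    simp [β, div_eq_mul_inv]; ring
  have f0 : γ θ 0 = (√6)⁻¹ * (-Real.cos θ - √3 * Real.sin θ) := by
    simp [γ, div_eq_mul_inv, hr]; ring
  have f1 : γ θ 1 = (√6)⁻¹ * (-Real.cos θ + √3 * Real.sin θ) := by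
    simp [γ, div_eq_mul_inv, hr]; ring
  have f2 : γ θ 2 = (√6)⁻¹ * (2 * Real.cos θ) := by
    simp [γ, div_eq_mul_inv]; ring
  refine ⟨(√6)⁻¹, √3, Real.cos θ, Real.sin θ, ?_, h3, Real.cos_sq_add_sin_sq θ, rfl,
    e0, e1, e2, f0, f1, f2, ?_, ?_⟩
  · rw [inv_pow, Real.sq_sqrt (by norm_num)]; norm_num
  · rw [b, e0, e1, e2]
  · rw [c, f0, f1, f2]

theorem β_sum : β θ 0 + β θ 1 + β θ 2 = 0 := by
  obtain ⟨r, t, C, S, hr, ht, hCS, -, e0, e1, e2, f0, f1, f2, hb, hc⟩ := exists_trig_constants θ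
  rw [e0, e1, e2]; ring

theorem γ_sum : γ θ 0 + γ θ 1 + γ θ 2 = 0 := by
  obtain ⟨r, t, C, S, hr, ht, hCS, -, e0, e1, e2, f0, f1, f2, hb, hc⟩ := exists_trig_constants θ
  rw [f0, f1, f2]; ring

theorem β_sq_sum : β θ 0 ^ 2 + β θ 1 ^ 2 + β θ 2 ^ 2 = 1 := by
  obtain ⟨r, t, C, S, hr, ht, hCS, -, e0, e1, e2, f0, f1, f2, hb, hc⟩ := exists_trig_constants θ
  rw [e0, e1, e2]; grind

theorem γ_sq_sum : γ θ 0 ^ 2 + γ θ 1 ^ 2 + γ θ 2 ^ 2 = 1 := by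
  obtain ⟨r, t, C, S, hr, ht, hCS, -, e0, e1, e2, f0, f1, f2, hb, hc⟩ := exists_trig_constants θ
  rw [f0, f1, f2]; grind

theorem βγ_sum : β θ 0 * γ θ 0 + β θ 1 * γ θ 1 + β θ 2 * γ θ 2 = 0 := by
  obtain ⟨r, t, C, S, hr, ht, hCS, -, e0, e1, e2, f0, f1, f2, hb, hc⟩ := exists_trig_constants θ
  rw [e0, e1, e2, f0, f1, f2]; grind

theorem β_sq_add_γ_sq (j : Fin 3) : β θ j ^ 2 + γ θ j ^ 2 = 2 / 3 := by
  obtain ⟨r, t, C, S, hr, ht, hCS, -, e0, e1, e2, f0, f1, f2, hb, hc⟩ := exists_trig_constants θ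
  fin_cases j <;> simp only [Fin.zero_eta, Fin.mk_one, Fin.reduceFinMk] <;>
    simp only [e0, e1, e2, f0, f1, f2] <;> grind

/-- This and the next identity are the addition formulas for `sin (3α - α)` and `cos (3α - α)` at
the angle `α = α_j` of `(β_j, γ_j)`; `a = r²`. -/
theorem c_mul_β_add_b_mul_γ (j : Fin 3) : c θ * β θ j + b θ * γ θ j = a * (β θ j * γ θ j) := by
  obtain ⟨r, t, C, S, hr, ht, hCS, -, e0, e1, e2, f0, f1, f2, hb, hc⟩ := exists_trig_constants θ
  rw [hb, hc, a]
  fin_cases j <;> simp only [Fin.zero_eta, Fin.mk_one, Fin.reduceFinMk] <;>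
    simp only [e0, e1, e2, f0, f1, f2] <;> grind

theorem b_mul_β_sub_c_mul_γ (j : Fin 3) :
    b θ * β θ j - c θ * γ θ j = a / 2 * (γ θ j ^ 2 - β θ j ^ 2) := by
  obtain ⟨r, t, C, S, hr, ht, hCS, -, e0, e1, e2, f0, f1, f2, hb, hc⟩ := exists_trig_constants θ
  rw [hb, hc, a]
  fin_cases j <;> simp only [Fin.zero_eta, Fin.mk_one, Fin.reduceFinMk] <;>
    simp only [e0, e1, e2, f0, f1, f2] <;> grind

theorem b_sq_add_c_sq : b θ ^ 2 + c θ ^ 2 = 1 / 216 := by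
  obtain ⟨r, t, C, S, hr, ht, hCS, -, e0, e1, e2, f0, f1, f2, hb, hc⟩ := exists_trig_constants θ
  rw [hb, hc]; grind

theorem β_diff (j : Fin 3) : β θ (j + 2) - β θ (j + 1) = -√3 * γ θ j := by
  obtain ⟨r, t, C, S, hr, ht, hCS, h3, e0, e1, e2, f0, f1, f2, hb, hc⟩ := exists_trig_constants θ
  rw [← h3]
  fin_cases j <;> simp [e0, e1, e2, f0, f1, f2] <;> grind

theorem γ_diff (j : Fin 3) : γ θ (j + 2) - γ θ (j + 1) = √3 * β θ j := by
  obtain ⟨r, t, C, S, hr, ht, hCS, h3, e0, e1, e2, f0, f1, f2, hb, hc⟩ := exists_trig_constants θ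
  rw [← h3]
  fin_cases j <;> simp [e0, e1, e2, f0, f1, f2] <;> grind

end constants
end SLCone

/-! ### The system of ordinary differential equations -/

namespace SLCone

theorem fin3_add (j : Fin 3) : j + 1 + 1 = j + 2 ∧ j + 1 + 2 = j ∧ j + 2 + 1 = j ∧
    j + 2 + 2 = j + 1 := by
  revert j; decide

theorem fin3_sum_cyclic {M : Type*} [AddCommMonoid M] (f : Fin 3 → M) (j : Fin 3) :
    f j + f (j + 1) + f (j + 2) = f 0 + f 1 + f 2 := by
  fin_cases j
  · simp
  · simp only [Fin.mk_one, Fin.isValue, Fin.reduceAdd]; abel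
  · simp only [Fin.reduceFinMk, Fin.isValue, Fin.reduceAdd]; abel

theorem fin3_prod_cyclic {M : Type*} [CommMonoid M] (f : Fin 3 → M) (j : Fin 3) :
    f j * f (j + 1) * f (j + 2) = f 0 * f 1 * f 2 := by
  have := fin3_sum_cyclic (M := Additive M) (fun i => Additive.ofMul (f i)) j
  exact this

theorem β_sum' (θ : ℝ) (j : Fin 3) : β θ j + β θ (j + 1) + β θ (j + 2) = 0 := by
  rw [fin3_sum_cyclic, β_sum]

theorem γ_sum' (θ : ℝ) (j : Fin 3) : γ θ j + γ θ (j + 1) + γ θ (j + 2) = 0 := by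
  rw [fin3_sum_cyclic, γ_sum]

theorem b_eq (θ : ℝ) (j : Fin 3) : b θ = -(1 / 2) * (β θ j * β θ (j + 1) * β θ (j + 2)) := by
  rw [fin3_prod_cyclic, b]

theorem c_eq (θ : ℝ) (j : Fin 3) : c θ = -(1 / 2) * (γ θ j * γ θ (j + 1) * γ θ (j + 2)) := by
  rw [fin3_prod_cyclic, c]

/-- The product `y_1 y_2 y_3`. -/
noncomputable def tripleProd (y : Fin 3 → ℝ → ℂ) (s : ℝ) : ℂ := y 0 s * y 1 s * y 2 s

theorem tripleProd_eq (y : Fin 3 → ℝ → ℂ) (s : ℝ) (j : Fin 3) :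
    tripleProd y s = y j s * y (j + 1) s * y (j + 2) s :=
  (fin3_prod_cyclic (fun i => y i s) j).symm

/-- The system of equations for one of the two triples of functions. -/
structure IsTriple (δ : Fin 3 → ℝ) (y : Fin 3 → ℝ → ℂ) (v : ℝ → ℝ) : Prop where
  sum : δ 0 + δ 1 + δ 2 = 0
  sq_sum : δ 0 ^ 2 + δ 1 ^ 2 + δ 2 ^ 2 = 1
  deriv : ∀ j s, HasDerivAt (y j) ((δ j : ℂ) * star (y (j + 1) s * y (j + 2) s)) s
  norm : ∀ j s, ‖y j s‖ ^ 2 = δ j * v s + 1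

namespace IsTriple
variable {δ : Fin 3 → ℝ} {y : Fin 3 → ℝ → ℂ} {v : ℝ → ℝ} (h : IsTriple δ y v)
include h

theorem mul_star (j : Fin 3) (s : ℝ) : y j s * star (y j s) = (δ j : ℂ) * v s + 1 := by
  have := Complex.mul_conj' (y j s)
  rw [← Complex.ofReal_pow, h.norm] at this
  simpa using this

theorem sum' (j : Fin 3) : δ j + δ (j + 1) + δ (j + 2) = 0 := by
  rw [fin3_sum_cyclic, h.sum]

/-- The derivative contains `|y_{j+1}|²` and `|y_{j+2}|²`; the norm relations make these affine in
`v`, and the constant part uses `δ_{j+1} + δ_{j+2} = -δ_j`. -/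
theorem hasDerivAt_star_mul (j : Fin 3) (s : ℝ) :
    HasDerivAt (fun s => star (y (j + 1) s * y (j + 2) s))
      ((2 * δ (j + 1) * δ (j + 2) * v s - δ j) * y j s) s := by
  obtain ⟨e1, e2, e3, e4⟩ := fin3_add j
  have h1 := (((h.deriv (j + 1) s).mul (h.deriv (j + 2) s)).star)
  rw [e1, e2, e3, e4] at h1
  refine h1.congr_deriv ?_
  have n1 := h.mul_star (j + 1) s
  have n2 := h.mul_star (j + 2) s
  have hs : (δ j + δ (j + 1) + δ (j + 2) : ℂ) = 0 := by exact_mod_cast h.sum' j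
  simp only [star_add, star_mul', RCLike.star_def, Complex.conj_ofReal, Complex.conj_conj] at n1 n2 ⊢
  linear_combination (δ (j + 1) * y j s : ℂ) * n2 + (δ (j + 2) * y j s : ℂ) * n1 + y j s * hs

/-- The derivative is the sum of the `δ_j |y_{j+1} y_{j+2}|²`. That it is real is what makes the
imaginary part a first integral. -/
theorem hasDerivAt_tripleProd (s : ℝ) :
    HasDerivAt (tripleProd y)
      ((-(6 * (-(1 / 2) * (δ 0 * δ 1 * δ 2))) * v s ^ 2 - v s : ℝ) : ℂ) s := by
  have h1 := ((h.deriv 0 s).mul (h.deriv 1 s)).mul (h.deriv 2 s)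
  refine h1.congr_deriv ?_
  have n0 := h.mul_star 0 s
  have n1 := h.mul_star 1 s
  have n2 := h.mul_star 2 s
  have hs : (δ 0 + δ 1 + δ 2 : ℂ) = 0 := by exact_mod_cast h.sum
  have hq : (δ 0 ^ 2 + δ 1 ^ 2 + δ 2 ^ 2 : ℂ) = 1 := by exact_mod_cast h.sq_sum
  simp only [Pi.mul_apply, zero_add, Fin.reduceAdd, star_mul'] at n0 n1 n2 ⊢
  push_cast
  have e : ∀ (d0 d1 d2 y0 y1 y2 z0 z1 z2 V : ℂ), y0 * z0 = d0 * V + 1 → y1 * z1 = d1 * V + 1 →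
      y2 * z2 = d2 * V + 1 → d0 + d1 + d2 = 0 → d0 ^ 2 + d1 ^ 2 + d2 ^ 2 = 1 →
      (d0 * (z1 * z2) * y1 + y0 * (d1 * (z2 * z0))) * y2 + y0 * y1 * (d2 * (z0 * z1)) =
      -(6 * (-(1 / 2) * (d0 * d1 * d2))) * V ^ 2 - V := by
    intros; grind
  exact e _ _ _ _ _ _ _ _ _ _ n0 n1 n2 hs hq

/-- This recovers `v` from the `y_j`, and so gives the differentiability of `v`, which is not
assumed. -/
theorem v_eq (s : ℝ) : (v s : ℂ) = ∑ j, (δ j : ℂ) * (y j s * star (y j s)) := by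
  have hs : (δ 0 + δ 1 + δ 2 : ℂ) = 0 := by exact_mod_cast h.sum
  have hq : (δ 0 ^ 2 + δ 1 ^ 2 + δ 2 ^ 2 : ℂ) = 1 := by exact_mod_cast h.sq_sum
  rw [Fin.sum_univ_three, h.mul_star, h.mul_star, h.mul_star]
  linear_combination (-(v s : ℂ)) * hq - hs

theorem hasDerivAt_v (s : ℝ) :
    HasDerivAt (fun s => (v s : ℂ)) (tripleProd y s + star (tripleProd y s)) s := by
  have h1 : ∀ j, HasDerivAt (fun s => (δ j : ℂ) * (y j s * star (y j s)))
      ((δ j : ℂ) ^ 2 * (tripleProd y s + star (tripleProd y s))) s := fun j => by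
    refine (((h.deriv j s).mul (h.deriv j s).star).const_mul _).congr_deriv ?_
    rw [tripleProd_eq y s j]
    simp only [star_mul', RCLike.star_def, Complex.conj_ofReal, Complex.conj_conj]
    ring
  have h2 : (fun s => (v s : ℂ)) = fun s => ∑ j, (δ j : ℂ) * (y j s * star (y j s)) :=
    funext h.v_eq
  rw [h2]
  refine (HasDerivAt.fun_sum fun j _ => h1 j).congr_deriv ?_
  have hq : (δ 0 ^ 2 + δ 1 ^ 2 + δ 2 ^ 2 : ℂ) = 1 := by exact_mod_cast h.sq_sum
  rw [Fin.sum_univ_three]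
  linear_combination (tripleProd y s + star (tripleProd y s)) * hq

theorem hasDerivAt_v_real (s : ℝ) : HasDerivAt v (2 * (tripleProd y s).re) s := by
  have h1 := Complex.reCLM.hasFDerivAt.comp_hasDerivAt s (h.hasDerivAt_v s)
  refine h1.congr_deriv ?_
  simp; ring

theorem tripleProd_im (s : ℝ) : (tripleProd y s).im = (tripleProd y 0).im := by
  have h1 : ∀ s, HasDerivAt (fun s => (tripleProd y s).im) 0 s := fun s => by
    have := Complex.imCLM.hasFDerivAt.comp_hasDerivAt s (h.hasDerivAt_tripleProd s)
    exact this.congr_deriv (by simp only [Complex.imCLM_apply, Complex.ofReal_im])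
  exact is_const_of_deriv_eq_zero (fun s => (h1 s).differentiableAt) (fun s => (h1 s).deriv) s 0

/-- Expand the product of the `1 + δ_j v`: the elementary symmetric functions of the `δ_j` are `0`,
`-1/2` and `δ_0 δ_1 δ_2`. As `v'` is twice the real part of the product, this is the energy equation
for `v`. -/
theorem tripleProd_normSq (s : ℝ) : (tripleProd y s).re ^ 2 + (tripleProd y s).im ^ 2 =
    1 - v s ^ 2 / 2 - 2 * (-(1 / 2) * (δ 0 * δ 1 * δ 2)) * v s ^ 3 := by
  have h1 : (tripleProd y s).re ^ 2 + (tripleProd y s).im ^ 2 = ‖tripleProd y s‖ ^ 2 := by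
    rw [← Complex.normSq_eq_norm_sq, Complex.normSq_apply]; ring
  rw [h1, tripleProd, norm_mul, norm_mul, mul_pow, mul_pow, h.norm, h.norm, h.norm]
  have hs := h.sum
  have hq := h.sq_sum
  grind

/-- Bootstrap: each derivative is a polynomial in the conjugates of the functions, so every order of
smoothness yields the next. -/
theorem contDiff (j : Fin 3) : ContDiff ℝ ∞ (y j) := by
  have key : ∀ n : ℕ, ∀ j, ContDiff ℝ n (y j) := by
    intro n
    induction n with
    | zero =>
      intro j
      exact contDiff_zero.2 (continuous_iff_continuousAt.2 fun s => (h.deriv j s).continuousAt)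
    | succ n ih =>
      intro j
      have hd : _root_.deriv (y j) = fun s => (δ j : ℂ) * star (y (j + 1) s * y (j + 2) s) :=
        funext fun s => (h.deriv j s).deriv
      have h1 : ContDiff ℝ n (_root_.deriv (y j)) := by
        rw [hd]
        exact contDiff_const.mul (Complex.conjCLE.contDiff.comp ((ih (j + 1)).mul (ih (j + 2))))
      have h2 : ContDiff ℝ ((n : WithTop ℕ∞) + 1) (y j) := contDiff_succ_iff_deriv.2
        ⟨fun s => (h.deriv j s).differentiableAt, fun h => absurd h (by simp), h1⟩
      exact_mod_cast h2
  exact contDiff_infty.2 fun n => key n j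

theorem contDiff_v : ContDiff ℝ ∞ v := by
  have h1 : v = fun s => ∑ j, δ j * ‖y j s‖ ^ 2 := by
    funext s
    rw [Fin.sum_univ_three, h.norm, h.norm, h.norm]
    linear_combination (-v s) * h.sq_sum - h.sum
  rw [h1]
  exact ContDiff.sum fun j _ => contDiff_const.mul ((h.contDiff j).norm_sq ℝ)

end IsTriple

variable {θ : ℝ} {y z : Fin 3 → ℝ → ℂ} {v w : ℝ → ℝ}

theorem IsData.fst (h : IsData θ y z v w) : IsTriple (β θ) y v :=
  ⟨β_sum θ, β_sq_sum θ, h.y_deriv, h.y_norm⟩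

theorem IsData.snd (h : IsData θ y z v w) : IsTriple (γ θ) z w :=
  ⟨γ_sum θ, γ_sq_sum θ, h.z_deriv, h.z_norm⟩

end SLCone

/-! ### Structure equations of the frame -/

theorem HasWirtinger.re_mul_im {f g : ℝ → ℂ} {f' g' : ℂ} {p : ℂ} (hf : HasDerivAt f f' p.re)
    (hg : HasDerivAt g g' p.im) :
    HasWirtinger (fun q => f q.re * g q.im) (2⁻¹ * (f' * g p.im - Complex.I * (f p.re * g')))
      (2⁻¹ * (f' * g p.im + Complex.I * (f p.re * g'))) p :=
  ((HasWirtinger.comp_re hf).mul (HasWirtinger.comp_im hg)).congr_deriv (by ring) (by ring)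

namespace SLCone
variable {θ : ℝ} {y z : Fin 3 → ℝ → ℂ} {v w : ℝ → ℝ}

/-- The vectors `vecPos` and `vecNeg` are the special cases `σ = -i` and `σ = i`. -/
noncomputable def mixVec (θ : ℝ) (y z : Fin 3 → ℝ → ℂ) (σ : ℂ) (p : ℂ) :
    EuclideanSpace ℂ (Fin 3) :=
  WithLp.toLp 2 fun j =>
    (β θ j : ℂ) * star (y (j + 1) p.re * y (j + 2) p.re) * z j p.im +
      σ * ((γ θ j : ℂ) * y j p.re * star (z (j + 1) p.im * z (j + 2) p.im))

theorem vecNeg_eq : vecNeg θ y z = mixVec θ y z Complex.I := by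
  funext p; ext j; simp [vecNeg, mixVec, mul_assoc]

theorem vecPos_eq : vecPos θ y z = mixVec θ y z (-Complex.I) := by
  funext p; ext j; simp [vecPos, mixVec, mul_assoc, sub_eq_add_neg]

/-- The derivative of `mixVec` for `σ = ± i` in the direction where it is not a multiple of
`vec₀`. -/
noncomputable def mixVecDeriv (θ : ℝ) (y z : Fin 3 → ℝ → ℂ) (v w : ℝ → ℝ) (σ : ℂ) (p : ℂ) :
    EuclideanSpace ℂ (Fin 3) :=
  WithLp.toLp 2 fun j =>
    2⁻¹ * ((-4 * b θ * v p.re - β θ j ^ 2) + (4 * c θ * w p.im + γ θ j ^ 2)) *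
        (y j p.re * z j p.im) +
      σ * ((β θ j * γ θ j : ℂ) * (star (y (j + 1) p.re * y (j + 2) p.re) *
        star (z (j + 1) p.im * z (j + 2) p.im)))

/-- The derivative `∂/∂z` of `weight`. -/
noncomputable def weightDeriv (θ : ℝ) (y z : Fin 3 → ℝ → ℂ) (p : ℂ) : ℂ :=
  2⁻¹ * (b θ * (tripleProd y p.re + star (tripleProd y p.re)) -
    Complex.I * (c θ * (tripleProd z p.im + star (tripleProd z p.im))))

/-- The factor of periodicity `ξ`. -/
noncomputable def period (θ : ℝ) (y z : Fin 3 → ℝ → ℂ) : ℂ :=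
  ((c θ * (tripleProd z 0).im : ℝ) : ℂ) - Complex.I * ((b θ * (tripleProd y 0).im : ℝ) : ℂ)

/-- As `β_j² + γ_j²` does not depend on `j`, `∂X⁺/∂z̄` and `∂X⁻/∂z` are multiples of `X⁰`. -/
theorem vecPos_vecNeg_coeff (θ : ℝ) (v w : ℝ → ℝ) (p : ℂ) (j : Fin 3) :
    2⁻¹ * ((-4 * b θ * v p.re - β θ j ^ 2) + (-4 * c θ * w p.im - γ θ j ^ 2)) =
      -2 * weight θ v w p := by
  have := β_sq_add_γ_sq θ j
  rw [weight, a]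
  linear_combination (-1 / 2 : ℝ) * this

/-- This compares the coefficients of `y_j z_j` when `W` times the remaining derivative of `X^±` is
expanded in the frame; `weight_smul_coeff` does so for the conjugated products. The mixed terms in
`v w` cancel. -/
theorem weight_mul_coeff (θ : ℝ) (v w : ℝ → ℝ) (p : ℂ) (j : Fin 3) : weight θ v w p *
      (2⁻¹ * ((-4 * b θ * v p.re - β θ j ^ 2) + (4 * c θ * w p.im + γ θ j ^ 2))) =
    b θ * β θ j * ((β θ (j + 1) * v p.re + 1) * (β θ (j + 2) * v p.re + 1)) -
      c θ * γ θ j * ((γ θ (j + 1) * w p.im + 1) * (γ θ (j + 2) * w p.im + 1)) := by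
  have k1 := b_mul_β_sub_c_mul_γ θ j
  have k2 := β_sq_add_γ_sq θ j
  have k3 := b_eq θ j
  have k4 := c_eq θ j
  have k5 := β_sum' θ j
  have k6 := γ_sum' θ j
  rw [weight]
  unfold a at k1 ⊢
  generalize β θ j = d0 at *
  generalize β θ (j + 1) = d1 at *
  generalize β θ (j + 2) = d2 at *
  generalize γ θ j = g0 at *
  generalize γ θ (j + 1) = g1 at *
  generalize γ θ (j + 2) = g2 at *
  generalize b θ = b at *
  generalize c θ = c at *
  generalize v p.re = v at *
  generalize w p.im = w at *
  have e1 : (d1 * v + 1) * (d2 * v + 1) * d0 = -2 * b * v ^ 2 - d0 ^ 2 * v + d0 := by grind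
  have e2 : (g1 * w + 1) * (g2 * w + 1) * g0 = -2 * c * w ^ 2 - g0 ^ 2 * w + g0 := by grind
  linear_combination (-b) * e1 + c * e2 + (b * v - c * w) / 2 * k2 - k1

theorem weight_smul_coeff (θ : ℝ) (v w : ℝ → ℝ) (p : ℂ) (j : Fin 3) : weight θ v w p * (β θ j * γ θ j) =
    c θ * β θ j * (γ θ j * w p.im + 1) + b θ * γ θ j * (β θ j * v p.re + 1) := by
  have k1 := c_mul_β_add_b_mul_γ θ j
  rw [weight]
  linear_combination -k1

namespace IsData
variable (h : IsData θ y z v w)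
include h

theorem hasWirtinger_weight (p : ℂ) :
    HasWirtinger (fun q => (weight θ v w q : ℂ)) (weightDeriv θ y z p)
      (star (weightDeriv θ y z p)) p := by
  have h1 := (HasWirtinger.comp_re (h.fst.hasDerivAt_v p.re)).const_smul (b θ)
  have h2 := (HasWirtinger.comp_im (h.snd.hasDerivAt_v p.im)).const_smul (c θ)
  refine ((((HasWirtinger.const (a : ℂ) p).add h1).add h2).congr_of_eventuallyEq
    (Filter.Eventually.of_forall fun q => ?_)).congr_deriv ?_ ?_
  · simp [weight]
  · simp only [weightDeriv, smul_eq_mul]; ring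
  · simp only [weightDeriv, smul_eq_mul, RCLike.star_def]
    simp [map_ofNat]
    ring

theorem hasWirtinger_vec₀ (p : ℂ) :
    HasWirtinger (vec₀ y z) ((2 : ℂ)⁻¹ • vecPos θ y z p) ((2 : ℂ)⁻¹ • vecNeg θ y z p) p := by
  refine (HasWirtinger.toLp fun j => HasWirtinger.re_mul_im (h.y_deriv j p.re)
    (h.z_deriv j p.im)).congr_deriv ?_ ?_
  · ext j; simp [vecPos]; ring
  · ext j; simp [vecNeg]; ring

theorem hasWirtinger_mixVec (σ : ℂ) (p : ℂ) (j : Fin 3) :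
    HasWirtinger (fun q => (β θ j : ℂ) * star (y (j + 1) q.re * y (j + 2) q.re) * z j q.im +
      σ * ((γ θ j : ℂ) * y j q.re * star (z (j + 1) q.im * z (j + 2) q.im)))
    (2⁻¹ * ((-4 * b θ * v p.re - β θ j ^ 2) - Complex.I * σ * (-4 * c θ * w p.im - γ θ j ^ 2)) *
        (y j p.re * z j p.im) +
      2⁻¹ * (σ - Complex.I) * ((β θ j * γ θ j : ℂ) * (star (y (j + 1) p.re * y (j + 2) p.re) *
        star (z (j + 1) p.im * z (j + 2) p.im))))
    (2⁻¹ * ((-4 * b θ * v p.re - β θ j ^ 2) + Complex.I * σ * (-4 * c θ * w p.im - γ θ j ^ 2)) *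
        (y j p.re * z j p.im) +
      2⁻¹ * (σ + Complex.I) * ((β θ j * γ θ j : ℂ) * (star (y (j + 1) p.re * y (j + 2) p.re) *
        star (z (j + 1) p.im * z (j + 2) p.im)))) p := by
  have h1 := HasWirtinger.re_mul_im ((h.fst.hasDerivAt_star_mul j p.re).const_mul (β θ j : ℂ))
    (h.z_deriv j p.im)
  have h2 := HasWirtinger.re_mul_im ((h.y_deriv j p.re).const_mul (γ θ j : ℂ))
    (h.snd.hasDerivAt_star_mul j p.im)
  have hb : (b θ : ℂ) = -(1 / 2) * (β θ j * β θ (j + 1) * β θ (j + 2)) := by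
    rw [b_eq θ j]; push_cast; ring
  have hc : (c θ : ℂ) = -(1 / 2) * (γ θ j * γ θ (j + 1) * γ θ (j + 2)) := by
    rw [c_eq θ j]; push_cast; ring
  refine (h1.add (h2.const_smul σ)).congr_deriv ?_ ?_ <;>
  · rw [hb, hc, smul_eq_mul]
    ring

theorem hasWirtinger_vecPos (p : ℂ) :
    HasWirtinger (vecPos θ y z) (mixVecDeriv θ y z v w (-Complex.I) p)
      ((-2 * weight θ v w p : ℂ) • vec₀ y z p) p := by
  rw [vecPos_eq]
  refine (HasWirtinger.toLp fun j => h.hasWirtinger_mixVec (-Complex.I) p j).congr_deriv ?_ ?_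
  · ext j
    simp only [mixVecDeriv]
    linear_combination (2⁻¹ * (-4 * c θ * w p.im - γ θ j ^ 2) * (y j p.re * z j p.im) : ℂ) *
      Complex.I_sq
  · ext j
    have := vecPos_vecNeg_coeff θ v w p j
    have e := congrArg Complex.ofReal this
    push_cast at e
    simp only [vec₀, PiLp.smul_apply, smul_eq_mul]
    rw [← e]
    linear_combination (-2⁻¹ * (-4 * c θ * w p.im - γ θ j ^ 2) * (y j p.re * z j p.im) : ℂ) *
      Complex.I_sq

theorem hasWirtinger_vecNeg (p : ℂ) :
    HasWirtinger (vecNeg θ y z) ((-2 * weight θ v w p : ℂ) • vec₀ y z p)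
      (mixVecDeriv θ y z v w Complex.I p) p := by
  rw [vecNeg_eq]
  refine (HasWirtinger.toLp fun j => h.hasWirtinger_mixVec Complex.I p j).congr_deriv ?_ ?_
  · ext j
    have := vecPos_vecNeg_coeff θ v w p j
    have e := congrArg Complex.ofReal this
    push_cast at e
    simp only [vec₀, PiLp.smul_apply, smul_eq_mul]
    rw [← e]
    linear_combination (-2⁻¹ * (-4 * c θ * w p.im - γ θ j ^ 2) * (y j p.re * z j p.im) : ℂ) *
      Complex.I_sq
  · ext j
    simp only [mixVecDeriv]
    linear_combination (2⁻¹ * (-4 * c θ * w p.im - γ θ j ^ 2) * (y j p.re * z j p.im) : ℂ) *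
      Complex.I_sq

/-- The factor `ξ` is defined by values at `0`; conservation of the imaginary parts lets it be
computed at any point. -/
theorem period_eq (p : ℂ) : period θ y z =
    2⁻¹ * (-Complex.I * (c θ * (tripleProd z p.im - star (tripleProd z p.im))) -
      b θ * (tripleProd y p.re - star (tripleProd y p.re))) := by
  rw [period, ← h.fst.tripleProd_im p.re, ← h.snd.tripleProd_im p.im]
  simp only [RCLike.star_def, Complex.sub_conj]
  push_cast
  linear_combination ((c θ : ℂ) * ((tripleProd z p.im).im : ℂ)) * Complex.I_sq

theorem weight_smul_mixVecDeriv_neg (p : ℂ) :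
    (weight θ v w p : ℂ) • mixVecDeriv θ y z v w (-Complex.I) p =
      weightDeriv θ y z p • vecPos θ y z p - period θ y z • vecNeg θ y z p := by
  rw [h.period_eq p, weightDeriv, vecPos_eq, vecNeg_eq]
  ext j
  have k1 := congrArg Complex.ofReal (weight_mul_coeff θ v w p j)
  have k2 := congrArg Complex.ofReal (weight_smul_coeff θ v w p j)
  rw [tripleProd_eq y p.re j, tripleProd_eq z p.im j]
  have n0 := h.fst.mul_star j p.re
  have n1 := h.fst.mul_star (j + 1) p.re
  have n2 := h.fst.mul_star (j + 2) p.re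
  have m0 := h.snd.mul_star j p.im
  have m1 := h.snd.mul_star (j + 1) p.im
  have m2 := h.snd.mul_star (j + 2) p.im
  have hI := Complex.I_sq
  push_cast at k1 k2
  -- The norm relations are used backwards, so that both sides become polynomials in the functions
  -- and their conjugates.
  rw [← n0, ← m0] at k2
  rw [← n1, ← n2, ← m1, ← m2] at k1
  simp only [mixVecDeriv, mixVec, PiLp.smul_apply, PiLp.sub_apply, smul_eq_mul, star_mul']
  linear_combination (y j p.re * z j p.im) * k1 - Complex.I * (star (y (j + 1) p.re) * star (y (j + 2) p.re) *
        star (z (j + 1) p.im) * star (z (j + 2) p.im)) * k2 -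
    (c θ * γ θ j * y j p.re * z j p.im * star (z (j + 1) p.im) * star (z (j + 2) p.im) *
      z (j + 1) p.im * z (j + 2) p.im : ℂ) * hI

theorem weight_smul_mixVecDeriv_pos (p : ℂ) :
    (weight θ v w p : ℂ) • mixVecDeriv θ y z v w Complex.I p =
      star (weightDeriv θ y z p) • vecNeg θ y z p + star (period θ y z) • vecPos θ y z p := by
  rw [h.period_eq p, weightDeriv, vecPos_eq, vecNeg_eq]
  ext j
  have k1 := congrArg Complex.ofReal (weight_mul_coeff θ v w p j)
  have k2 := congrArg Complex.ofReal (weight_smul_coeff θ v w p j)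
  rw [tripleProd_eq y p.re j, tripleProd_eq z p.im j]
  have n0 := h.fst.mul_star j p.re
  have n1 := h.fst.mul_star (j + 1) p.re
  have n2 := h.fst.mul_star (j + 2) p.re
  have m0 := h.snd.mul_star j p.im
  have m1 := h.snd.mul_star (j + 1) p.im
  have m2 := h.snd.mul_star (j + 2) p.im
  have hI := Complex.I_sq
  push_cast at k1 k2
  rw [← n0, ← m0] at k2
  rw [← n1, ← n2, ← m1, ← m2] at k1
  simp only [mixVecDeriv, mixVec, PiLp.smul_apply, PiLp.add_apply, smul_eq_mul, star_mul',
    star_sub, star_add, star_neg, RCLike.star_def, Complex.conj_ofReal, Complex.conj_I,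
    map_inv₀, map_ofNat, Complex.conj_conj] at *
  linear_combination (y j p.re * z j p.im) * k1 + Complex.I * (starRingEnd ℂ (y (j + 1) p.re) * starRingEnd ℂ (y (j + 2) p.re) *
        starRingEnd ℂ (z (j + 1) p.im) * starRingEnd ℂ (z (j + 2) p.im)) * k2 -
    (c θ * γ θ j * y j p.re * z j p.im * starRingEnd ℂ (z (j + 1) p.im) *
      starRingEnd ℂ (z (j + 2) p.im) * z (j + 1) p.im * z (j + 2) p.im : ℂ) * hI

end IsData
end SLCone

/-! ### Orthogonality of the frame and zeros of the weight -/

namespace SLCone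

/-- A sum over three equally spaced angles keeps only frequencies divisible by three. Those of
degree three give `b` and `c`; the two sums of degree four contain only frequencies two and four. -/
theorem cubic_sums (θ : ℝ) :
    β θ 0 ^ 2 * γ θ 0 + β θ 1 ^ 2 * γ θ 1 + β θ 2 ^ 2 * γ θ 2 = 6 * c θ ∧
    β θ 0 * γ θ 0 ^ 2 + β θ 1 * γ θ 1 ^ 2 + β θ 2 * γ θ 2 ^ 2 = 6 * b θ ∧
    β θ 0 ^ 3 * γ θ 0 + β θ 1 ^ 3 * γ θ 1 + β θ 2 ^ 3 * γ θ 2 = 0 ∧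
    β θ 0 * γ θ 0 ^ 3 + β θ 1 * γ θ 1 ^ 3 + β θ 2 * γ θ 2 ^ 3 = 0 ∧
    β θ 0 ^ 3 + β θ 1 ^ 3 + β θ 2 ^ 3 = -6 * b θ ∧
    γ θ 0 ^ 3 + γ θ 1 ^ 3 + γ θ 2 ^ 3 = -6 * c θ := by
  obtain ⟨r, t, C, S, hr, ht, hCS, -, e0, e1, e2, f0, f1, f2, hb, hc⟩ := exists_trig_constants θ
  rw [e0, e1, e2, f0, f1, f2, hb, hc]
  refine ⟨?_, ?_, ?_, ?_, ?_, ?_⟩ <;> grind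

theorem β_mul_quadratic (θ x : ℝ) (j : Fin 3) :
    β θ j * ((β θ (j + 1) * x + 1) * (β θ (j + 2) * x + 1)) =
      -2 * b θ * x ^ 2 - β θ j ^ 2 * x + β θ j := by
  rw [b_eq θ j]
  linear_combination (β θ j * x) * β_sum' θ j

theorem γ_mul_quadratic (θ x : ℝ) (j : Fin 3) :
    γ θ j * ((γ θ (j + 1) * x + 1) * (γ θ (j + 2) * x + 1)) =
      -2 * c θ * x ^ 2 - γ θ j ^ 2 * x + γ θ j := by
  rw [c_eq θ j]
  linear_combination (γ θ j * x) * γ_sum' θ j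

/-- This sum is `|∂X⁰/∂s|²`, and the one in `sum_γ_sq` is `|∂X⁰/∂t|²`. Their equality is half of the
conformality of the map and makes `X⁺` and `X⁻` orthogonal. -/
theorem sum_β_sq (θ : ℝ) (v w : ℝ → ℝ) (p : ℂ) :
    ∑ j, β θ j ^ 2 * ((β θ (j + 1) * v p.re + 1) * (β θ (j + 2) * v p.re + 1)) *
      (γ θ j * w p.im + 1) = 6 * weight θ v w p := by
  obtain ⟨k1, k2, k3, k4, k5, k6⟩ := cubic_sums θ
  have l1 := β_sum θ
  have l2 := βγ_sum θ
  have l3 := β_sq_sum θ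
  have : ∀ j, β θ j ^ 2 * ((β θ (j + 1) * v p.re + 1) * (β θ (j + 2) * v p.re + 1)) *
      (γ θ j * w p.im + 1) = β θ j * (-2 * b θ * v p.re ^ 2 - β θ j ^ 2 * v p.re + β θ j) *
      (γ θ j * w p.im + 1) := fun j => by rw [← β_mul_quadratic]; ring
  simp only [this, Fin.sum_univ_three, weight, a]
  linear_combination w p.im * k1 - v p.re * w p.im * k3 - v p.re * k5 -
    2 * b θ * v p.re ^ 2 * w p.im * l2 - 2 * b θ * v p.re ^ 2 * l1 + l3

theorem sum_γ_sq (θ : ℝ) (v w : ℝ → ℝ) (p : ℂ) :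
    ∑ j, γ θ j ^ 2 * ((γ θ (j + 1) * w p.im + 1) * (γ θ (j + 2) * w p.im + 1)) *
      (β θ j * v p.re + 1) = 6 * weight θ v w p := by
  obtain ⟨k1, k2, k3, k4, k5, k6⟩ := cubic_sums θ
  have l1 := γ_sum θ
  have l2 := βγ_sum θ
  have l3 := γ_sq_sum θ
  have : ∀ j, γ θ j ^ 2 * ((γ θ (j + 1) * w p.im + 1) * (γ θ (j + 2) * w p.im + 1)) *
      (β θ j * v p.re + 1) = γ θ j * (-2 * c θ * w p.im ^ 2 - γ θ j ^ 2 * w p.im + γ θ j) *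
      (β θ j * v p.re + 1) := fun j => by rw [← γ_mul_quadratic]; ring
  simp only [this, Fin.sum_univ_three, weight, a]
  linear_combination v p.re * k2 - v p.re * w p.im * k4 - w p.im * k6 -
    2 * c θ * w p.im ^ 2 * v p.re * l2 - 2 * c θ * w p.im ^ 2 * l1 + l3

variable {θ : ℝ} {y z : Fin 3 → ℝ → ℂ} {v w : ℝ → ℝ}

namespace IsData
variable (h : IsData θ y z v w)
include h

theorem inner_vec₀_self (p : ℂ) : inner ℂ (vec₀ y z p) (vec₀ y z p) = 3 := by
  have e : ∀ j, y j p.re * z j p.im * starRingEnd ℂ (y j p.re * z j p.im) =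
      (((β θ j * v p.re + 1) * (γ θ j * w p.im + 1) : ℝ) : ℂ) := fun j => by
    have n0 := h.fst.mul_star j p.re
    have m0 := h.snd.mul_star j p.im
    push_cast
    rw [← n0, ← m0, map_mul]
    simp only [RCLike.star_def]; ring
  simp only [vec₀, PiLp.inner_apply, RCLike.inner_apply, e]
  rw [← Complex.ofReal_sum]
  norm_cast
  rw [Fin.sum_univ_three]
  linear_combination v p.re * w p.im * βγ_sum θ + v p.re * β_sum θ + w p.im * γ_sum θ

theorem inner_vec₀_mixVec (σ p : ℂ) : inner ℂ (vec₀ y z p) (mixVec θ y z σ p) = 0 := by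
  have e : ∀ j, ((β θ j : ℂ) * star (y (j + 1) p.re * y (j + 2) p.re) * z j p.im +
      σ * ((γ θ j : ℂ) * y j p.re * star (z (j + 1) p.im * z (j + 2) p.im))) *
      starRingEnd ℂ (y j p.re * z j p.im) =
      (β θ j * (γ θ j * w p.im + 1)) * star (tripleProd y p.re) +
        σ * (γ θ j * (β θ j * v p.re + 1)) * star (tripleProd z p.im) := fun j => by
    have n0 := h.fst.mul_star j p.re
    have m0 := h.snd.mul_star j p.im
    rw [tripleProd_eq y p.re j, tripleProd_eq z p.im j, ← n0, ← m0]
    simp only [RCLike.star_def, map_mul]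
    ring
  have l1 := congrArg Complex.ofReal (β_sum θ)
  have l2 := congrArg Complex.ofReal (γ_sum θ)
  have l3 := congrArg Complex.ofReal (βγ_sum θ)
  push_cast at l1 l2 l3
  simp only [vec₀, mixVec, PiLp.inner_apply, RCLike.inner_apply, e]
  rw [Fin.sum_univ_three]
  linear_combination (star (tripleProd y p.re)) * l1 + σ * (star (tripleProd z p.im)) * l2 +
    (w p.im * star (tripleProd y p.re) + σ * v p.re * star (tripleProd z p.im)) * l3

/-- The cross terms carry the factor `∑ β_j γ_j = 0`, and the two square sums agree. With `σ, τ = ±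
i` the right side is `12 W` for equal and `0` for opposite signs. -/
theorem inner_mixVec_mixVec (σ τ p : ℂ) :
    inner ℂ (mixVec θ y z σ p) (mixVec θ y z τ p) =
      6 * weight θ v w p * (1 + star σ * τ) := by
  have e : ∀ j, ((β θ j : ℂ) * star (y (j + 1) p.re * y (j + 2) p.re) * z j p.im +
      τ * ((γ θ j : ℂ) * y j p.re * star (z (j + 1) p.im * z (j + 2) p.im))) *
      starRingEnd ℂ ((β θ j : ℂ) * star (y (j + 1) p.re * y (j + 2) p.re) * z j p.im +
      σ * ((γ θ j : ℂ) * y j p.re * star (z (j + 1) p.im * z (j + 2) p.im))) =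
      ((β θ j ^ 2 * ((β θ (j + 1) * v p.re + 1) * (β θ (j + 2) * v p.re + 1)) *
      (γ θ j * w p.im + 1) : ℝ) : ℂ) + star σ * τ *
      ((γ θ j ^ 2 * ((γ θ (j + 1) * w p.im + 1) * (γ θ (j + 2) * w p.im + 1)) *
      (β θ j * v p.re + 1) : ℝ) : ℂ) + β θ j * γ θ j *
      (τ * (tripleProd y p.re * star (tripleProd z p.im)) +
        star σ * (star (tripleProd y p.re) * tripleProd z p.im)) := fun j => by
    have n0 := h.fst.mul_star j p.re
    have n1 := h.fst.mul_star (j + 1) p.re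
    have n2 := h.fst.mul_star (j + 2) p.re
    have m0 := h.snd.mul_star j p.im
    have m1 := h.snd.mul_star (j + 1) p.im
    have m2 := h.snd.mul_star (j + 2) p.im
    push_cast
    rw [tripleProd_eq y p.re j, tripleProd_eq z p.im j, ← n0, ← m0, ← n1, ← n2, ← m1, ← m2]
    simp only [RCLike.star_def, map_mul, map_add, Complex.conj_ofReal, Complex.conj_conj]
    ring
  have l3 := congrArg Complex.ofReal (βγ_sum θ)
  push_cast at l3
  simp only [mixVec, PiLp.inner_apply, RCLike.inner_apply, e, Finset.sum_add_distrib,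
    ← Finset.mul_sum, ← Finset.sum_mul, ← Complex.ofReal_sum, sum_β_sq, sum_γ_sq]
  rw [Fin.sum_univ_three]
  push_cast
  linear_combination (τ * (tripleProd y p.re * star (tripleProd z p.im)) +
        star σ * (star (tripleProd y p.re) * tripleProd z p.im)) * l3

theorem norm_vec₀_sq (p : ℂ) : ‖vec₀ y z p‖ ^ 2 = 3 := by
  have := h.inner_vec₀_self p
  rw [← inner_self_eq_norm_sq (𝕜 := ℂ), this]
  simp

theorem norm_vecPos_sq (p : ℂ) : ‖vecPos θ y z p‖ ^ 2 = 12 * weight θ v w p := by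
  have := h.inner_mixVec_mixVec (-Complex.I) (-Complex.I) p
  rw [← vecPos_eq] at this
  have e : (6 * weight θ v w p * (1 + star (-Complex.I) * -Complex.I) : ℂ) =
      (12 * weight θ v w p : ℝ) := by
    simp; ring
  rw [← inner_self_eq_norm_sq (𝕜 := ℂ), this, e]
  exact Complex.ofReal_re _

theorem norm_vecNeg_sq (p : ℂ) : ‖vecNeg θ y z p‖ ^ 2 = 12 * weight θ v w p := by
  have := h.inner_mixVec_mixVec Complex.I Complex.I p
  rw [← vecNeg_eq] at this
  have e : (6 * weight θ v w p * (1 + star Complex.I * Complex.I) : ℂ) =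
      (12 * weight θ v w p : ℝ) := by
    simp; ring
  rw [← inner_self_eq_norm_sq (𝕜 := ℂ), this, e]
  exact Complex.ofReal_re _

theorem inner_vec₀_vecPos (p : ℂ) : inner ℂ (vec₀ y z p) (vecPos θ y z p) = 0 := by
  rw [vecPos_eq, h.inner_vec₀_mixVec]

theorem inner_vec₀_vecNeg (p : ℂ) : inner ℂ (vec₀ y z p) (vecNeg θ y z p) = 0 := by
  rw [vecNeg_eq, h.inner_vec₀_mixVec]

theorem inner_vecPos_vecNeg (p : ℂ) : inner ℂ (vecPos θ y z p) (vecNeg θ y z p) = 0 := by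
  rw [vecPos_eq, vecNeg_eq, h.inner_mixVec_mixVec]
  simp

theorem inner_vecPos_vec₀ (p : ℂ) : inner ℂ (vecPos θ y z p) (vec₀ y z p) = 0 := by
  rw [← inner_conj_symm, h.inner_vec₀_vecPos, map_zero]

theorem inner_vecNeg_vec₀ (p : ℂ) : inner ℂ (vecNeg θ y z p) (vec₀ y z p) = 0 := by
  rw [← inner_conj_symm, h.inner_vec₀_vecNeg, map_zero]

theorem inner_vecNeg_vecPos (p : ℂ) : inner ℂ (vecNeg θ y z p) (vecPos θ y z p) = 0 := by
  rw [← inner_conj_symm, h.inner_vecPos_vecNeg, map_zero]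

theorem weight_nonneg (p : ℂ) : 0 ≤ weight θ v w p := by
  have := h.norm_vecPos_sq p
  nlinarith [sq_nonneg ‖vecPos θ y z p‖]

theorem vecPos_ne_zero {p : ℂ} (hp : weight θ v w p ≠ 0) : vecPos θ y z p ≠ 0 := by
  intro h0
  have := h.norm_vecPos_sq p
  rw [h0] at this
  simp at this
  exact hp this

theorem vecNeg_ne_zero {p : ℂ} (hp : weight θ v w p ≠ 0) : vecNeg θ y z p ≠ 0 := by
  intro h0
  have := h.norm_vecNeg_sq p
  rw [h0] at this
  simp at this
  exact hp this

theorem vecPos_eq_zero {p : ℂ} (hp : weight θ v w p = 0) : vecPos θ y z p = 0 := by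
  have := h.norm_vecPos_sq p
  rw [hp] at this
  simpa using this

theorem vecNeg_eq_zero {p : ℂ} (hp : weight θ v w p = 0) : vecNeg θ y z p = 0 := by
  have := h.norm_vecNeg_sq p
  rw [hp] at this
  simpa using this

/-- If `b B` and `c C` are not both zero, then `vecPos` and `vecNeg` have no zeros. -/
theorem weight_ne_zero (hBC : b θ * (tripleProd y 0).im ≠ 0 ∨ c θ * (tripleProd z 0).im ≠ 0)
    (p : ℂ) : weight θ v w p ≠ 0 := by
  intro hp
  have h1 := h.vecPos_eq_zero hp
  have h2 := h.vecNeg_eq_zero hp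
  -- The sum and the difference of `X⁺` and `X⁻` separate the derivatives of `X⁰` in `s` and in `t`.
  have e1 : ∀ j, (β θ j : ℂ) * star (y (j + 1) p.re * y (j + 2) p.re) * z j p.im = 0 := fun j => by
    have a1 := congrArg (fun x : EuclideanSpace ℂ (Fin 3) => x j) h1
    have a2 := congrArg (fun x : EuclideanSpace ℂ (Fin 3) => x j) h2
    simp only [vecPos, vecNeg, PiLp.zero_apply] at a1 a2
    linear_combination (a1 + a2) / 2
  have e2 : ∀ j, (γ θ j : ℂ) * y j p.re * star (z (j + 1) p.im * z (j + 2) p.im) = 0 := fun j => by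
    have a1 := congrArg (fun x : EuclideanSpace ℂ (Fin 3) => x j) h1
    have a2 := congrArg (fun x : EuclideanSpace ℂ (Fin 3) => x j) h2
    simp only [vecPos, vecNeg, PiLp.zero_apply] at a1 a2
    have : Complex.I * ((γ θ j : ℂ) * y j p.re * star (z (j + 1) p.im * z (j + 2) p.im)) = 0 := by
      linear_combination (a2 - a1) / 2
    exact (mul_eq_zero.1 this).resolve_left Complex.I_ne_zero
  refine vec₀_ne_zero h p ?_
  ext j
  simp only [vec₀, PiLp.zero_apply]
  rcases hBC with hB | hC
  -- Here no `β_j` is zero, and no `y_j` has a zero because the imaginary part of the product is the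
  -- constant `B ≠ 0`; so `e1` forces `z_j = 0`.
  · have hb : β θ j ≠ 0 := fun h0 => hB (by rw [b_eq θ j, h0]; ring)
    have hy : tripleProd y p.re ≠ 0 := fun h0 => hB (by
      rw [← h.fst.tripleProd_im p.re, h0]; simp)
    rw [tripleProd_eq y p.re j] at hy
    have := e1 j
    simp_all
  · have hb : γ θ j ≠ 0 := fun h0 => hC (by rw [c_eq θ j, h0]; ring)
    have hy : tripleProd z p.im ≠ 0 := fun h0 => hC (by
      rw [← h.snd.tripleProd_im p.im, h0]; simp)
    rw [tripleProd_eq z p.im j] at hy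
    have := e2 j
    simp_all

end IsData
end SLCone

/-! ### Projections onto the three lines commute with their Laplacians -/

theorem lineProj_mk {m : ℕ} (x : EuclideanSpace ℂ (Fin m)) (hx : x ≠ 0) :
    lineProj (Projectivization.mk ℂ x hx) =
      (((‖x‖ ^ 2 : ℝ) : ℂ)⁻¹) • InnerProductSpace.rankOne ℂ x x := by
  ext1 u
  change (Submodule.span ℂ {x}).starProjection u = _
  rw [Submodule.starProjection_singleton]
  simp [smul_smul, div_eq_inv_mul]

theorem isBoundedBilinearMap_rankOne (m : ℕ) : IsBoundedBilinearMap ℝ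
    fun x : EuclideanSpace ℂ (Fin m) × EuclideanSpace ℂ (Fin m) =>
      InnerProductSpace.rankOne ℂ x.1 x.2 :=
  { add_left := by simp
    smul_left := fun c x y => by
      ext1 z; simp [smul_comm c]
    add_right := by simp
    smul_right := fun c x y => by
      rw [← Complex.coe_smul c y, map_smulₛₗ]; simp
    bound := ⟨1, one_pos, fun x y => by simp⟩ }

theorem contDiff_rankOne (m : ℕ) : ContDiff ℝ ∞
    (fun x : EuclideanSpace ℂ (Fin m) × EuclideanSpace ℂ (Fin m) =>
      InnerProductSpace.rankOne ℂ x.1 x.2) :=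
  (isBoundedBilinearMap_rankOne m).contDiff (n := ∞)

theorem ContDiff.rankOne {m : ℕ} {f g : ℂ → EuclideanSpace ℂ (Fin m)} (hf : ContDiff ℝ ∞ f)
    (hg : ContDiff ℝ ∞ g) : ContDiff ℝ ∞ fun q => InnerProductSpace.rankOne ℂ (f q) (g q) := by
  have h := hf.prodMk hg
  have := (contDiff_rankOne m).comp h
  exact this

theorem contDiff_toLp {n : ℕ} {f : Fin n → ℂ → ℂ} (hf : ∀ j, ContDiff ℝ ∞ (f j)) :
    ContDiff ℝ ∞ fun q => (WithLp.toLp 2 fun j => f j q : EuclideanSpace ℂ (Fin n)) :=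
  ((PiLp.continuousLinearEquiv 2 ℂ fun _ : Fin n => ℂ).symm.toContinuousLinearMap.restrictScalars
    ℝ).contDiff.comp (contDiff_pi.2 hf)

theorem commute_rankOne {m : ℕ} {x u : EuclideanSpace ℂ (Fin m)} (h : inner ℂ x u = 0) :
    Commute (InnerProductSpace.rankOne ℂ x x) (InnerProductSpace.rankOne ℂ u u) := by
  have h' : inner ℂ u x = 0 := by rw [← inner_conj_symm, h, map_zero]
  rw [Commute, SemiconjBy, ContinuousLinearMap.mul_def, ContinuousLinearMap.mul_def,
    InnerProductSpace.rankOne_comp_rankOne, InnerProductSpace.rankOne_comp_rankOne, h, h',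
    zero_smul, zero_smul]

/-- For a selfadjoint family it suffices to compute `∂P/∂z`. -/
theorem HasWirtinger.of_star_eq {m : ℕ}
    {P : ℂ → EuclideanSpace ℂ (Fin m) →L[ℂ] EuclideanSpace ℂ (Fin m)}
    {u w : EuclideanSpace ℂ (Fin m) →L[ℂ] EuclideanSpace ℂ (Fin m)} {p : ℂ}
    (hP : HasWirtinger P u w p) (hs : ∀ q, Star.star (P q) = P q) :
    HasWirtinger P u (Star.star u) p := by
  have h1 := hP.star
  simp only [hs] at h1
  rwa [← h1.dZbar_eq, hP.dZbar_eq]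

theorem star_rankOne_self {m : ℕ} (x : EuclideanSpace ℂ (Fin m)) :
    star (InnerProductSpace.rankOne ℂ x x) = InnerProductSpace.rankOne ℂ x x := by
  rw [ContinuousLinearMap.star_eq_adjoint, InnerProductSpace.adjoint_rankOne]

namespace SLCone
variable {θ : ℝ} {y z : Fin 3 → ℝ → ℂ} {v w : ℝ → ℝ}

/-- The orthogonal projection onto the line of `vec₀`. -/
noncomputable def proj₀ (y z : Fin 3 → ℝ → ℂ) (p : ℂ) :
    EuclideanSpace ℂ (Fin 3) →L[ℂ] EuclideanSpace ℂ (Fin 3) :=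
  (3 : ℂ)⁻¹ • InnerProductSpace.rankOne ℂ (vec₀ y z p) (vec₀ y z p)

/-- The orthogonal projection onto the line of `vecPos`, off the zeros of the weight. -/
noncomputable def projPos (θ : ℝ) (y z : Fin 3 → ℝ → ℂ) (v w : ℝ → ℝ) (p : ℂ) :
    EuclideanSpace ℂ (Fin 3) →L[ℂ] EuclideanSpace ℂ (Fin 3) :=
  (12 * weight θ v w p : ℂ)⁻¹ • InnerProductSpace.rankOne ℂ (vecPos θ y z p) (vecPos θ y z p)

/-- The orthogonal projection onto the line of `vecNeg`, off the zeros of the weight. -/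
noncomputable def projNeg (θ : ℝ) (y z : Fin 3 → ℝ → ℂ) (v w : ℝ → ℝ) (p : ℂ) :
    EuclideanSpace ℂ (Fin 3) →L[ℂ] EuclideanSpace ℂ (Fin 3) :=
  (12 * weight θ v w p : ℂ)⁻¹ • InnerProductSpace.rankOne ℂ (vecNeg θ y z p) (vecNeg θ y z p)

theorem star_proj₀ (p : ℂ) : star (proj₀ y z p) = proj₀ y z p := by
  simp only [proj₀, star_smul, star_rankOne_self]
  simp

theorem star_projPos (p : ℂ) : star (projPos θ y z v w p) = projPos θ y z v w p := by
  simp only [projPos, star_smul, star_rankOne_self]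
  simp

theorem star_projNeg (p : ℂ) : star (projNeg θ y z v w p) = projNeg θ y z v w p := by
  simp only [projNeg, star_smul, star_rankOne_self]
  simp

namespace IsData
variable (h : IsData θ y z v w)
include h

theorem lineProj_vec₀ {p : ℂ} (hx : vec₀ y z p ≠ 0) :
    lineProj (Projectivization.mk ℂ (vec₀ y z p) hx) = proj₀ y z p := by
  rw [lineProj_mk, h.norm_vec₀_sq, proj₀]; norm_num

theorem lineProj_vecPos {p : ℂ} (hx : vecPos θ y z p ≠ 0) :
    lineProj (Projectivization.mk ℂ (vecPos θ y z p) hx) = projPos θ y z v w p := by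
  rw [lineProj_mk, h.norm_vecPos_sq, projPos]; norm_num

theorem lineProj_vecNeg {p : ℂ} (hx : vecNeg θ y z p ≠ 0) :
    lineProj (Projectivization.mk ℂ (vecNeg θ y z p) hx) = projNeg θ y z v w p := by
  rw [lineProj_mk, h.norm_vecNeg_sq, projNeg]; norm_num

theorem contDiff_y (j : Fin 3) : ContDiff ℝ ∞ fun p : ℂ => y j p.re :=
  (h.fst.contDiff j).comp Complex.reCLM.contDiff

theorem contDiff_z (j : Fin 3) : ContDiff ℝ ∞ fun p : ℂ => z j p.im :=
  (h.snd.contDiff j).comp Complex.imCLM.contDiff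

theorem contDiff_star_y (j k : Fin 3) : ContDiff ℝ ∞ fun p : ℂ => star (y j p.re * y k p.re) :=
  Complex.conjCLE.contDiff.comp ((h.contDiff_y j).mul (h.contDiff_y k))

theorem contDiff_star_z (j k : Fin 3) : ContDiff ℝ ∞ fun p : ℂ => star (z j p.im * z k p.im) :=
  Complex.conjCLE.contDiff.comp ((h.contDiff_z j).mul (h.contDiff_z k))

theorem contDiff_weight : ContDiff ℝ ∞ (weight θ v w) :=
  (contDiff_const.add (contDiff_const.mul (h.fst.contDiff_v.comp Complex.reCLM.contDiff))).add
    (contDiff_const.mul (h.snd.contDiff_v.comp Complex.imCLM.contDiff))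

theorem contDiff_vec₀ : ContDiff ℝ ∞ (vec₀ y z) :=
  contDiff_toLp fun j => (h.contDiff_y j).mul (h.contDiff_z j)

theorem contDiff_mixVec (σ : ℂ) : ContDiff ℝ ∞ (mixVec θ y z σ) :=
  contDiff_toLp fun j =>
    ((contDiff_const.mul (h.contDiff_star_y _ _)).mul (h.contDiff_z j)).add (contDiff_const.mul
      ((contDiff_const.mul (h.contDiff_y j)).mul (h.contDiff_star_z _ _)))

theorem contDiff_vecPos : ContDiff ℝ ∞ (vecPos θ y z) := by
  rw [vecPos_eq]; exact h.contDiff_mixVec _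

theorem contDiff_vecNeg : ContDiff ℝ ∞ (vecNeg θ y z) := by
  rw [vecNeg_eq]; exact h.contDiff_mixVec _

theorem contDiff_proj₀ : ContDiff ℝ ∞ (proj₀ y z) := by
  have h1 := h.contDiff_vec₀.rankOne h.contDiff_vec₀
  have h2 : ContDiff ℝ ∞ fun _ : ℂ => (3 : ℂ)⁻¹ := contDiff_const
  exact h2.smul h1

theorem contDiff_inv_weight (hW : ∀ p, weight θ v w p ≠ 0) :
    ContDiff ℝ ∞ fun p => (12 * weight θ v w p : ℂ)⁻¹ :=
  (contDiff_const.mul (Complex.ofRealCLM.contDiff.comp h.contDiff_weight)).inv fun p =>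
    mul_ne_zero (by norm_num) (Complex.ofReal_ne_zero.2 (hW p))

theorem contDiff_projPos (hW : ∀ p, weight θ v w p ≠ 0) : ContDiff ℝ ∞ (projPos θ y z v w) :=
  (h.contDiff_inv_weight hW).smul (h.contDiff_vecPos.rankOne h.contDiff_vecPos)

theorem contDiff_projNeg (hW : ∀ p, weight θ v w p ≠ 0) : ContDiff ℝ ∞ (projNeg θ y z v w) :=
  (h.contDiff_inv_weight hW).smul (h.contDiff_vecNeg.rankOne h.contDiff_vecNeg)

theorem eventually_weight_ne_zero {p : ℂ} (hp : weight θ v w p ≠ 0) :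
    ∀ᶠ q in nhds p, weight θ v w q ≠ 0 :=
  h.contDiff_weight.continuous.continuousAt.eventually_ne hp

theorem hasWirtinger_vecPos' {p : ℂ} (hp : weight θ v w p ≠ 0) :
    HasWirtinger (vecPos θ y z)
      ((weightDeriv θ y z p / weight θ v w p) • vecPos θ y z p -
        (period θ y z / weight θ v w p) • vecNeg θ y z p)
      ((-2 * weight θ v w p : ℂ) • vec₀ y z p) p := by
  refine (h.hasWirtinger_vecPos p).congr_deriv ?_ rfl
  have hp' : (weight θ v w p : ℂ) ≠ 0 := Complex.ofReal_ne_zero.2 hp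
  have e := h.weight_smul_mixVecDeriv_neg p
  rw [← inv_smul_smul₀ hp' (mixVecDeriv θ y z v w (-Complex.I) p), e, smul_sub, smul_smul,
    smul_smul, div_eq_inv_mul, div_eq_inv_mul]

theorem hasWirtinger_vecNeg' {p : ℂ} (hp : weight θ v w p ≠ 0) :
    HasWirtinger (vecNeg θ y z) ((-2 * weight θ v w p : ℂ) • vec₀ y z p)
      ((star (weightDeriv θ y z p) / weight θ v w p) • vecNeg θ y z p +
        (star (period θ y z) / weight θ v w p) • vecPos θ y z p) p := by
  refine (h.hasWirtinger_vecNeg p).congr_deriv rfl ?_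
  have hp' : (weight θ v w p : ℂ) ≠ 0 := Complex.ofReal_ne_zero.2 hp
  have e := h.weight_smul_mixVecDeriv_pos p
  rw [← inv_smul_smul₀ hp' (mixVecDeriv θ y z v w Complex.I p), e, smul_add, smul_smul,
    smul_smul, div_eq_inv_mul, div_eq_inv_mul]

/-- `∂P/∂z` is made of `X⁺ ⊗ X⁰` and `X⁰ ⊗ X⁻`; by the structure equations its `∂/∂z̄` derivative
contains only the diagonal terms `X ⊗ X` of the orthogonal frame. -/
theorem commute_proj₀ (p : ℂ) : Commute (proj₀ y z p) (planeLaplacian (proj₀ y z) p) := by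
  have hX := fun q => h.hasWirtinger_vec₀ q
  have h1 := fun q => ((hX q).rankOne (hX q)).const_smul (3 : ℂ)⁻¹
  have hA := ((((h.hasWirtinger_vecPos p).const_smul (2 : ℂ)⁻¹).rankOne (hX p)).add
    ((hX p).rankOne ((h.hasWirtinger_vecNeg p).const_smul (2 : ℂ)⁻¹))).const_smul (3 : ℂ)⁻¹
  refine commute_planeLaplacian (star_proj₀ p) (Filter.Eventually.of_forall fun q =>
    (h1 q).of_star_eq star_proj₀) hA ?_
  have c0 := Commute.refl (InnerProductSpace.rankOne ℂ (vec₀ y z p) (vec₀ y z p))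
  have c1 := commute_rankOne (h.inner_vec₀_vecPos p)
  have c2 := commute_rankOne (h.inner_vec₀_vecNeg p)
  refine Commute.smul_left (Commute.smul_right ?_ _) _
  simp only [map_smul, map_smulₛₗ, smul_apply]
  refine Commute.add_right (Commute.add_right ?_ ?_) (Commute.add_right ?_ ?_)
  · exact (c0.smul_right _).smul_right _
  · exact (c1.smul_right _).smul_right _
  · exact (c2.smul_right _).smul_right _
  · exact (c0.smul_right _).smul_right _

/-- The `∂/∂z̄` derivative of the second fundamental form between the lines of `vecPos` and
`vecNeg`. -/
theorem hasWirtinger_rankOne_vecNeg_vecPos {p : ℂ} (hp : weight θ v w p ≠ 0) :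
    ∃ u, HasWirtinger (fun q => ((weight θ v w q : ℂ) * (weight θ v w q : ℂ))⁻¹ •
        InnerProductSpace.rankOne ℂ (vecNeg θ y z q) (vecPos θ y z q)) u
      ((star (period θ y z) / weight θ v w p ^ 3) •
        (InnerProductSpace.rankOne ℂ (vecPos θ y z p) (vecPos θ y z p) -
          InnerProductSpace.rankOne ℂ (vecNeg θ y z p) (vecNeg θ y z p))) p := by
  have hp' : (weight θ v w p : ℂ) ≠ 0 := Complex.ofReal_ne_zero.2 hp
  -- The factor `W⁻²` absorbs the terms `W_z̄ / W` that the two vectors contribute, leaving only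
  -- diagonal terms.
  have hW := ((h.hasWirtinger_weight p).mul (h.hasWirtinger_weight p)).inv (mul_ne_zero hp' hp')
  have h1 := hW.smul ((h.hasWirtinger_vecNeg' hp).rankOne (h.hasWirtinger_vecPos' hp))
  refine ⟨_, h1.congr_deriv rfl ?_⟩
  simp only [map_smul, map_smulₛₗ, map_add, map_sub, smul_apply, add_apply, map_div₀,
    Complex.conj_ofReal, RCLike.star_def]
  match_scalars <;> (field_simp; try ring)

/-- In `∂P/∂z` the term `X⁺ ⊗ X⁺` cancels against the derivative of `1/W`. What remains is a
combination of `W⁻² X⁻ ⊗ X⁺` and `X⁺ ⊗ X⁰`, and both have diagonal `∂/∂z̄` derivatives. -/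
theorem commute_projPos {p : ℂ} (hp : weight θ v w p ≠ 0) :
    Commute (projPos θ y z v w p) (planeLaplacian (projPos θ y z v w) p) := by
  have hP : ∀ q, weight θ v w q ≠ 0 → ∃ w', HasWirtinger (projPos θ y z v w)
      (-(period θ y z / 12) • (((weight θ v w q : ℂ) * (weight θ v w q : ℂ))⁻¹ •
        InnerProductSpace.rankOne ℂ (vecNeg θ y z q) (vecPos θ y z q)) -
        (6 : ℂ)⁻¹ • InnerProductSpace.rankOne ℂ (vecPos θ y z q) (vec₀ y z q)) w' q := by
    intro q hq
    have hq' : (weight θ v w q : ℂ) ≠ 0 := Complex.ofReal_ne_zero.2 hq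
    have h1 := (((HasWirtinger.const (12 : ℂ) q).mul (h.hasWirtinger_weight q)).inv
      (mul_ne_zero (by norm_num) hq')).smul
      ((h.hasWirtinger_vecPos' hq).rankOne (h.hasWirtinger_vecPos' hq))
    refine ⟨_, h1.congr_deriv ?_ rfl⟩
    simp only [map_smul, map_smulₛₗ, map_sub, smul_apply, sub_apply, map_mul, map_neg,
      Complex.conj_ofReal, map_ofNat]
    match_scalars <;> (field_simp; try ring)
  obtain ⟨u, hu⟩ := h.hasWirtinger_rankOne_vecNeg_vecPos hp
  have hA := (hu.const_smul (-(period θ y z / 12))).sub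
    (((h.hasWirtinger_vecPos p).rankOne (h.hasWirtinger_vec₀ p)).const_smul (6 : ℂ)⁻¹)
  refine commute_planeLaplacian (star_projPos p)
    ((h.eventually_weight_ne_zero hp).mono fun q hq =>
      (hP q hq).elim fun _ hw => hw.of_star_eq star_projPos) hA ?_
  have c0 := Commute.refl (InnerProductSpace.rankOne ℂ (vecPos θ y z p) (vecPos θ y z p))
  have c1 := commute_rankOne (h.inner_vecPos_vec₀ p)
  have c2 := commute_rankOne (h.inner_vecPos_vecNeg p)
  refine Commute.smul_left ?_ _
  simp only [map_smul, map_smulₛₗ, smul_apply]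
  exact (((c0.sub_right c2).smul_right _).smul_right _).sub_right
    (((c1.smul_right _).add_right (c0.smul_right _)).smul_right _)

theorem commute_projNeg {p : ℂ} (hp : weight θ v w p ≠ 0) :
    Commute (projNeg θ y z v w p) (planeLaplacian (projNeg θ y z v w) p) := by
  have hP : ∀ q, weight θ v w q ≠ 0 → ∃ w', HasWirtinger (projNeg θ y z v w)
      ((period θ y z / 12) • (((weight θ v w q : ℂ) * (weight θ v w q : ℂ))⁻¹ •
        InnerProductSpace.rankOne ℂ (vecNeg θ y z q) (vecPos θ y z q)) -
        (6 : ℂ)⁻¹ • InnerProductSpace.rankOne ℂ (vec₀ y z q) (vecNeg θ y z q)) w' q := by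
    intro q hq
    have hq' : (weight θ v w q : ℂ) ≠ 0 := Complex.ofReal_ne_zero.2 hq
    have h1 := (((HasWirtinger.const (12 : ℂ) q).mul (h.hasWirtinger_weight q)).inv
      (mul_ne_zero (by norm_num) hq')).smul
      ((h.hasWirtinger_vecNeg' hq).rankOne (h.hasWirtinger_vecNeg' hq))
    refine ⟨_, h1.congr_deriv ?_ rfl⟩
    simp only [map_smul, map_smulₛₗ, map_add, smul_apply, Complex.conj_ofReal, map_div₀, RCLike.star_def, Complex.conj_conj]
    match_scalars <;> (field_simp; try ring)
  obtain ⟨u, hu⟩ := h.hasWirtinger_rankOne_vecNeg_vecPos hp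
  have hA := (hu.const_smul (period θ y z / 12)).sub
    (((h.hasWirtinger_vec₀ p).rankOne (h.hasWirtinger_vecNeg p)).const_smul (6 : ℂ)⁻¹)
  refine commute_planeLaplacian (star_projNeg p)
    ((h.eventually_weight_ne_zero hp).mono fun q hq =>
      (hP q hq).elim fun _ hw => hw.of_star_eq star_projNeg) hA ?_
  have c0 := Commute.refl (InnerProductSpace.rankOne ℂ (vecNeg θ y z p) (vecNeg θ y z p))
  have c1 := commute_rankOne (h.inner_vecNeg_vec₀ p)
  have c2 := commute_rankOne (h.inner_vecNeg_vecPos p)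
  refine Commute.smul_left ?_ _
  simp only [map_smul, map_smulₛₗ, smul_apply]
  exact (((c2.sub_right c0).smul_right _).smul_right _).sub_right
    (((c0.smul_right _).add_right (c1.smul_right _)).smul_right _)

end IsData
end SLCone

/-! ### The sections and the equations of the harmonic sequence -/

theorem isHarmonicMap_of_lineProj_eq {m : ℕ} {f : ℂ → CProj m}
    {P : ℂ → EuclideanSpace ℂ (Fin m) →L[ℂ] EuclideanSpace ℂ (Fin m)}
    (hf : ∀ p, lineProj (f p) = P p) (hs : ContDiff ℝ ∞ P)
    (hc : ∀ p, Commute (P p) (planeLaplacian P p)) : IsHarmonicMap f := by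
  have e : (fun p => lineProj (f p)) = P := funext hf
  refine isHarmonicMap_of_commute ?_ fun p => ?_
  · rw [IsSmoothMap, e]; exact hs
  · rw [e, hf]; exact hc p

theorem HasWirtinger.of_differentiableAt {V : Type*} [NormedAddCommGroup V] [NormedSpace ℂ V]
    {f : ℂ → V} {p : ℂ} (hf : DifferentiableAt ℝ f p) : HasWirtinger f (dZ f p) (dZbar f p) p := by
  refine hf.hasFDerivAt.congr_fderiv ?_
  ext1 x
  have e : fderiv ℝ f p x = (x.re : ℂ) • fderiv ℝ f p 1 + (x.im : ℂ) • fderiv ℝ f p Complex.I := by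
    rw [Complex.coe_smul, Complex.coe_smul, ← map_smul, ← map_smul, ← map_add]
    congr 1
    apply Complex.ext <;> simp
  have h1 : (x.re : ℂ) = 2⁻¹ * (x + starRingEnd ℂ x) := by rw [Complex.add_conj]; push_cast; ring
  have h2 : (x.im : ℂ) = -Complex.I * 2⁻¹ * (x - starRingEnd ℂ x) := by
    rw [Complex.sub_conj]; push_cast; linear_combination (x.im : ℂ) * Complex.I_sq
  rw [e, h1, h2, wirtingerMap_apply, dZ, dZbar]
  module

/-- A constant factor drops out of the derivative of `log ‖f‖²`; this allows the powers of `ξ` in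
the periodic sequence. -/
theorem dZ_smul_eq_add_log {m : ℕ} {f : ℂ → EuclideanSpace ℂ (Fin m)}
    {u w : EuclideanSpace ℂ (Fin m)} {ν : ℂ → ℝ} {a b : ℂ} {p : ℂ}
    (hf : HasWirtinger f (u + (a / ν p) • f p) w p)
    (hν : HasWirtinger (fun q => (ν q : ℂ)) a b p) (hn : ∀ q, ‖f q‖ ^ 2 = ν q)
    (h0 : ν p ≠ 0) {c : ℂ} (hc : c ≠ 0) :
    dZ (fun q => c • f q) p =
      c • u + dZ (fun q => ((Real.log (‖c • f q‖ ^ 2) : ℝ) : ℂ)) p • (c • f p) := by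
  have hc' : ‖c‖ ^ 2 ≠ 0 := pow_ne_zero _ (norm_ne_zero_iff.2 hc)
  have h1 : HasWirtinger (fun q => ((‖c • f q‖ ^ 2 : ℝ) : ℂ)) (((‖c‖ ^ 2 : ℝ) : ℂ) • a)
      (((‖c‖ ^ 2 : ℝ) : ℂ) • b) p := by
    refine (hν.const_smul ((‖c‖ ^ 2 : ℝ) : ℂ)).congr_of_eventuallyEq
      (Filter.Eventually.of_forall fun q => ?_)
    simp only [norm_smul, mul_pow, hn, Complex.ofReal_mul, smul_eq_mul]
  have hne : ‖c • f p‖ ^ 2 ≠ 0 := by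
    rw [norm_smul, mul_pow, hn]; exact mul_ne_zero hc' h0
  rw [(h1.ofReal_log hne).dZ_eq, (hf.const_smul c).dZ_eq, norm_smul, mul_pow, hn, smul_add,
    smul_smul, smul_smul]
  congr 2
  have h2 : ((‖c‖ ^ 2 : ℝ) : ℂ) ≠ 0 := Complex.ofReal_ne_zero.2 hc'
  have h3 : (ν p : ℂ) ≠ 0 := Complex.ofReal_ne_zero.2 h0
  rw [Complex.ofReal_mul, smul_eq_mul]
  field_simp

theorem dZbar_smul_eq {m : ℕ} {f : ℂ → EuclideanSpace ℂ (Fin m)}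
    {g u : EuclideanSpace ℂ (Fin m)} {p : ℂ}
    (hf : HasWirtinger f u (-(((‖f p‖ ^ 2 / ‖g‖ ^ 2 : ℝ) : ℂ) • g)) p) {c : ℂ} (hc : c ≠ 0) :
    dZbar (fun q => c • f q) p = -(((‖c • f p‖ ^ 2 / ‖c • g‖ ^ 2 : ℝ) : ℂ) • (c • g)) := by
  have hc' : ‖c‖ ^ 2 ≠ 0 := pow_ne_zero _ (norm_ne_zero_iff.2 hc)
  rw [(hf.const_smul c).dZbar_eq, norm_smul, norm_smul, mul_pow, mul_pow,
    mul_div_mul_left _ _ hc', smul_neg, smul_comm]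

namespace SLCone
variable {θ : ℝ} {y z : Fin 3 → ℝ → ℂ} {v w : ℝ → ℝ}

namespace IsData
variable (h : IsData θ y z v w)
include h

theorem norm_phi₀_sq (p : ℂ) : ‖phi₀ y z p‖ ^ 2 = 1 := by
  rw [phi₀, norm_smul, mul_pow, h.norm_vec₀_sq, Complex.norm_real, Real.norm_eq_abs, sq_abs,
    div_pow, Real.sq_sqrt (by norm_num)]
  norm_num

theorem norm_phiPos_sq (p : ℂ) : ‖phiPos θ y z p‖ ^ 2 = weight θ v w p := by
  rw [phiPos, norm_smul, mul_pow, h.norm_vecPos_sq, Complex.norm_real, Real.norm_eq_abs, sq_abs,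
    div_pow, mul_pow, Real.sq_sqrt (by norm_num)]
  ring

theorem norm_phiNeg_sq (p : ℂ) : ‖phiNeg θ y z v w p‖ ^ 2 = (weight θ v w p)⁻¹ := by
  rw [phiNeg, norm_smul, mul_pow, h.norm_vecNeg_sq, Complex.norm_real, Real.norm_eq_abs, sq_abs,
    neg_sq, div_pow, mul_pow, mul_pow, Real.sq_sqrt (by norm_num)]
  -- At a zero of the weight both sides are zero by convention. The formula at all points is what
  -- `dZ_smul_eq_add_log` asks for.
  by_cases hp : weight θ v w p = 0
  · simp [hp]
  · field_simp; norm_num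

theorem phi₀_ne_zero (p : ℂ) : phi₀ y z p ≠ 0 := by
  intro h0; have := h.norm_phi₀_sq p; rw [h0] at this; simp at this

theorem phiPos_ne_zero {p : ℂ} (hp : weight θ v w p ≠ 0) : phiPos θ y z p ≠ 0 := by
  intro h0; have := h.norm_phiPos_sq p; rw [h0] at this; simp at this; exact hp this.symm

theorem phiNeg_ne_zero {p : ℂ} (hp : weight θ v w p ≠ 0) : phiNeg θ y z v w p ≠ 0 := by
  intro h0; have := h.norm_phiNeg_sq p; rw [h0] at this; simp at this; exact hp this.symm

theorem inner_phi₀_phiPos (p : ℂ) : inner ℂ (phi₀ y z p) (phiPos θ y z p) = 0 := by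
  simp only [phi₀, phiPos, inner_smul_left, inner_smul_right, h.inner_vec₀_vecPos, mul_zero]

theorem inner_phiNeg_phi₀ (p : ℂ) : inner ℂ (phiNeg θ y z v w p) (phi₀ y z p) = 0 := by
  simp only [phi₀, phiNeg, inner_smul_left, inner_smul_right, h.inner_vecNeg_vec₀, mul_zero]

theorem inner_phiPos_phiNeg (p : ℂ) : inner ℂ (phiPos θ y z p) (phiNeg θ y z v w p) = 0 := by
  simp only [phiPos, phiNeg, inner_smul_left, inner_smul_right, h.inner_vecPos_vecNeg, mul_zero]

theorem contDiff_phi₀ : ContDiff ℝ ∞ (phi₀ y z) := by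
  have h2 : ContDiff ℝ ∞ fun _ : ℂ => ((1 / √3 : ℝ) : ℂ) := contDiff_const
  exact h2.smul h.contDiff_vec₀

theorem contDiff_phiPos : ContDiff ℝ ∞ (phiPos θ y z) := by
  have h2 : ContDiff ℝ ∞ fun _ : ℂ => ((1 / (2 * √3) : ℝ) : ℂ) := contDiff_const
  exact h2.smul h.contDiff_vecPos

theorem contDiffOn_phiNeg : ContDiffOn ℝ ∞ (phiNeg θ y z v w) {p | weight θ v w p = 0}ᶜ := by
  have h2 : ContDiffOn ℝ ∞ (fun p => -(1 / (2 * √3 * weight θ v w p)))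
      {p | weight θ v w p = 0}ᶜ := by
    refine (contDiffOn_const.div (contDiff_const.mul h.contDiff_weight).contDiffOn
      fun p hp => ?_).neg
    exact mul_ne_zero (by positivity) hp
  have h3 := Complex.ofRealCLM.contDiff.comp_contDiffOn h2
  exact h3.smul h.contDiff_vecNeg.contDiffOn

theorem hasWirtinger_phi₀ {p : ℂ} (hp : weight θ v w p ≠ 0) :
    HasWirtinger (phi₀ y z) (phiPos θ y z p)
      (-((weight θ v w p : ℂ) • phiNeg θ y z v w p)) p := by
  have hp' : (weight θ v w p : ℂ) ≠ 0 := Complex.ofReal_ne_zero.2 hp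
  have h3 : ((√3 : ℝ) : ℂ) ≠ 0 := Complex.ofReal_ne_zero.2 (by positivity)
  refine ((h.hasWirtinger_vec₀ p).const_smul ((1 / √3 : ℝ) : ℂ)).congr_deriv ?_ ?_
  · rw [phiPos]; push_cast; match_scalars; field_simp
  · rw [phiNeg]; push_cast; match_scalars; field_simp

theorem hasWirtinger_phiPos {p : ℂ} (hp : weight θ v w p ≠ 0) :
    HasWirtinger (phiPos θ y z) (period θ y z • phiNeg θ y z v w p +
        (weightDeriv θ y z p / weight θ v w p) • phiPos θ y z p)
      (-((weight θ v w p : ℂ) • phi₀ y z p)) p := by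
  have hp' : (weight θ v w p : ℂ) ≠ 0 := Complex.ofReal_ne_zero.2 hp
  have h3 : ((√3 : ℝ) : ℂ) ≠ 0 := Complex.ofReal_ne_zero.2 (by positivity)
  refine ((h.hasWirtinger_vecPos' hp).const_smul ((1 / (2 * √3) : ℝ) : ℂ)).congr_deriv ?_ ?_
  · rw [phiNeg, phiPos]; push_cast; match_scalars <;> field_simp
  · rw [phi₀]; push_cast; match_scalars; field_simp

/-- The factor `-1 / (2 √3 W)` turns `-2 W X⁰` into `φ_0`, and its own derivative cancels the `X⁻`
component `W_z̄ / W` of `∂X⁻/∂z̄`. -/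
theorem hasWirtinger_phiNeg {p : ℂ} (hp : weight θ v w p ≠ 0) :
    HasWirtinger (phiNeg θ y z v w) (phi₀ y z p +
        (-(weightDeriv θ y z p) / weight θ v w p) • phiNeg θ y z v w p)
      (-((star (period θ y z) / weight θ v w p ^ 2) • phiPos θ y z p)) p := by
  have hp' : (weight θ v w p : ℂ) ≠ 0 := Complex.ofReal_ne_zero.2 hp
  have h3 : ((√3 : ℝ) : ℂ) ≠ 0 := Complex.ofReal_ne_zero.2 (by positivity)
  have h1 := (((h.hasWirtinger_weight p).inv hp').smul (h.hasWirtinger_vecNeg' hp)).const_smul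
    (-(1 / (2 * (√3 : ℝ))) : ℂ)
  refine (h1.congr_of_eventuallyEq (Filter.Eventually.of_forall fun q => ?_)).congr_deriv ?_ ?_
  · simp only [phiNeg, smul_smul]; push_cast; congr 1; ring
  · rw [phiNeg, phi₀]; push_cast; match_scalars <;> (field_simp; try ring)
  · rw [phiPos]; push_cast; match_scalars <;> (field_simp; try ring)

theorem hasWirtinger_inv_weight {p : ℂ} (hp : weight θ v w p ≠ 0) :
    HasWirtinger (fun q => (((weight θ v w q)⁻¹ : ℝ) : ℂ)) (-weightDeriv θ y z p /
      weight θ v w p ^ 2) (-star (weightDeriv θ y z p) / weight θ v w p ^ 2) p := by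
  simpa using (h.hasWirtinger_weight p).inv (Complex.ofReal_ne_zero.2 hp)

section lift
variable {p c : ℂ} (hp : weight θ v w p ≠ 0) (hc : c ≠ 0)
include hp hc

theorem dZ_phi₀ : dZ (fun q => c • phi₀ y z q) p = c • phiPos θ y z p +
    dZ (fun q => ((Real.log (‖c • phi₀ y z q‖ ^ 2) : ℝ) : ℂ)) p • (c • phi₀ y z p) := by
  refine dZ_smul_eq_add_log (ν := fun _ => 1) (a := 0) (b := 0)
    ((h.hasWirtinger_phi₀ hp).congr_deriv ?_ rfl) (HasWirtinger.const _ p) h.norm_phi₀_sq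
    one_ne_zero hc
  simp

theorem dZ_phiPos : dZ (fun q => c • phiPos θ y z q) p = c • period θ y z • phiNeg θ y z v w p +
    dZ (fun q => ((Real.log (‖c • phiPos θ y z q‖ ^ 2) : ℝ) : ℂ)) p • (c • phiPos θ y z p) :=
  dZ_smul_eq_add_log (h.hasWirtinger_phiPos hp) (h.hasWirtinger_weight p) h.norm_phiPos_sq hp hc

theorem dZ_phiNeg : dZ (fun q => c • phiNeg θ y z v w q) p = c • phi₀ y z p +
    dZ (fun q => ((Real.log (‖c • phiNeg θ y z v w q‖ ^ 2) : ℝ) : ℂ)) p •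
      (c • phiNeg θ y z v w p) := by
  refine dZ_smul_eq_add_log ((h.hasWirtinger_phiNeg hp).congr_deriv ?_ rfl)
    (h.hasWirtinger_inv_weight hp) h.norm_phiNeg_sq (inv_ne_zero hp) hc
  have hp' : (weight θ v w p : ℂ) ≠ 0 := Complex.ofReal_ne_zero.2 hp
  congr 2
  push_cast
  field_simp

theorem dZbar_phi₀ : dZbar (fun q => c • phi₀ y z q) p =
    -(((‖c • phi₀ y z p‖ ^ 2 / ‖c • phiNeg θ y z v w p‖ ^ 2 : ℝ) : ℂ) •
      (c • phiNeg θ y z v w p)) := by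
  refine dZbar_smul_eq ((h.hasWirtinger_phi₀ hp).congr_deriv rfl ?_) hc
  rw [h.norm_phi₀_sq, h.norm_phiNeg_sq]; simp

theorem dZbar_phiPos : dZbar (fun q => c • phiPos θ y z q) p =
    -(((‖c • phiPos θ y z p‖ ^ 2 / ‖c • phi₀ y z p‖ ^ 2 : ℝ) : ℂ) • (c • phi₀ y z p)) := by
  refine dZbar_smul_eq ((h.hasWirtinger_phiPos hp).congr_deriv rfl ?_) hc
  rw [h.norm_phi₀_sq, h.norm_phiPos_sq]; simp

/-- The section before `φ_{-1}` is `ξ⁻¹ φ_1`. The factor `|ξ|²` from its norm combines with `ξ⁻¹` to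
the conjugate of `ξ`. -/
theorem dZbar_phiNeg (hξ : period θ y z ≠ 0) : dZbar (fun q => c • phiNeg θ y z v w q) p =
    -(((‖c • phiNeg θ y z v w p‖ ^ 2 / ‖c • (period θ y z)⁻¹ • phiPos θ y z p‖ ^ 2 : ℝ) : ℂ) •
      (c • (period θ y z)⁻¹ • phiPos θ y z p)) := by
  refine dZbar_smul_eq ((h.hasWirtinger_phiNeg hp).congr_deriv rfl ?_) hc
  have hp' : (weight θ v w p : ℂ) ≠ 0 := Complex.ofReal_ne_zero.2 hp
  rw [norm_smul, mul_pow, h.norm_phiNeg_sq, h.norm_phiPos_sq, smul_smul, norm_inv]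
  congr 2
  have h1 : period θ y z * star (period θ y z) = ((‖period θ y z‖ ^ 2 : ℝ) : ℂ) := by
    rw [RCLike.star_def, Complex.mul_conj']; push_cast; rfl
  have h2 : ((‖period θ y z‖ : ℝ) : ℂ) ≠ 0 := Complex.ofReal_ne_zero.2 (norm_ne_zero_iff.2 hξ)
  push_cast at h1 ⊢
  field_simp
  linear_combination h1

end lift

theorem isHarmonicMap_psi : IsHarmonicMap (psi h) :=
  isHarmonicMap_of_lineProj_eq (fun p => h.lineProj_vec₀ (vec₀_ne_zero h p)) h.contDiff_proj₀
    h.commute_proj₀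

/-- If `ξ = 0`, then the harmonic sequence terminates. -/
theorem not_isNonisotropic (hξ : period θ y z = 0) : ¬ IsNonisotropic (psi h) := by
  rintro ⟨-, Ψ, D, f, hΨ⟩
  have hf := hΨ.isLift
  obtain ⟨p, hp⟩ : ∃ p, p ∉ D := (hf.discrete 0).exists
  have hDo : ∀ᶠ q in nhds p, q ∉ D := hf.closed.isOpen_compl.mem_nhds hp
  -- The given sequence is arbitrary, but its `φ_0` spans the line of `X⁰`; the factor `g` is found
  -- by orthogonal projection and hence is smooth.
  set g : ℂ → ℂ := fun q => (3 : ℂ)⁻¹ * inner ℂ (vec₀ y z q) (f 0 q) with hg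
  have hgs : ContDiff ℝ ∞ g := contDiff_const.mul (h.contDiff_vec₀.inner ℂ hf.smooth_zero)
  have hg1 : ∀ q, HasWirtinger g (dZ g q) (dZbar g q) q := fun q =>
    HasWirtinger.of_differentiableAt (hgs.differentiable (by simp) q)
  have hf0 : f 0 = fun q => g q • vec₀ y z q := by
    funext q
    obtain ⟨hne, he⟩ := hf.lift_zero q
    have h0 := congrFun hΨ.zero q
    rw [he, psi, Projectivization.mk_eq_mk_iff'] at h0
    obtain ⟨c, hc⟩ := h0
    simp only [hg]
    rw [← hc, inner_smul_right, h.inner_vec₀_self, mul_comm c, inv_mul_cancel_left₀ (by norm_num)]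
  -- The equation for `∂φ_0/∂z` gives `φ_1` up to a multiple of `X⁰`, and orthogonality removes this
  -- multiple.
  have hf1 : ∀ q ∉ D, f 1 q = (g q / 2) • vecPos θ y z q := by
    intro q hq
    have e1 := hf.dZ_eq 0 trivial q hq
    have e2 := hf.orthogonal 0 trivial q hq
    have hne := (hf.lift 0 trivial q hq).1
    rw [zero_add] at e1 e2
    have e3 : dZ (f 0) q = dZ g q • vec₀ y z q + g q • (2 : ℂ)⁻¹ • vecPos θ y z q := by
      rw [hf0]
      exact ((hg1 q).smul (h.hasWirtinger_vec₀ q)).dZ_eq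
    set l := dZ (fun q => ((Real.log (‖f 0 q‖ ^ 2) : ℝ) : ℂ)) q with hl
    have e0 : f 0 q = g q • vec₀ y z q := congrFun hf0 q
    have hgq : g q ≠ 0 := fun h0 => hne (by rw [e0, h0, zero_smul])
    rw [e0] at e1 e2
    have e4 : f 1 q = (dZ g q - l * g q) • vec₀ y z q + (g q / 2) • vecPos θ y z q := by
      rw [e3] at e1
      have := eq_sub_of_add_eq e1.symm
      rw [this]
      module
    rw [e4, inner_smul_left, inner_add_right, inner_smul_right, inner_smul_right,
      h.inner_vec₀_self, h.inner_vec₀_vecPos] at e2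
    have e5 : dZ g q - l * g q = 0 := by
      have := (mul_eq_zero.1 e2).resolve_left (by simpa using hgq)
      simpa using this
    rw [e4, e5, zero_smul, zero_add]
  have hne1 := (hf.lift 1 trivial p hp).1
  have hW : weight θ v w p ≠ 0 := fun h0 => hne1 (by
    rw [hf1 p hp, h.vecPos_eq_zero h0, smul_zero])
  have hgp : g p ≠ 0 := fun h0 => hne1 (by rw [hf1 p hp, h0, zero_div, zero_smul])
  have hf1' : HasWirtinger (f 1) _ _ p :=
    ((((hg1 p).const_smul (2 : ℂ)⁻¹).smul (h.hasWirtinger_vecPos' hW))).congr_of_eventuallyEq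
      (hDo.mono fun q hq => by
        simp only [hf1 q hq, smul_eq_mul, div_eq_inv_mul])
  have e1 := hf.dZ_eq 1 trivial p hp
  have e2 := hf.orthogonal 1 trivial p hp
  have hne2 := (hf.lift 2 trivial p hp).1
  rw [hf1'.dZ_eq, hξ, zero_div, zero_smul, sub_zero, hf1 p hp] at e1
  rw [hf1 p hp] at e2
  norm_num at e1 e2
  set l := dZ (fun q => (2 : ℂ) * ((Real.log ‖f 1 q‖ : ℝ) : ℂ)) p with hl
  have e3 := eq_sub_of_add_eq e1.symm
  -- With `ξ = 0` no `X⁻` component is left, so `φ_2` is parallel to `φ_1`; orthogonality then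
  -- forces it to vanish.
  have e4 : f 2 p = (1 / 2 * dZ g p + 1 / 2 * g p * (weightDeriv θ y z p / weight θ v w p) -
      l * (g p / 2)) • vecPos θ y z p := by
    rw [e3]; module
  have e5 := e2.resolve_right hgp
  rw [e4, inner_smul_right, mul_eq_zero] at e5
  rcases e5 with e5 | e5
  · exact hne2 (by rw [e4, e5, zero_smul])
  · exact h.vecPos_ne_zero hW (inner_self_eq_zero.1 e5)

end IsData
end SLCone

/-! ### The periodic sequence -/

namespace SLCone
variable {θ : ℝ} {y z : Fin 3 → ℝ → ℂ} {v w : ℝ → ℝ}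

/-- The three sections from which the periodic sequence is made. -/
noncomputable def baseSection (θ : ℝ) (y z : Fin 3 → ℝ → ℂ) (v w : ℝ → ℝ) (r : ℤ) :
    ℂ → EuclideanSpace ℂ (Fin 3) :=
  if r = 0 then phiNeg θ y z v w else if r = 1 then phi₀ y z else phiPos θ y z

/-- The sequence of sections with `φ (k + 3) = ξ φ k`. -/
noncomputable def periodicSection (θ : ℝ) (y z : Fin 3 → ℝ → ℂ) (v w : ℝ → ℝ) (k : ℤ) (p : ℂ) :
    EuclideanSpace ℂ (Fin 3) :=
  period θ y z ^ ((k + 1) / 3) • baseSection θ y z v w ((k + 1) % 3) p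

/-- The shift by one in `periodicSection` puts the indices `-1, 0, 1` into one block with quotient
`0`; the block of index `n` carries `ξ ^ n`. -/
theorem periodicSection_neg (n : ℤ) : periodicSection θ y z v w (3 * n - 1) =
    fun p => period θ y z ^ n • phiNeg θ y z v w p := by
  funext p
  have e1 : (3 * n - 1 + 1) / 3 = n := by omega
  have e2 : (3 * n - 1 + 1) % 3 = 0 := by omega
  rw [periodicSection, e1, e2, baseSection, if_pos rfl]

theorem periodicSection_zero (n : ℤ) : periodicSection θ y z v w (3 * n) =
    fun p => period θ y z ^ n • phi₀ y z p := by
  funext p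
  have e1 : (3 * n + 1) / 3 = n := by omega
  have e2 : (3 * n + 1) % 3 = 1 := by omega
  rw [periodicSection, e1, e2, baseSection, if_neg (by norm_num), if_pos rfl]

theorem periodicSection_pos (n : ℤ) : periodicSection θ y z v w (3 * n + 1) =
    fun p => period θ y z ^ n • phiPos θ y z p := by
  funext p
  have e1 : (3 * n + 1 + 1) / 3 = n := by omega
  have e2 : (3 * n + 1 + 1) % 3 = 2 := by omega
  rw [periodicSection, e1, e2, baseSection, if_neg (by norm_num), if_neg (by norm_num)]

theorem exists_three_mul (k : ℤ) : ∃ n, k = 3 * n - 1 ∨ k = 3 * n ∨ k = 3 * n + 1 :=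
  ⟨(k + 1) / 3, by omega⟩

theorem periodicSection_add_three (hξ : period θ y z ≠ 0) (k : ℤ) (p : ℂ) :
    periodicSection θ y z v w (k + 3) p = period θ y z • periodicSection θ y z v w k p := by
  have e1 : (k + 3 + 1) / 3 = (k + 1) / 3 + 1 := by omega
  have e2 : (k + 3 + 1) % 3 = (k + 1) % 3 := by omega
  rw [periodicSection, periodicSection, e1, e2, smul_smul, zpow_add_one₀ hξ, mul_comm]

namespace IsData
variable (h : IsData θ y z v w) (hW : ∀ p, weight θ v w p ≠ 0) (hξ : period θ y z ≠ 0)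
include h hW hξ

theorem periodicSection_ne_zero (k : ℤ) (p : ℂ) : periodicSection θ y z v w k p ≠ 0 := by
  obtain ⟨n, rfl | rfl | rfl⟩ := exists_three_mul k
  · rw [periodicSection_neg]
    exact smul_ne_zero (zpow_ne_zero _ hξ) (h.phiNeg_ne_zero (hW p))
  · rw [periodicSection_zero]
    exact smul_ne_zero (zpow_ne_zero _ hξ) (h.phi₀_ne_zero p)
  · rw [periodicSection_pos]
    exact smul_ne_zero (zpow_ne_zero _ hξ) (h.phiPos_ne_zero (hW p))

omit hW hξ in
theorem inner_periodicSection (k : ℤ) (p : ℂ) :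
    inner ℂ (periodicSection θ y z v w k p) (periodicSection θ y z v w (k + 1) p) = 0 ∧
    inner ℂ (periodicSection θ y z v w k p) (periodicSection θ y z v w (k + 2) p) = 0 := by
  have i1 := h.inner_phi₀_phiPos p
  have i2 := h.inner_phiNeg_phi₀ p
  have i3 := h.inner_phiPos_phiNeg p
  have j1 : inner ℂ (phiPos θ y z p) (phi₀ y z p) = 0 := by
    rw [← inner_conj_symm, i1, map_zero]
  have j2 : inner ℂ (phi₀ y z p) (phiNeg θ y z v w p) = 0 := by
    rw [← inner_conj_symm, i2, map_zero]
  have j3 : inner ℂ (phiNeg θ y z v w p) (phiPos θ y z p) = 0 := by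
    rw [← inner_conj_symm, i3, map_zero]
  obtain ⟨n, rfl | rfl | rfl⟩ := exists_three_mul k
  · rw [show 3 * n - 1 + 1 = 3 * n by ring, show 3 * n - 1 + 2 = 3 * n + 1 by ring,
      periodicSection_neg, periodicSection_zero, periodicSection_pos]
    simp only [inner_smul_left, inner_smul_right, i2, j3, mul_zero, and_self]
  · rw [show 3 * n + 2 = 3 * (n + 1) - 1 by ring,
      periodicSection_neg, periodicSection_zero, periodicSection_pos]
    simp only [inner_smul_left, inner_smul_right, i1, j2, mul_zero, and_self]
  · rw [show 3 * n + 1 + 1 = 3 * (n + 1) - 1 by ring, show 3 * n + 1 + 2 = 3 * (n + 1) by ring,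
      periodicSection_neg, periodicSection_zero, periodicSection_pos]
    simp only [inner_smul_left, inner_smul_right, i3, j1, mul_zero, and_self]

omit hξ in
theorem contDiff_periodicSection (k : ℤ) : ContDiff ℝ ∞ (periodicSection θ y z v w k) := by
  have hc : ∀ n : ℤ, ContDiff ℝ ∞ fun _ : ℂ => period θ y z ^ n := fun n => contDiff_const
  obtain ⟨n, rfl | rfl | rfl⟩ := exists_three_mul k
  · rw [periodicSection_neg]
    refine (hc n).smul (contDiffOn_univ.1 ?_)
    refine h.contDiffOn_phiNeg.mono fun p _ => hW p
  · rw [periodicSection_zero]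
    exact (hc n).smul h.contDiff_phi₀
  · rw [periodicSection_pos]
    exact (hc n).smul h.contDiff_phiPos

/-- Inside a block the equations are those of the three sections. Going up from the top of a block
costs a factor `ξ`, going down from the bottom a factor `ξ⁻¹`. -/
theorem isHarmonicLift_periodicSection (Ψ : ℤ → ℂ → CProj 3)
    (hΨ : ∀ k p, Ψ k p = Projectivization.mk ℂ (periodicSection θ y z v w k p)
      (h.periodicSection_ne_zero hW hξ k p)) :
    IsHarmonicLift Set.univ ∅ Ψ (periodicSection θ y z v w) where
  discrete p := by simp
  closed := isClosed_empty
  smooth_zero := h.contDiff_periodicSection hW 0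
  lift_zero p := ⟨_, hΨ 0 p⟩
  smooth k _ := (h.contDiff_periodicSection hW k).contDiffOn
  lift k _ p _ := ⟨_, hΨ k p⟩
  outside k hk := absurd trivial hk
  orthogonal k _ p _ := (h.inner_periodicSection k p).1
  dZ_eq k _ p _ := by
    obtain ⟨n, rfl | rfl | rfl⟩ := exists_three_mul k
    · rw [show 3 * n - 1 + 1 = 3 * n by ring, periodicSection_neg, periodicSection_zero]
      exact h.dZ_phiNeg (hW p) (zpow_ne_zero _ hξ)
    · rw [periodicSection_zero, periodicSection_pos]
      exact h.dZ_phi₀ (hW p) (zpow_ne_zero _ hξ)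
    · rw [show 3 * n + 1 + 1 = 3 * (n + 1) - 1 by ring, periodicSection_neg, periodicSection_pos]
      have := h.dZ_phiPos (hW p) (zpow_ne_zero n hξ)
      rwa [smul_smul, ← zpow_add_one₀ hξ] at this
  dZbar_eq k _ p _ := by
    obtain ⟨n, rfl | rfl | rfl⟩ := exists_three_mul k
    · rw [show 3 * n - 1 - 1 = 3 * (n - 1) + 1 by ring, periodicSection_neg, periodicSection_pos]
      have := h.dZbar_phiNeg (hW p) (zpow_ne_zero n hξ) hξ
      have e : period θ y z ^ n • (period θ y z)⁻¹ • phiPos θ y z p =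
          period θ y z ^ (n - 1) • phiPos θ y z p := by rw [smul_smul, zpow_sub_one₀ hξ]
      rwa [e] at this
    · rw [periodicSection_zero, periodicSection_neg]
      exact h.dZbar_phi₀ (hW p) (zpow_ne_zero _ hξ)
    · rw [show 3 * n + 1 - 1 = 3 * n by ring, periodicSection_zero, periodicSection_pos]
      exact h.dZbar_phiPos (hW p) (zpow_ne_zero _ hξ)

theorem mk_periodicSection (k : ℤ) (p : ℂ) :
    (∃ hx : vecNeg θ y z p ≠ 0, Projectivization.mk ℂ (periodicSection θ y z v w (3 * k - 1) p)
      (h.periodicSection_ne_zero hW hξ _ p) = Projectivization.mk ℂ (vecNeg θ y z p) hx) ∧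
    (∃ hx : vec₀ y z p ≠ 0, Projectivization.mk ℂ (periodicSection θ y z v w (3 * k) p)
      (h.periodicSection_ne_zero hW hξ _ p) = Projectivization.mk ℂ (vec₀ y z p) hx) ∧
    (∃ hx : vecPos θ y z p ≠ 0, Projectivization.mk ℂ (periodicSection θ y z v w (3 * k + 1) p)
      (h.periodicSection_ne_zero hW hξ _ p) = Projectivization.mk ℂ (vecPos θ y z p) hx) := by
  refine ⟨⟨h.vecNeg_ne_zero (hW p), ?_⟩, ⟨vec₀_ne_zero h p, ?_⟩, ⟨h.vecPos_ne_zero (hW p), ?_⟩⟩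
  · refine (Projectivization.mk_eq_mk_iff' ℂ _ _ _ _).2
      ⟨period θ y z ^ k * ((-(1 / (2 * √3 * weight θ v w p)) : ℝ) : ℂ), ?_⟩
    simp only [periodicSection_neg, phiNeg, smul_smul]
  · refine (Projectivization.mk_eq_mk_iff' ℂ _ _ _ _).2
      ⟨period θ y z ^ k * ((1 / √3 : ℝ) : ℂ), ?_⟩
    simp only [periodicSection_zero, phi₀, smul_smul]
  · refine (Projectivization.mk_eq_mk_iff' ℂ _ _ _ _).2
      ⟨period θ y z ^ k * ((1 / (2 * √3) : ℝ) : ℂ), ?_⟩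
    simp only [periodicSection_pos, phiPos, smul_smul]

theorem isHarmonicSequenceWith_periodicSection :
    IsHarmonicSequenceWith (psi h) Set.univ ∅
      (fun k p => Projectivization.mk ℂ (periodicSection θ y z v w k p)
        (h.periodicSection_ne_zero hW hξ k p)) (periodicSection θ y z v w) where
  interval := Set.ordConnected_univ
  zero_mem := trivial
  zero := funext fun p => by
    obtain ⟨_, e⟩ := (h.mk_periodicSection hW hξ 0 p).2.1
    simp only [mul_zero] at e
    exact e
  harmonic k _ := by
    obtain ⟨n, rfl | rfl | rfl⟩ := exists_three_mul k
    · refine isHarmonicMap_of_lineProj_eq (fun p => ?_) (h.contDiff_projNeg hW)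
        fun p => h.commute_projNeg (hW p)
      obtain ⟨hx, e⟩ := (h.mk_periodicSection hW hξ n p).1
      rw [e, h.lineProj_vecNeg]
    · refine isHarmonicMap_of_lineProj_eq (fun p => ?_) h.contDiff_proj₀ h.commute_proj₀
      obtain ⟨hx, e⟩ := (h.mk_periodicSection hW hξ n p).2.1
      rw [e, h.lineProj_vec₀]
    · refine isHarmonicMap_of_lineProj_eq (fun p => ?_) (h.contDiff_projPos hW)
        fun p => h.commute_projPos (hW p)
      obtain ⟨hx, e⟩ := (h.mk_periodicSection hW hξ n p).2.2
      rw [e, h.lineProj_vecPos]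
  isLift := h.isHarmonicLift_periodicSection hW hξ _ fun _ _ => rfl

theorem isSuperconformal_psi : IsSuperconformal (psi h) := by
  have hs := h.isHarmonicSequenceWith_periodicSection hW hξ
  refine ⟨⟨h.isHarmonicMap_psi, _, _, _, hs⟩, _, ⟨_, _, hs⟩, fun j k h1 h2 p => ?_⟩
  rw [Projectivization.submodule_mk, Projectivization.submodule_mk,
    Submodule.isOrtho_span]
  rintro _ rfl _ rfl
  obtain ⟨i1, i2⟩ := h.inner_periodicSection j p
  rcases (show k = j + 1 ∨ k = j + 2 by push_cast at h2; omega) with rfl | rfl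
  · exact i1
  · exact i2

end IsData
end SLCone

/-! ### Consequences of the differential equations when the product is real -/

/-- A solution of a homogeneous linear differential inequality that vanishes somewhere vanishes
everywhere. -/
theorem eq_zero_of_norm_deriv_le {E : Type*} [NormedAddCommGroup E] [NormedSpace ℝ E]
    {f f' : ℝ → E} {K : ℝ → ℝ} (hK : Continuous K) (hf : ∀ s, HasDerivAt f (f' s) s)
    (hb : ∀ s, ‖f' s‖ ≤ K s * ‖f s‖) {s₀ : ℝ} (h0 : f s₀ = 0) (s : ℝ) : f s = 0 := by
  have key : ∀ (g g' : ℝ → E) (L : ℝ → ℝ), Continuous L → (∀ s, HasDerivAt g (g' s) s) →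
      (∀ s, ‖g' s‖ ≤ L s * ‖g s‖) → ∀ s₁ s₂, s₁ ≤ s₂ → g s₁ = 0 → g s₂ = 0 := by
    intro g g' L hL hg hb s₁ s₂ hs h1
    obtain ⟨M, hM⟩ := (isCompact_Icc (a := s₁) (b := s₂)).exists_bound_of_continuousOn
      hL.continuousOn
    refine eq_zero_of_abs_deriv_le_mul_abs_self_of_eq_zero_right (K := M) (f' := g')
      (fun t _ => (hg t).continuousAt.continuousWithinAt)
      (fun t _ => (hg t).hasDerivWithinAt) h1 (fun t ht => ?_) s₂ (Set.right_mem_Icc.2 hs)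
    refine (hb t).trans (mul_le_mul_of_nonneg_right ?_ (norm_nonneg _))
    exact (le_abs_self _).trans (hM t (Set.Ico_subset_Icc_self ht))
  rcases le_total s₀ s with hs | hs
  · exact key f f' K hK hf hb s₀ s hs h0
  -- Values before `s₀` are reached by reversing time.
  · have := key (fun t => f (-t)) (fun t => -f' (-t)) (fun t => K (-t)) (by fun_prop)
      (fun t => by
        have := (hf (-t)).scomp t (hasDerivAt_neg t)
        rwa [neg_one_smul] at this)
      (fun t => by rw [norm_neg]; exact hb (-t)) (-s₀) (-s) (neg_le_neg hs) (by rw [neg_neg, h0])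
    rwa [neg_neg] at this

namespace SLCone

namespace IsTriple
variable {δ : Fin 3 → ℝ} {y : Fin 3 → ℝ → ℂ} {v : ℝ → ℝ} (h : IsTriple δ y v)
include h

/-- In the extremal case the function `v` cannot reach the critical value unless it is constant. -/
theorem const_of_extremal {k : ℝ} (hk : k = -(1 / 2) * (δ 0 * δ 1 * δ 2)) (hk2 : k ^ 2 = 1 / 216)
    (hB : (tripleProd y 0).im = 0) {s₀ : ℝ} (hs : 1 / 6 + k * v s₀ = 0) (s : ℝ) :
    1 / 6 + k * v s = 0 := by
  have hd : ∀ s, HasDerivAt (fun s => 1 / 6 + k * v s) (k * (2 * (tripleProd y s).re)) s :=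
    fun s => ((h.hasDerivAt_v_real s).const_mul k).const_add _
  -- In the extremal case the cubic of the energy equation has a double root: with `x = k v`, it is
  -- `x'² = 8 (1/12 - x) (1/6 + x)²`. So the derivative of `1/6 + x` is bounded by a continuous
  -- multiple of `1/6 + x`; the absolute value avoids the sign of `1/12 - x`.
  refine eq_zero_of_norm_deriv_le (K := fun s => √(8 * |1 / 12 - k * v s|)) ?_ hd (fun s => ?_) hs s
  · have := h.contDiff_v.continuous
    fun_prop
  · have e := h.tripleProd_normSq s
    rw [h.tripleProd_im, hB, ← hk] at e
    have e2 : (k * (2 * (tripleProd y s).re)) ^ 2 =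
        8 * (1 / 12 - k * v s) * (1 / 6 + k * v s) ^ 2 := by
      linear_combination (4 * k ^ 2) * e + 4 * hk2
    have e3 : √(8 * |1 / 12 - k * v s|) * |1 / 6 + k * v s| =
        √(8 * |1 / 12 - k * v s| * (1 / 6 + k * v s) ^ 2) := by
      rw [Real.sqrt_mul (by positivity) ((1 / 6 + k * v s) ^ 2), Real.sqrt_sq_eq_abs]
    rw [Real.norm_eq_abs, Real.norm_eq_abs, e3]
    refine Real.abs_le_sqrt ?_
    rw [e2]
    gcongr
    exact le_abs_self _

/-- Critical points of `v` are nondegenerate except in the extremal case. -/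
theorem eventually_re_ne_zero {k : ℝ} (hk : k = -(1 / 2) * (δ 0 * δ 1 * δ 2))
    (hk2 : k ^ 2 ≠ 1 / 216) (hB : (tripleProd y 0).im = 0) {s₀ : ℝ}
    (hs : (tripleProd y s₀).re = 0) :
    ∀ᶠ s in nhds s₀, s ≠ s₀ → (tripleProd y s).re ≠ 0 := by
  have hd : HasDerivAt (fun s => (tripleProd y s).re) (-(6 * k) * v s₀ ^ 2 - v s₀) s₀ := by
    have := Complex.reCLM.hasFDerivAt.comp_hasDerivAt s₀ (h.hasDerivAt_tripleProd s₀)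
    refine this.congr_deriv ?_
    rw [hk, Complex.reCLM_apply, Complex.ofReal_re]
  have e := h.tripleProd_normSq s₀
  rw [h.tripleProd_im, hB, hs, ← hk] at e
  -- A degenerate critical point has `v = 0` or `6 k v = -1`. The energy equation excludes the
  -- first, where the cubic is `1`, and in the second case forces `k² = 1/216`.
  have hne : -(6 * k) * v s₀ ^ 2 - v s₀ ≠ 0 := by
    intro h0
    have h1 : v s₀ * (6 * k * v s₀ + 1) = 0 := by linear_combination -h0
    rcases mul_eq_zero.1 h1 with h2 | h2
    · rw [h2] at e; norm_num at e
    · apply hk2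
      have hkv : k * v s₀ = -1 / 6 := by linarith
      have e3 : k ^ 2 * (1 - v s₀ ^ 2 / 2 - 2 * k * v s₀ ^ 3) = 0 := by rw [← e]; ring
      have e4 : k ^ 2 * (1 - v s₀ ^ 2 / 2 - 2 * k * v s₀ ^ 3) =
        k ^ 2 - (k * v s₀) ^ 2 / 2 - 2 * (k * v s₀) ^ 3 := by ring
      rw [e4, hkv] at e3
      linarith
  have := hd.eventually_ne hne (c := 0)
  exact eventually_nhdsWithin_iff.1 this

/-- If `y_1 y_2 y_3` is real, then up to constant factors of modulus one the functions `y_j` are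
real. -/
theorem exists_real_structure (hB : (tripleProd y 0).im = 0) :
    ∃ d : Fin 3 → ℂ, (∀ j, d j * (d (j + 1) * d (j + 2)) = 1) ∧ ∀ j s, d j * y j s = star (y j s) := by
  have hinit : ∃ d : Fin 3 → ℂ, (∀ j, d j * (d (j + 1) * d (j + 2)) = 1) ∧
      ∀ j, d j * y j 0 = star (y j 0) := by
    have aux : ∀ x : ℂ, ∃ c : ℂ, c ≠ 0 ∧ c * x = star x := by
      intro x
      by_cases hx : x = 0
      · exact ⟨1, one_ne_zero, by simp [hx]⟩
      · exact ⟨star x / x, div_ne_zero (star_ne_zero.2 hx) hx, div_mul_cancel₀ _ hx⟩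
    choose d hd0 hd using fun j => aux (y j 0)
    -- If some `y_j` vanishes at `0`, its factor is free and can be adjusted to make the product
    -- one; otherwise the product is one because `y_1 y_2 y_3` is real.
    by_cases hy : ∃ j, y j 0 = 0
    · obtain ⟨j, hj⟩ := hy
      refine ⟨Function.update d j (d (j + 1) * d (j + 2))⁻¹, ?_, fun i => ?_⟩
      · have e : ∀ i, Function.update d j (d (j + 1) * d (j + 2))⁻¹ i *
            (Function.update d j (d (j + 1) * d (j + 2))⁻¹ (i + 1) *
              Function.update d j (d (j + 1) * d (j + 2))⁻¹ (i + 2)) =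
            (d (j + 1) * d (j + 2))⁻¹ * (d (j + 1) * d (j + 2)) := fun i => by
          rw [← mul_assoc, fin3_prod_cyclic, ← fin3_prod_cyclic _ j, Function.update_self,
            Function.update_of_ne (by simp), Function.update_of_ne (by simp), mul_assoc]
        intro i
        rw [e, inv_mul_cancel₀ (mul_ne_zero (hd0 _) (hd0 _))]
      · by_cases hi : i = j
        · subst hi; simp [hj]
        · rw [Function.update_of_ne hi, hd]
    · push Not at hy
      refine ⟨d, fun j => ?_, hd⟩
      have h1 : tripleProd y 0 ≠ 0 := mul_ne_zero (mul_ne_zero (hy 0) (hy 1)) (hy 2)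
      have h2 : star (tripleProd y 0) = tripleProd y 0 := Complex.conj_eq_iff_im.2 hB
      rw [tripleProd_eq y 0 j] at h1 h2
      apply mul_right_cancel₀ h1
      have h3 : d j * y j 0 * (d (j + 1) * y (j + 1) 0) * (d (j + 2) * y (j + 2) 0) =
          y j 0 * y (j + 1) 0 * y (j + 2) 0 := by
        rw [hd, hd, hd, ← star_mul', ← star_mul', h2]
      linear_combination h3
  obtain ⟨d, hd, hd0⟩ := hinit
  refine ⟨d, hd, ?_⟩
  -- The defects from being real satisfy a homogeneous linear system, because the product of the
  -- factors is one; they vanish at `0`, hence always.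
  have hg : ∀ j s, HasDerivAt (fun s => d j * y j s - star (y j s))
      (δ j * (-(d j * d (j + 1) * y (j + 1) s * (d (j + 2) * y (j + 2) s - star (y (j + 2) s))) -
        d j * star (y (j + 2) s) * (d (j + 1) * y (j + 1) s - star (y (j + 1) s)))) s := by
    intro j s
    refine (((h.deriv j s).const_mul (d j)).sub (h.deriv j s).star).congr_deriv ?_
    simp only [star_mul', RCLike.star_def, Complex.conj_ofReal, Complex.conj_conj]
    linear_combination (δ j * (y (j + 1) s) * (y (j + 2) s)) * hd j
  have hK : ∀ j, Continuous fun s => |δ j| * (‖d j * d (j + 1) * y (j + 1) s‖ +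
      ‖d j * star (y (j + 2) s)‖) := fun j => by
    have c1 := (h.contDiff (j + 1)).continuous
    have c2 := (h.contDiff (j + 2)).continuous
    fun_prop
  have main := eq_zero_of_norm_deriv_le (f := fun s j => d j * y j s - star (y j s))
    (K := fun s => ∑ j, |δ j| * (‖d j * d (j + 1) * y (j + 1) s‖ + ‖d j * star (y (j + 2) s)‖))
    (continuous_finsetSum _ fun j _ => hK j) (fun s => hasDerivAt_pi.2 fun j => hg j s)
    (fun s => ?_) (s₀ := 0) (by funext j; simp [hd0])
  · intro j s
    exact sub_eq_zero.1 (congrFun (main s) j)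
  · set g : Fin 3 → ℂ := fun j => d j * y j s - star (y j s) with hgdef
    have hle : ∀ j, ‖d j * y j s - star (y j s)‖ ≤ ‖g‖ := fun j => norm_le_pi_norm g j
    refine (pi_norm_le_iff_of_nonneg (by positivity)).2 fun j => ?_
    have h1 : |δ j| * (‖d j * d (j + 1) * y (j + 1) s‖ + ‖d j * star (y (j + 2) s)‖) ≤
        ∑ j, |δ j| * (‖d j * d (j + 1) * y (j + 1) s‖ + ‖d j * star (y (j + 2) s)‖) :=
      Finset.single_le_sum (f := fun j => |δ j| * (‖d j * d (j + 1) * y (j + 1) s‖ +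
        ‖d j * star (y (j + 2) s)‖)) (fun i _ => by positivity) (Finset.mem_univ j)
    refine le_trans ?_ (mul_le_mul_of_nonneg_right h1 (norm_nonneg _))
    rw [norm_mul, Complex.norm_real, Real.norm_eq_abs, mul_assoc |δ j| _ ‖g‖, add_mul]
    refine mul_le_mul_of_nonneg_left ((norm_sub_le _ _).trans ?_) (abs_nonneg _)
    rw [norm_neg, norm_mul, norm_mul (d j * star (y (j + 2) s))]
    exact add_le_add (mul_le_mul_of_nonneg_left (hle _) (norm_nonneg _))
      (mul_le_mul_of_nonneg_left (hle _) (norm_nonneg _))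

end IsTriple
end SLCone

/-! ### Extension of harmonic maps over a discrete set -/

/-- A selfadjoint projection of trace one is the projection onto a line. -/
theorem exists_lineProj_eq {m : ℕ} {Q : EuclideanSpace ℂ (Fin m) →L[ℂ] EuclideanSpace ℂ (Fin m)}
    (h1 : Q * Q = Q) (h2 : star Q = Q) (h3 : LinearMap.trace ℂ _ Q.toLinearMap = 1) :
    ∃ x : CProj m, lineProj x = Q := by
  obtain ⟨hS, hQ⟩ := isStarProjection_iff_eq_starProjection_range.1 (⟨h1, h2⟩ : IsStarProjection Q)
  have hp : LinearMap.IsProj Q.range Q.toLinearMap :=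
    ⟨fun x => ⟨x, rfl⟩, fun x ⟨u, hu⟩ => by
      rw [← hu]; exact congrArg (fun T : _ →L[ℂ] _ => T u) h1⟩
  have hf : Module.finrank ℂ Q.range = 1 := by
    have := hp.trace
    rw [h3] at this
    exact_mod_cast this.symm
  refine ⟨Projectivization.mk'' Q.range hf, ?_⟩
  conv_rhs => rw [hQ]
  simp only [lineProj, Projectivization.submodule_mk'']

theorem lineProj_injective (m : ℕ) : Function.Injective (lineProj (m := m)) := fun _ _ h =>
  Projectivization.submodule_injective (Submodule.starProjection_inj.1 h)

theorem trace_lineProj {m : ℕ} (x : CProj m) :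
    LinearMap.trace ℂ _ (lineProj x).toLinearMap = 1 := by
  have hp : LinearMap.IsProj x.submodule (lineProj x).toLinearMap :=
    ⟨fun u => Submodule.starProjection_apply_mem _ u,
      fun u hu => Submodule.starProjection_eq_self_iff.2 hu⟩
  rw [hp.trace, Projectivization.finrank_submodule, Nat.cast_one]

theorem eq_of_eq_off_discrete {X : Type*} [TopologicalSpace X] [T2Space X] {D : Set ℂ}
    (hD : ∀ p, ∀ᶠ q in nhdsWithin p {p}ᶜ, q ∉ D) {f g : ℂ → X} (hf : Continuous f)
    (hg : Continuous g) (h : ∀ p ∉ D, f p = g p) (p : ℂ) : f p = g p :=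
  tendsto_nhds_unique_of_eventuallyEq ((hf.tendsto p).mono_left nhdsWithin_le_nhds)
    ((hg.tendsto p).mono_left nhdsWithin_le_nhds) ((hD p).mono h)

theorem continuous_planeLaplacian {m : ℕ}
    {P : ℂ → EuclideanSpace ℂ (Fin m) →L[ℂ] EuclideanSpace ℂ (Fin m)} (hP : ContDiff ℝ ∞ P) :
    Continuous (planeLaplacian P) :=
  (contDiff_fderiv_apply (contDiff_fderiv_apply hP 1) 1).continuous.add
    (contDiff_fderiv_apply (contDiff_fderiv_apply hP Complex.I) Complex.I).continuous

/-- A smooth family of operators that off a discrete set is given by the projections onto the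
lines of a harmonic map is so everywhere. -/
theorem exists_harmonic_extension {m : ℕ} {D : Set ℂ}
    (hD : ∀ p, ∀ᶠ q in nhdsWithin p {p}ᶜ, q ∉ D) (hc : IsClosed D)
    {Q P : ℂ → EuclideanSpace ℂ (Fin m) →L[ℂ] EuclideanSpace ℂ (Fin m)} (hQ : ContDiff ℝ ∞ Q)
    (hQP : ∀ p ∉ D, Q p = P p) (hP : ∀ p ∉ D, ∃ x, lineProj x = P p)
    (hcomm : ∀ p ∉ D, Commute (P p) (planeLaplacian P p)) :
    ∃ f : ℂ → CProj m, IsHarmonicMap f ∧ ∀ p ∉ D, lineProj (f p) = P p := by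
  have hQc := hQ.continuous
  -- Being idempotent, selfadjoint, of trace one and commuting with the Laplacian are closed
  -- conditions, so they pass to the points of `D` by continuity.
  have h1 := eq_of_eq_off_discrete hD (f := fun p => Q p * Q p) (hQc.mul hQc) hQc fun p hp => by
    obtain ⟨x, hx⟩ := hP p hp
    rw [hQP p hp, ← hx, lineProj_mul_self]
  have h2 := eq_of_eq_off_discrete hD (f := fun p => star (Q p))
    ((ContinuousLinearMap.adjoint (𝕜 := ℂ)).continuous.comp hQc) hQc fun p hp => by
    obtain ⟨x, hx⟩ := hP p hp
    rw [hQP p hp, ← hx, star_lineProj]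
  have h3 := eq_of_eq_off_discrete hD
    (f := fun p => LinearMap.trace ℂ _ (Q p).toLinearMap) (g := fun _ => 1) (by
      simp only [LinearMap.trace_eq_sum_inner _ (EuclideanSpace.basisFun (Fin m) ℂ)]
      exact continuous_finsetSum _ fun i _ =>
        continuous_const.inner (hQc.clm_apply continuous_const)) continuous_const fun p hp => by
    obtain ⟨x, hx⟩ := hP p hp
    rw [hQP p hp, ← hx, trace_lineProj]
  choose f hf using fun p => exists_lineProj_eq (h1 p) (h2 p) (h3 p)
  refine ⟨f, isHarmonicMap_of_lineProj_eq hf hQ fun p => ?_, fun p hp => by rw [hf, hQP p hp]⟩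
  have hL := continuous_planeLaplacian hQ
  refine eq_of_eq_off_discrete hD (f := fun p => Q p * planeLaplacian Q p)
    (g := fun p => planeLaplacian Q p * Q p) (hQc.mul hL) (hL.mul hQc) (fun p hp => ?_) p
  have he : Q =ᶠ[nhds p] P := Filter.eventually_of_mem (hc.isOpen_compl.mem_nhds hp) hQP
  have e1 : ∀ e : ℂ, (fun q => fderiv ℝ Q q e) =ᶠ[nhds p] fun q => fderiv ℝ P q e := fun e =>
    (he.fderiv (𝕜 := ℝ)).mono fun _ hq => congrArg (fun T => T e) hq
  have : planeLaplacian Q p = planeLaplacian P p := by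
    rw [planeLaplacian, planeLaplacian, (e1 1).fderiv_eq, (e1 Complex.I).fderiv_eq]
  rw [this, hQP p hp]
  exact hcomm p hp

/-! ### The cross product with the real map -/

namespace SLCone
variable {θ : ℝ} {y z : Fin 3 → ℝ → ℂ} {v w : ℝ → ℝ}

/-- The vectors `a_j` for which `x ↦ (⟪a_j, x⟫)_j` is, for a vector `X` that is real with respect to
the real structure given by `d`, the cross product with `X`. -/
noncomputable def crossVec (d : Fin 3 → ℂ) (X : EuclideanSpace ℂ (Fin 3)) (j : Fin 3) :
    EuclideanSpace ℂ (Fin 3) :=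
  (star (d (j + 2)) * X (j + 1)) • EuclideanSpace.single (j + 2) 1 -
    (star (d (j + 1)) * X (j + 2)) • EuclideanSpace.single (j + 1) 1

/-- The complex structure on the tangent plane of the sphere at `X / √3`, extended complex linearly
and by zero, and multiplied by `i`. -/
noncomputable def crossMap (d : Fin 3 → ℂ) (X : EuclideanSpace ℂ (Fin 3)) :
    EuclideanSpace ℂ (Fin 3) →L[ℂ] EuclideanSpace ℂ (Fin 3) :=
  (Complex.I * ((√3 : ℝ) : ℂ)⁻¹) •
    ∑ j, InnerProductSpace.rankOne ℂ (EuclideanSpace.single j 1) (crossVec d X j)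

theorem crossMap_apply (d : Fin 3 → ℂ) (X x : EuclideanSpace ℂ (Fin 3)) (j : Fin 3) :
    crossMap d X x j = Complex.I * ((√3 : ℝ) : ℂ)⁻¹ *
      (star (X (j + 1)) * (d (j + 2) * x (j + 2)) - star (X (j + 2)) * (d (j + 1) * x (j + 1))) := by
  have e : ∀ i, inner ℂ (crossVec d X i) x =
      star (X (i + 1)) * (d (i + 2) * x (i + 2)) - star (X (i + 2)) * (d (i + 1) * x (i + 1)) := by
    intro i
    rw [crossVec, inner_sub_left, inner_smul_left, inner_smul_left,
      EuclideanSpace.inner_single_left, EuclideanSpace.inner_single_left]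
    simp only [map_mul, map_one, RCLike.star_def, Complex.conj_conj, one_mul]
    ring
  simp only [crossMap, smul_apply, sum_apply, InnerProductSpace.rankOne_apply, e,
    PiLp.smul_apply, smul_eq_mul]
  congr 1
  fin_cases j <;> simp [Fin.sum_univ_three]

namespace IsData
variable (h : IsData θ y z v w)
include h

theorem contDiff_crossMap (d : Fin 3 → ℂ) : ContDiff ℝ ∞ fun p => crossMap d (vec₀ y z p) := by
  have hX : ∀ j, ContDiff ℝ ∞ fun p => vec₀ y z p j := fun j =>
    (h.contDiff_y j).mul (h.contDiff_z j)
  have hs : ∀ (c : ℂ) (x : EuclideanSpace ℂ (Fin 3)) (j : Fin 3),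
      ContDiff ℝ ∞ fun p => (c * vec₀ y z p j) • x := fun c x j => by
    have h1 : ContDiff ℝ ∞ fun p => c * vec₀ y z p j := contDiff_const.mul (hX j)
    have h2 : ContDiff ℝ ∞ fun _ : ℂ => x := contDiff_const
    exact h1.smul h2
  have hv : ∀ j, ContDiff ℝ ∞ fun p => crossVec d (vec₀ y z p) j := fun j =>
    (hs _ _ _).sub (hs _ _ _)
  have h1 : ContDiff ℝ ∞ fun p => ∑ j, InnerProductSpace.rankOne ℂ
      (EuclideanSpace.single j (1 : ℂ)) (crossVec d (vec₀ y z p) j) :=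
    ContDiff.sum fun j _ => contDiff_const.rankOne (hv j)
  have h2 : ContDiff ℝ ∞ fun _ : ℂ => Complex.I * ((√3 : ℝ) : ℂ)⁻¹ := contDiff_const
  exact h2.smul h1

/-- In `β_{j+2} |y_{j+1}|² - β_{j+1} |y_{j+2}|²` the function `v` cancels and `-√3 γ_j` remains;
likewise for `z`, with `√3 β_j`. So the cross product exchanges the two parts of `mixVec`, up to
conjugation. -/
theorem cross_vec₀_mixVec (σ p : ℂ) (j : Fin 3) :
    vec₀ y z p (j + 1) * mixVec θ y z σ p (j + 2) - vec₀ y z p (j + 2) * mixVec θ y z σ p (j + 1) =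
      √3 * (σ * (β θ j * (y (j + 1) p.re * y (j + 2) p.re) * star (z j p.im)) -
        γ θ j * star (y j p.re) * (z (j + 1) p.im * z (j + 2) p.im)) := by
  obtain ⟨e1, e2, e3, e4⟩ := fin3_add j
  have n1 := h.fst.mul_star (j + 1) p.re
  have n2 := h.fst.mul_star (j + 2) p.re
  have m1 := h.snd.mul_star (j + 1) p.im
  have m2 := h.snd.mul_star (j + 2) p.im
  have k1 := congrArg Complex.ofReal (β_diff θ j)
  have k2 := congrArg Complex.ofReal (γ_diff θ j)
  push_cast at k1 k2
  simp only [vec₀, mixVec, e1, e2, e3, e4, star_mul']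
  linear_combination (star (y j p.re) * (z (j + 1) p.im * z (j + 2) p.im)) *
      (β θ (j + 2) * n1 - β θ (j + 1) * n2 + k1) +
    σ * (y (j + 1) p.re * y (j + 2) p.re) * star (z j p.im) *
      (γ θ (j + 2) * m1 - γ θ (j + 1) * m2 + k2)

/-- Three nonzero orthogonal vectors in `ℂ³`, once normalized, form an orthonormal basis. -/
theorem proj_sum {p : ℂ} (hp : weight θ v w p ≠ 0) (x : EuclideanSpace ℂ (Fin 3)) :
    proj₀ y z p x + projPos θ y z v w p x + projNeg θ y z v w p x = x := by
  set c : ℝ := (√(12 * weight θ v w p))⁻¹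
  have hpos : 0 < weight θ v w p := lt_of_le_of_ne (h.weight_nonneg p) hp.symm
  have hc : c ^ 2 = (12 * weight θ v w p)⁻¹ := by
    rw [inv_pow, Real.sq_sqrt (by positivity)]
  have hc3 : ((√3)⁻¹ : ℝ) ^ 2 = 3⁻¹ := by rw [inv_pow, Real.sq_sqrt (by norm_num)]
  let f : Fin 3 → EuclideanSpace ℂ (Fin 3) := ![(((√3)⁻¹ : ℝ) : ℂ) • vec₀ y z p,
    (c : ℂ) • vecPos θ y z p, (c : ℂ) • vecNeg θ y z p]
  have hn : ∀ (r : ℝ) (u : EuclideanSpace ℂ (Fin 3)), r ^ 2 * ‖u‖ ^ 2 = 1 → ‖(r : ℂ) • u‖ = 1 := by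
    intro r u hu
    rw [← sq_eq_sq₀ (norm_nonneg _) zero_le_one, norm_smul, mul_pow, Complex.norm_real,
      Real.norm_eq_abs, sq_abs, hu, one_pow]
  have ho : Orthonormal ℂ f := by
    refine ⟨fun i => ?_, fun i j hij => ?_⟩
    · fin_cases i
      · exact hn _ _ (by rw [hc3, h.norm_vec₀_sq]; norm_num)
      · exact hn _ _ (by rw [hc, h.norm_vecPos_sq]; field_simp)
      · exact hn _ _ (by rw [hc, h.norm_vecNeg_sq]; field_simp)
    · have hm : ∀ (r r' : ℝ) (x x' : EuclideanSpace ℂ (Fin 3)), inner ℂ x x' = 0 →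
          inner ℂ ((r : ℂ) • x) ((r' : ℂ) • x') = 0 := fun r r' x x' e => by
        rw [inner_smul_left, inner_smul_right, e, mul_zero, mul_zero]
      fin_cases i <;> fin_cases j <;> first | exact absurd rfl hij | skip
      · exact hm _ _ _ _ (h.inner_vec₀_vecPos p)
      · exact hm _ _ _ _ (h.inner_vec₀_vecNeg p)
      · exact hm _ _ _ _ (h.inner_vecPos_vec₀ p)
      · exact hm _ _ _ _ (h.inner_vecPos_vecNeg p)
      · exact hm _ _ _ _ (h.inner_vecNeg_vec₀ p)
      · exact hm _ _ _ _ (h.inner_vecNeg_vecPos p)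
  have hb : ⊤ ≤ Submodule.span ℂ (Set.range f) := by
    rw [ho.linearIndependent.span_eq_top_of_card_eq_finrank (by simp)]
  have hs := (OrthonormalBasis.mk ho hb).sum_repr' x
  simp only [OrthonormalBasis.coe_mk, Fin.sum_univ_three] at hs
  conv_rhs => rw [← hs]
  simp only [f, proj₀, projPos, projNeg, smul_apply, InnerProductSpace.rankOne_apply,
    Matrix.cons_val_zero, Matrix.cons_val_one, Matrix.cons_val, inner_smul_left, smul_smul,
    Complex.conj_ofReal]
  have hc' : (c : ℂ) ^ 2 = (12 * (weight θ v w p : ℂ))⁻¹ := by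
    rw [← Complex.ofReal_pow, hc]; push_cast; rfl
  have hc3' : (((√3)⁻¹ : ℝ) : ℂ) ^ 2 = 3⁻¹ := by
    rw [← Complex.ofReal_pow, hc3]; push_cast; rfl
  rw [← hc', ← hc3']
  module

/-- For a real structure that is compatible with the data, `crossMap` has the eigenvectors `vec₀`,
`vecPos`, `vecNeg`. -/
theorem crossMap_eq {d : Fin 3 → ℂ} {p : ℂ} (hp : weight θ v w p ≠ 0)
    (hd0 : ∀ j, d j * vec₀ y z p j = star (vec₀ y z p j))
    (hd1 : ∀ j, d j * vecPos θ y z p j = star (vecNeg θ y z p j))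
    (hd2 : ∀ j, d j * vecNeg θ y z p j = star (vecPos θ y z p j)) :
    crossMap d (vec₀ y z p) = projPos θ y z v w p - projNeg θ y z v w p := by
  have h3 : ((√3 : ℝ) : ℂ) ≠ 0 := Complex.ofReal_ne_zero.2 (by positivity)
  have c0 : crossMap d (vec₀ y z p) (vec₀ y z p) = 0 := by
    ext j
    rw [crossMap_apply, hd0, hd0, PiLp.zero_apply]
    ring
  have c1 : crossMap d (vec₀ y z p) (vecPos θ y z p) = vecPos θ y z p := by
    ext j
    have e := congrArg star (h.cross_vec₀_mixVec Complex.I p j)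
    rw [crossMap_apply, hd1, hd1, vecNeg_eq]
    simp only [star_sub, star_mul', RCLike.star_def, Complex.conj_ofReal, Complex.conj_conj,
      Complex.conj_I] at e ⊢
    rw [e, vecPos]
    simp only [star_mul', RCLike.star_def]
    field_simp
    linear_combination (-(β θ j : ℂ) * starRingEnd ℂ (y (j + 1) p.re) *
      starRingEnd ℂ (y (j + 2) p.re) * z j p.im) * Complex.I_sq
  have c2 : crossMap d (vec₀ y z p) (vecNeg θ y z p) = -vecNeg θ y z p := by
    ext j
    have e := congrArg star (h.cross_vec₀_mixVec (-Complex.I) p j)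
    rw [crossMap_apply, hd2, hd2, vecPos_eq]
    simp only [star_sub, star_mul', star_neg, RCLike.star_def, Complex.conj_ofReal,
      Complex.conj_conj, Complex.conj_I] at e ⊢
    rw [e, PiLp.neg_apply, vecNeg]
    simp only [star_mul', RCLike.star_def]
    field_simp
    linear_combination ((β θ j : ℂ) * starRingEnd ℂ (y (j + 1) p.re) *
      starRingEnd ℂ (y (j + 2) p.re) * z j p.im) * Complex.I_sq
  ext1 x
  have hx := h.proj_sum hp x
  conv_lhs => rw [← hx]
  rw [map_add, map_add, sub_apply]
  simp only [proj₀, projPos, projNeg, smul_apply, InnerProductSpace.rankOne_apply, map_smul, c0,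
    c1, c2]
  module

end IsData
end SLCone

/-! ### Isolated zeros and harmonic lines in the isotropic case -/

namespace SLCone
variable {θ : ℝ} {y z : Fin 3 → ℝ → ℂ} {v w : ℝ → ℝ}

namespace IsData
variable (h : IsData θ y z v w)
include h

/-- If the weight is identically zero, then the map is constant. -/
theorem psi_const (hW : ∀ p, weight θ v w p = 0) : ∃ x, ∀ p, psi h p = x := by
  have hd : ∀ p, HasFDerivAt (vec₀ y z) (0 : ℂ →L[ℝ] EuclideanSpace ℂ (Fin 3)) p := fun p => by
    refine ((h.hasWirtinger_vec₀ p).congr_deriv (u' := 0) (w' := 0) ?_ ?_).congr_fderiv ?_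
    · rw [h.vecPos_eq_zero (hW p), smul_zero]
    · rw [h.vecNeg_eq_zero (hW p), smul_zero]
    · ext1 x
      simp [wirtingerMap_apply]
  refine ⟨psi h 0, fun p => ?_⟩
  have e := is_const_of_fderiv_eq_zero (𝕜 := ℝ) (fun p => (hd p).differentiableAt)
    (fun p => (hd p).fderiv) p 0
  simp only [psi, e]

section
variable (hB : b θ * (tripleProd y 0).im = 0) (hC : c θ * (tripleProd z 0).im = 0)
  (hψ : ¬ ∃ x, ∀ p, psi h p = x)
include hB hC hψ

omit hC in
-- If `c = 0`, then `b² = 1/216`, so `B = 0` and `const_of_extremal` applies. The weight depends on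
-- `s` only; one zero would make it vanish identically and `ψ` constant.
theorem weight_ne_zero_of_c_eq_zero (hc : c θ = 0) (p : ℂ) : weight θ v w p ≠ 0 := by
  intro hp
  have k := b_sq_add_c_sq θ
  rw [hc] at k
  have hb2 : b θ ^ 2 = 1 / 216 := by linarith
  have hb : b θ ≠ 0 := fun h0 => by rw [h0] at hb2; norm_num at hb2
  refine hψ (h.psi_const fun q => ?_)
  have := h.fst.const_of_extremal (k := b θ) rfl hb2 ((mul_eq_zero.1 hB).resolve_left hb)
    (s₀ := p.re) (by rw [weight, hc, a] at hp; linarith) q.re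
  rw [weight, hc, a]
  linarith

omit hB in
theorem weight_ne_zero_of_b_eq_zero (hb : b θ = 0) (p : ℂ) : weight θ v w p ≠ 0 := by
  intro hp
  have k := b_sq_add_c_sq θ
  rw [hb] at k
  have hc2 : c θ ^ 2 = 1 / 216 := by linarith
  have hc : c θ ≠ 0 := fun h0 => by rw [h0] at hc2; norm_num at hc2
  refine hψ (h.psi_const fun q => ?_)
  have := h.snd.const_of_extremal (k := c θ) rfl hc2 ((mul_eq_zero.1 hC).resolve_left hc)
    (s₀ := p.im) (by rw [weight, hb, a] at hp; linarith) q.im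
  rw [weight, hb, a]
  linarith

omit hψ hB hC in
/-- The weight is minimal at its zeros. -/
theorem re_eq_zero_of_weight_eq_zero (hb : b θ ≠ 0) (hc : c θ ≠ 0) {p : ℂ}
    (hp : weight θ v w p = 0) : (tripleProd y p.re).re = 0 ∧ (tripleProd z p.im).re = 0 := by
  have d1 : HasDerivAt (fun s => weight θ v w ⟨s, p.im⟩) (b θ * (2 * (tripleProd y p.re).re)) p.re :=
    (((h.fst.hasDerivAt_v_real p.re).const_mul (b θ)).const_add a).add_const (c θ * w p.im)
  have d2 : HasDerivAt (fun t => weight θ v w ⟨p.re, t⟩) (c θ * (2 * (tripleProd z p.im).re)) p.im :=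
    ((h.snd.hasDerivAt_v_real p.im).const_mul (c θ)).const_add (a + b θ * v p.re)
  have m1 : IsLocalMin (fun s => weight θ v w ⟨s, p.im⟩) p.re :=
    Filter.Eventually.of_forall fun s => by
      change weight θ v w p ≤ _
      rw [hp]; exact h.weight_nonneg _
  have m2 : IsLocalMin (fun t => weight θ v w ⟨p.re, t⟩) p.im :=
    Filter.Eventually.of_forall fun s => by
      change weight θ v w p ≤ _
      rw [hp]; exact h.weight_nonneg _
  have e1 := m1.hasDerivAt_eq_zero d1
  have e2 := m2.hasDerivAt_eq_zero d2
  exact ⟨by simpa [hb] using e1, by simpa [hc] using e2⟩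

/-- When `b` and `c` are nonzero, `B = C = 0`, and `b² + c² = 1/216` excludes the extremal value for
both. Both coordinates of a zero are then isolated critical points. -/
theorem eventually_weight_ne_zero_punctured (p : ℂ) :
    ∀ᶠ q in nhdsWithin p {p}ᶜ, q ∉ {q | weight θ v w q = 0} := by
  by_cases hc : c θ = 0
  · exact Filter.Eventually.of_forall (h.weight_ne_zero_of_c_eq_zero hB hψ hc)
  by_cases hb : b θ = 0
  · exact Filter.Eventually.of_forall (h.weight_ne_zero_of_b_eq_zero hC hψ hb)
  by_cases hp : weight θ v w p = 0
  swap
  · exact (h.eventually_weight_ne_zero hp).filter_mono nhdsWithin_le_nhds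
  obtain ⟨r1, r2⟩ := h.re_eq_zero_of_weight_eq_zero hb hc hp
  have k := b_sq_add_c_sq θ
  have hb2 : b θ ^ 2 ≠ 1 / 216 := fun e => hc (pow_eq_zero_iff two_ne_zero |>.1 (by linarith))
  have hc2 : c θ ^ 2 ≠ 1 / 216 := fun e => hb (pow_eq_zero_iff two_ne_zero |>.1 (by linarith))
  have v1 := h.fst.eventually_re_ne_zero (k := b θ) rfl hb2 ((mul_eq_zero.1 hB).resolve_left hb) r1
  have v2 := h.snd.eventually_re_ne_zero (k := c θ) rfl hc2 ((mul_eq_zero.1 hC).resolve_left hc) r2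
  have u1 := (Complex.continuous_re.tendsto p).eventually v1
  have u2 := (Complex.continuous_im.tendsto p).eventually v2
  filter_upwards [nhdsWithin_le_nhds u1, nhdsWithin_le_nhds u2, self_mem_nhdsWithin]
    with q q1 q2 hq h0
  obtain ⟨s1, s2⟩ := h.re_eq_zero_of_weight_eq_zero hb hc h0
  exact hq (Complex.ext (by_contra fun e => q1 e s1) (by_contra fun e => q2 e s2))

omit hψ hB hC in
theorem isClosed_weight_eq_zero : IsClosed {p | weight θ v w p = 0} :=
  isClosed_eq h.contDiff_weight.continuous continuous_const

omit hψ hB hC in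
/-- If `B = C = 0`, then the projections onto the lines spanned by `vecPos` and `vecNeg` extend
smoothly over the zeros of these vectors. -/
theorem exists_contDiff_extension (hB : (tripleProd y 0).im = 0) (hC : (tripleProd z 0).im = 0) :
    ∃ Q Q' : ℂ → EuclideanSpace ℂ (Fin 3) →L[ℂ] EuclideanSpace ℂ (Fin 3),
      ContDiff ℝ ∞ Q ∧ ContDiff ℝ ∞ Q' ∧ ∀ p, weight θ v w p ≠ 0 →
        Q p = projPos θ y z v w p ∧ Q' p = projNeg θ y z v w p := by
  obtain ⟨d, hd, hdy⟩ := h.fst.exists_real_structure hB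
  obtain ⟨e, he, hez⟩ := h.snd.exists_real_structure hC
  -- Since the product of the factors is one, the conjugated products obey the same reality
  -- condition as `y_j`.
  have hA : ∀ j s, d j * star (y (j + 1) s * y (j + 2) s) = y (j + 1) s * y (j + 2) s :=
    fun j s => by
      rw [star_mul', ← hdy, ← hdy]
      linear_combination (y (j + 1) s * y (j + 2) s) * hd j
  have hE : ∀ j t, e j * star (z (j + 1) t * z (j + 2) t) = z (j + 1) t * z (j + 2) t :=
    fun j t => by
      rw [star_mul', ← hez, ← hez]
      linear_combination (z (j + 1) t * z (j + 2) t) * he j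
  have hcross : ∀ p, weight θ v w p ≠ 0 → crossMap (fun j => d j * e j) (vec₀ y z p) =
      projPos θ y z v w p - projNeg θ y z v w p := fun p hp => by
    refine h.crossMap_eq hp (fun j => ?_) (fun j => ?_) (fun j => ?_)
    · simp only [vec₀, star_mul', ← hdy, ← hez]
      ring
    · have i1 := hA j p.re
      have i2 := hE j p.im
      have i3 := hdy j p.re
      have i4 := hez j p.im
      simp only [vecPos, vecNeg, star_add, star_mul', RCLike.star_def,
        Complex.conj_ofReal, Complex.conj_I, Complex.conj_conj] at i1 i2 i3 i4 ⊢
      rw [← i3, ← i4]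
      linear_combination (β θ j * e j * z j p.im) * i1 -
        (Complex.I * γ θ j * d j * y j p.re) * i2
    · have i1 := hA j p.re
      have i2 := hE j p.im
      have i3 := hdy j p.re
      have i4 := hez j p.im
      simp only [vecPos, vecNeg, star_sub, star_mul', RCLike.star_def,
        Complex.conj_ofReal, Complex.conj_I, Complex.conj_conj] at i1 i2 i3 i4 ⊢
      rw [← i3, ← i4]
      linear_combination (β θ j * e j * z j p.im) * i1 +
        (Complex.I * γ θ j * d j * y j p.re) * i2
  have hX := h.contDiff_crossMap fun j => d j * e j
  have h1 : ContDiff ℝ ∞ fun _ : ℂ => (1 : EuclideanSpace ℂ (Fin 3) →L[ℂ] EuclideanSpace ℂ (Fin 3)) :=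
    contDiff_const
  have h2 : ContDiff ℝ ∞ fun _ : ℂ => (2 : ℂ)⁻¹ := contDiff_const
  have hs : ∀ p, weight θ v w p ≠ 0 →
      1 - proj₀ y z p = projPos θ y z v w p + projNeg θ y z v w p := fun p hp => by
    ext1 x
    have := h.proj_sum hp x
    rw [sub_apply, add_apply, one_apply_eq_self, sub_eq_iff_eq_add]
    exact this.symm.trans (by abel)
  -- Off the zeros the sum of the two projections is `1 - P₀` and their difference is the cross map.
  -- Both expressions are smooth everywhere, so half their sum and half their difference are the
  -- extensions.
  refine ⟨fun p => (2 : ℂ)⁻¹ • (1 - proj₀ y z p + crossMap (fun j => d j * e j) (vec₀ y z p)),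
    fun p => (2 : ℂ)⁻¹ • (1 - proj₀ y z p - crossMap (fun j => d j * e j) (vec₀ y z p)),
    h2.smul ((h1.sub h.contDiff_proj₀).add hX), h2.smul ((h1.sub h.contDiff_proj₀).sub hX),
    fun p hp => ?_⟩
  simp only [hs p hp, hcross p hp]
  constructor <;> module

/-- If `b` or `c` is zero, the weight has no zeros and the projections are already smooth; only
otherwise, where `B = C = 0`, is the real structure needed. -/
theorem exists_harmonic_lines : ∃ f g : ℂ → CProj 3, IsHarmonicMap f ∧ IsHarmonicMap g ∧
    ∀ p, weight θ v w p ≠ 0 →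
      lineProj (f p) = projPos θ y z v w p ∧ lineProj (g p) = projNeg θ y z v w p := by
  have hQ : ∃ Q Q' : ℂ → EuclideanSpace ℂ (Fin 3) →L[ℂ] EuclideanSpace ℂ (Fin 3),
      ContDiff ℝ ∞ Q ∧ ContDiff ℝ ∞ Q' ∧ ∀ p, weight θ v w p ≠ 0 →
        Q p = projPos θ y z v w p ∧ Q' p = projNeg θ y z v w p := by
    by_cases hc : c θ = 0
    · have hW := h.weight_ne_zero_of_c_eq_zero hB hψ hc
      exact ⟨_, _, h.contDiff_projPos hW, h.contDiff_projNeg hW, fun _ _ => ⟨rfl, rfl⟩⟩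
    by_cases hb : b θ = 0
    · have hW := h.weight_ne_zero_of_b_eq_zero hC hψ hb
      exact ⟨_, _, h.contDiff_projPos hW, h.contDiff_projNeg hW, fun _ _ => ⟨rfl, rfl⟩⟩
    exact h.exists_contDiff_extension ((mul_eq_zero.1 hB).resolve_left hb)
      ((mul_eq_zero.1 hC).resolve_left hc)
  obtain ⟨Q, Q', hs, hs', he⟩ := hQ
  have hD := h.eventually_weight_ne_zero_punctured hB hC hψ
  obtain ⟨f, hf, hf'⟩ := exists_harmonic_extension hD h.isClosed_weight_eq_zero hs
    (fun p hp => (he p hp).1) (fun p hp => ⟨_, h.lineProj_vecPos (h.vecPos_ne_zero hp)⟩)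
    (fun p hp => h.commute_projPos hp)
  obtain ⟨g, hg, hg'⟩ := exists_harmonic_extension hD h.isClosed_weight_eq_zero hs'
    (fun p hp => (he p hp).2) (fun p hp => ⟨_, h.lineProj_vecNeg (h.vecNeg_ne_zero hp)⟩)
    (fun p hp => h.commute_projNeg hp)
  exact ⟨f, g, hf, hg, fun p hp => ⟨hf' p hp, hg' p hp⟩⟩

end

end IsData
end SLCone

/-! ### The sequence of three terms -/

namespace SLCone
variable {θ : ℝ} {y z : Fin 3 → ℝ → ℂ} {v w : ℝ → ℝ}

/-- The sequence of the three sections `phiNeg`, `phi₀`, `phiPos`. -/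
noncomputable def finiteSection (θ : ℝ) (y z : Fin 3 → ℝ → ℂ) (v w : ℝ → ℝ) (k : ℤ) :
    ℂ → EuclideanSpace ℂ (Fin 3) :=
  if k = -1 then phiNeg θ y z v w else if k = 0 then phi₀ y z
  else if k = 1 then phiPos θ y z else 0

theorem finiteSection_of_notMem {k : ℤ} (hk : k ∉ ({-1, 0, 1} : Set ℤ)) :
    finiteSection θ y z v w k = 0 := by
  simp only [Set.mem_insert_iff, Set.mem_singleton_iff, not_or] at hk
  rw [finiteSection, if_neg hk.1, if_neg hk.2.1, if_neg hk.2.2]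

/-- Three maps as a sequence. -/
def threeMaps {X : Type*} (g f₀ f : X) (k : ℤ) : X :=
  if k = -1 then g else if k = 1 then f else f₀

theorem mk_smul_eq {m : ℕ} {x u : EuclideanSpace ℂ (Fin m)} {a : ℂ} (hx : x ≠ 0) (hu : u ≠ 0)
    (e : u = a • x) : Projectivization.mk ℂ x hx = Projectivization.mk ℂ u hu := by
  refine ((Projectivization.mk_eq_mk_iff' ℂ u x hu hx).2 ⟨a, e.symm⟩).symm

namespace IsData
variable (h : IsData θ y z v w)
include h

theorem isHarmonicLift_finiteSection (hξ : period θ y z = 0)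
    (hD : ∀ p, ∀ᶠ q in nhdsWithin p {p}ᶜ, q ∉ {q | weight θ v w q = 0}) {f g : ℂ → CProj 3}
    (hf : ∀ p (hp : weight θ v w p ≠ 0), f p = Projectivization.mk ℂ _ (h.vecPos_ne_zero hp))
    (hg : ∀ p (hp : weight θ v w p ≠ 0), g p = Projectivization.mk ℂ _ (h.vecNeg_ne_zero hp)) :
    IsHarmonicLift {-1, 0, 1} {p | weight θ v w p = 0} (threeMaps g (psi h) f)
      (finiteSection θ y z v w) where
  discrete := hD
  closed := h.isClosed_weight_eq_zero
  smooth_zero := h.contDiff_phi₀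
  lift_zero p := ⟨h.phi₀_ne_zero p, mk_smul_eq _ _ rfl⟩
  smooth k hk := by
    obtain rfl | rfl | rfl := hk
    · exact h.contDiffOn_phiNeg
    · exact h.contDiff_phi₀.contDiffOn
    · exact h.contDiff_phiPos.contDiffOn
  lift k hk p hp := by
    obtain rfl | rfl | rfl := hk
    · exact ⟨h.phiNeg_ne_zero hp, (hg p hp).trans (mk_smul_eq _ _ rfl)⟩
    · exact ⟨h.phi₀_ne_zero p, mk_smul_eq _ _ rfl⟩
    · exact ⟨h.phiPos_ne_zero hp, (hf p hp).trans (mk_smul_eq _ _ rfl)⟩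
  outside k hk p := by rw [finiteSection_of_notMem hk, Pi.zero_apply]
  orthogonal k hk p hp := by
    obtain rfl | rfl | rfl := hk
    · exact h.inner_phiNeg_phi₀ p
    · exact h.inner_phi₀_phiPos p
    · exact inner_zero_right _
  dZ_eq k hk p hp := by
    obtain rfl | rfl | rfl := hk
    · have := h.dZ_phiNeg hp one_ne_zero
      simp only [one_smul] at this
      exact this
    · have := h.dZ_phi₀ hp one_ne_zero
      simp only [one_smul] at this
      exact this
    · have := h.dZ_phiPos hp one_ne_zero
      simp only [one_smul, hξ, zero_smul] at this
      exact this
  dZbar_eq k hk p hp := by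
    obtain rfl | rfl | rfl := hk
    -- The right side contains a division by `‖0‖ ^ 2`, which is harmless since it multiplies the
    -- zero vector.
    · have e : finiteSection θ y z v w (-1 - 1) p = 0 := rfl
      rw [e, smul_zero, neg_zero]
      refine (h.hasWirtinger_phiNeg hp).dZbar_eq.trans ?_
      rw [hξ, star_zero, zero_div, zero_smul, neg_zero]
    · have := h.dZbar_phi₀ hp one_ne_zero
      simp only [one_smul] at this
      exact this
    · have := h.dZbar_phiPos hp one_ne_zero
      simp only [one_smul] at this
      exact this

theorem isHarmonicSequenceWith_finiteSection (hξ : period θ y z = 0)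
    (hD : ∀ p, ∀ᶠ q in nhdsWithin p {p}ᶜ, q ∉ {q | weight θ v w q = 0}) {f g : ℂ → CProj 3}
    (hf' : IsHarmonicMap f) (hg' : IsHarmonicMap g)
    (hf : ∀ p (hp : weight θ v w p ≠ 0), f p = Projectivization.mk ℂ _ (h.vecPos_ne_zero hp))
    (hg : ∀ p (hp : weight θ v w p ≠ 0), g p = Projectivization.mk ℂ _ (h.vecNeg_ne_zero hp)) :
    IsHarmonicSequenceWith (psi h) {-1, 0, 1} {p | weight θ v w p = 0} (threeMaps g (psi h) f)
      (finiteSection θ y z v w) where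
  interval := by
    have : ({-1, 0, 1} : Set ℤ) = Set.Icc (-1) 1 := by
      ext k
      simp only [Set.mem_insert_iff, Set.mem_singleton_iff, Set.mem_Icc]
      omega
    rw [this]
    exact Set.ordConnected_Icc
  zero_mem := Or.inr (Or.inl rfl)
  zero := rfl
  harmonic k hk := by
    obtain rfl | rfl | rfl := hk
    · exact hg'
    · exact h.isHarmonicMap_psi
    · exact hf'
  isLift := h.isHarmonicLift_finiteSection hξ hD hf hg

end IsData
end SLCone

/-! ### The proposition -/

theorem proposition6p1 (θ : ℝ) (y z : Fin 3 → ℝ → ℂ) (v w : ℝ → ℝ)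
    (h : SLCone.IsData θ y z v w) (B C : ℝ)
    (hB : (y 0 0 * y 1 0 * y 2 0).im = B) (hC : (z 0 0 * z 1 0 * z 2 0).im = C) :
    (∀ s, (y 0 s * y 1 s * y 2 s).im = B) ∧
    (∀ t, (z 0 t * z 1 t * z 2 t).im = C) ∧
    (SLCone.b θ * B ≠ 0 ∨ SLCone.c θ * C ≠ 0 →
      IsSuperconformal (SLCone.psi h) ∧
      ∃ (Ψ : ℤ → ℂ → CProj 3) (φ : ℤ → ℂ → EuclideanSpace ℂ (Fin 3)),
        IsHarmonicSequenceWith (SLCone.psi h) Set.univ ∅ Ψ φ ∧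
        (∀ p, φ (-1) p = SLCone.phiNeg θ y z v w p) ∧
        (∀ p, φ 0 p = SLCone.phi₀ y z p) ∧
        (∀ p, φ 1 p = SLCone.phiPos θ y z p) ∧
        (∀ p, φ 2 p =
          (((SLCone.c θ * C : ℝ) : ℂ) - Complex.I * ((SLCone.b θ * B : ℝ) : ℂ)) • φ (-1) p) ∧
        (∀ k p, φ (k + 3) p =
          (((SLCone.c θ * C : ℝ) : ℂ) - Complex.I * ((SLCone.b θ * B : ℝ) : ℂ)) • φ k p) ∧
        ∀ (k : ℤ) (p : ℂ),
          (∃ hx : SLCone.vecNeg θ y z p ≠ 0,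
            Ψ (3 * k - 1) p = Projectivization.mk ℂ (SLCone.vecNeg θ y z p) hx) ∧
          (∃ hx : SLCone.vec₀ y z p ≠ 0,
            Ψ (3 * k) p = Projectivization.mk ℂ (SLCone.vec₀ y z p) hx) ∧
          (∃ hx : SLCone.vecPos θ y z p ≠ 0,
            Ψ (3 * k + 1) p = Projectivization.mk ℂ (SLCone.vecPos θ y z p) hx)) ∧
    (SLCone.b θ * B = 0 ∧ SLCone.c θ * C = 0 →
      IsIsotropic (SLCone.psi h) ∧
      ((¬ ∃ x, ∀ p, SLCone.psi h p = x) →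
        ∃ (Ψ : ℤ → ℂ → CProj 3) (φ : ℤ → ℂ → EuclideanSpace ℂ (Fin 3)),
          IsHarmonicSequenceWith (SLCone.psi h) {-1, 0, 1} {p | SLCone.weight θ v w p = 0} Ψ φ ∧
          (∀ p, SLCone.weight θ v w p ≠ 0 → φ (-1) p = SLCone.phiNeg θ y z v w p) ∧
          (∀ p, φ 0 p = SLCone.phi₀ y z p) ∧
          (∀ p, φ 1 p = SLCone.phiPos θ y z p) ∧
          (∀ p, Ψ 0 p = Projectivization.mk ℂ (SLCone.vec₀ y z p) (SLCone.vec₀_ne_zero h p)) ∧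
          ∀ p, SLCone.weight θ v w p ≠ 0 →
            (∃ hx : SLCone.vecNeg θ y z p ≠ 0,
              Ψ (-1) p = Projectivization.mk ℂ (SLCone.vecNeg θ y z p) hx) ∧
            (∃ hx : SLCone.vecPos θ y z p ≠ 0,
              Ψ 1 p = Projectivization.mk ℂ (SLCone.vecPos θ y z p) hx))) := by
  subst hB hC
  refine ⟨h.fst.tripleProd_im, h.snd.tripleProd_im, fun hBC => ?_, fun ⟨hB, hC⟩ => ?_⟩
  · have hW := h.weight_ne_zero hBC
    have hξ : SLCone.period θ y z ≠ 0 := fun h0 => by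
      have e1 := congrArg Complex.re h0
      have e2 := congrArg Complex.im h0
      simp only [SLCone.period, Complex.sub_re, Complex.sub_im,
        Complex.ofReal_re, Complex.ofReal_im, Complex.I_mul_re, Complex.I_mul_im, neg_zero,
        sub_zero, zero_sub, Complex.zero_re, Complex.zero_im, neg_eq_zero] at e1 e2
      exact hBC.elim (fun e => e e2) fun e => e e1
    have hs := h.isHarmonicSequenceWith_periodicSection hW hξ
    have e3 := SLCone.periodicSection_add_three (v := v) (w := w) hξ
    refine ⟨h.isSuperconformal_psi hW hξ, _, _, hs, fun p => ?_, fun p => ?_, fun p => ?_,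
      fun p => (congrArg (fun k => SLCone.periodicSection θ y z v w k p)
        (show (2 : ℤ) = -1 + 3 by norm_num)).trans (e3 (-1) p), e3, fun k p => ?_⟩
    · simpa using congrFun (SLCone.periodicSection_neg (θ := θ) (y := y) (z := z) 0) p
    · simpa using congrFun (SLCone.periodicSection_zero (θ := θ) (y := y) (z := z) 0) p
    · simpa using congrFun (SLCone.periodicSection_pos (θ := θ) (y := y) (z := z) 0) p
    · exact h.mk_periodicSection hW hξ k p
  · have hξ : SLCone.period θ y z = 0 := by
      have hB' : SLCone.b θ * (SLCone.tripleProd y 0).im = 0 := hB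
      have hC' : SLCone.c θ * (SLCone.tripleProd z 0).im = 0 := hC
      rw [SLCone.period, hB', hC']
      simp
    refine ⟨⟨h.isHarmonicMap_psi, h.not_isNonisotropic hξ⟩, fun hψ => ?_⟩
    obtain ⟨f, g, hf, hg, he⟩ := h.exists_harmonic_lines hB hC hψ
    -- The harmonic extensions were found only through their projections; a line is determined by
    -- its projection.
    have hf' : ∀ p (hp : SLCone.weight θ v w p ≠ 0),
        f p = Projectivization.mk ℂ _ (h.vecPos_ne_zero hp) := fun p hp =>
      lineProj_injective 3 ((he p hp).1.trans (h.lineProj_vecPos (h.vecPos_ne_zero hp)).symm)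
    have hg' : ∀ p (hp : SLCone.weight θ v w p ≠ 0),
        g p = Projectivization.mk ℂ _ (h.vecNeg_ne_zero hp) := fun p hp =>
      lineProj_injective 3 ((he p hp).2.trans (h.lineProj_vecNeg (h.vecNeg_ne_zero hp)).symm)
    exact ⟨_, _, h.isHarmonicSequenceWith_finiteSection hξ
      (h.eventually_weight_ne_zero_punctured hB hC hψ) hf hg hf' hg', fun _ _ => rfl,
      fun _ => rfl, fun _ => rfl, fun _ => rfl,
      fun p hp => ⟨⟨_, hg' p hp⟩, ⟨_, hf' p hp⟩⟩⟩
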